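/- \textbf{Language.} Types are $\theta ::= \mathtt{unit}\mid\mathtt{int}\mid\theta\times\theta\mid\theta\to\theta$; a type is \emph{ground} if it contains no arrow. There are pairwise disjoint sets of variables, references and method names, with countably infinitely many variables $x$ and references $r$ of each type and countably infinitely many method names $m$ of each arrow type; $\oplus$ ranges over a set of operators, each denoting a total function $\mathbb Z\times\mathbb Z\to\mathbb Z$. Terms and values of HORef are $$M ::= \mathtt{fail}\mid x\mid m\mid i\mid ()\mid r:=M\mid {!r}\mid M\oplus M\mid\langle M,M\rangle\mid\pi_1M\mid\pi_2M\mid x\,M\mid m\,M\mid \mathtt{if}\ M\ \mathtt{then}\ M\ \mathtt{else}\ M\mid\mathtt{let}\ x=M\ \mathtt{in}\ M\mid\mathtt{letrec}\ f=\lambda x.M\ \mathtt{in}\ M\mid\lambda x.M,$$ $$v ::= x\mid m\mid i\mid()\mid\langle v,v\rangle .$$ They are typed by the usual simple typing rules (conditions of $\mathtt{if}$ have type $\mathtt{int}$; each occurrence of $\mathtt{fail}$ is used at one fixed but arbitrary type, so that a typed term has a unique type), and are considered up to renaming of bound variables. A \emph{configuration} $(M,R,S,k)$ consists of a typed term $M$,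 a finite map $R$ (repository) from method names to $\lambda$-abstractions of the same type, a finite map $S$ (store) from references to values of the same type, and a bound $k\in\{\mathtt{nil}\}\cup\mathbb N$. It is \emph{valid} if all methods and references appearing in $M,R,S$ belong to $\mathrm{dom}(R)$ and $\mathrm{dom}(S)$ respectively. \textbf{Semantics.} Evaluation $(M,R,S,k)\Downarrow(\chi,R',S')$ of closed valid configurations, with $\chi$ a closed value, $\mathtt{fail}$ or $\mathtt{nil}$, is the call-by-value, left-to-right big-step semantics in which: $(M,R,S,\mathtt{nil})\Downarrow(\mathtt{nil},R,S)$; and, if $k\neq\mathtt{nil}$, $\mathtt{fail}$ evaluates to $\mathtt{fail}$ and a value to itself; $!r$ evaluates to $S(r)$; $\lambda x.M$ evaluates to any name $m\notin\mathrm{dom}(R)$ of its type, with repository $R[m\mapsto\lambda x.M]$; $r:=M$ evaluates $M$ to $v$ and yields $()$ with the store updated by $r\mapsto v$; $\oplus$, pairing, projections and $\mathtt{let}$ are as usual; $\mathtt{if}\ M\ \mathtt{then}\ M_1\ \mathtt{else}\ M_0$ continues with $M_0$ if $M$ evaluates to $0$, and with $M_1$ if it evaluates to another integer; $\mathtt{letrec}\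 f=\lambda x.M\ \mathtt{in}\ N$ evaluates $N\{m/f\}$ in the repository $R[m\mapsto\lambda x.M\{m/f\}]$ for any $m\notin\mathrm{dom}(R)$ of the type of $f$; and $m\,M$, where $R(m)=\lambda x.N$, evaluates $M$ to $v$ with bound $k$ and then $N\{v/x\}$ with bound $k-1$, where $0-1=\mathtt{nil}$. If the evaluation of a subterm yields $\mathtt{fail}$ or $\mathtt{nil}$, this outcome is propagated at once. \textbf{Formulas.} Formulas are quantifier-free, built from equations between expressions. Expressions are built from program variables, SSA variables $r_0,r_1,\dots$ for each reference $r$, method names, integers, $()$, $\mathtt{fail}$, $\mathtt{nil}$, operators, pairing and projections. Each variable ranges over the closed values of its type and the two further constants $\mathtt{fail},\mathtt{nil}$ (an equation with an undefined side, such as $\mathtt{fail}\oplus 1$, is false); distinct method names denote distinct objects. $\phi\Rightarrow\psi$ in (ii) below means that every such valuation satisfying $\phi$ satisfies $\psi$. Put $$F\,a\,b\,\phi=(a=\mathtt{fail}\Rightarrow b=\mathtt{fail})\wedge(a=\mathtt{nil}\Rightarrow b=\mathtt{nil})\wedge(a=\mathtt{fail}\vee a=\mathtt{nil}\vee\phi).$$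 \textbf{Translation.} SSA maps $C,D$ send each $r$ in the common domain $\Pi=\mathrm{dom}(S)$ to an SSA variable of $r$; $C[r]$ is $C$ with $C(r)=r_i$ replaced by $r_{i+1}$, and $C[\Pi]$ does this for all $r\in\Pi$; $(C=D)$ abbreviates $\bigwedge_{r\in\Pi}C(r)=D(r)$. The translation $[\![M,R,C,D,\phi,k]\!]=(ret,\phi',R',C',D')$ is defined as follows, where $ret$, $f'$ and $m$ in the rules for $\lambda$ and $\mathtt{letrec}$ are fresh, of the appropriate type, supplied by an arbitrary deterministic generator of fresh names. In every rule $ret$ is the returned variable. \begin{itemize} \item $k=\mathtt{nil}$: $(ret,\ ret=\mathtt{nil}\wedge\phi,\ R,C,D)$. In all other cases $k\ne\mathtt{nil}$. \item $\mathtt{fail},x,m,i,()$: $(ret,\ ret=M\wedge\phi,\ R,C,D)$. $\ {!r}$: $(ret,\ ret=D(r)\wedge\phi,\ R,C,D)$. $\ \lambda x.N$: $(ret,\ ret=m\wedge\phi,\ R[m\mapsto\lambda x.N],C,D)$. \item $\pi_jN$: with $[\![N,R,C,D,\phi,k]\!]=(ret_1,\phi_1,R_1,C_1,D_1)$, return $(ret,\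 F\,ret_1\,ret\,(ret=\pi_j\,ret_1)\wedge\phi_1,\ R_1,C_1,D_1)$. \item $r:=N$: with the same notation, $C_1'=C_1[r]$ and $D_1'=D_1[r\mapsto C_1'(r)]$, return $(ret,\ F\,ret_1\,ret\,(ret=()\wedge D_1'(r)=ret_1)\wedge\phi_1,\ R_1,C_1',D_1')$. \item $M_1\oplus M_2$ and $\langle M_1,M_2\rangle$: with $(ret_1,\phi_1,R_1,C_1,D_1)=[\![M_1,R,C,D,\phi,k]\!]$ and $(ret_2,\phi_2,R_2,C_2,D_2)=[\![M_2,R_1,C_1,D_1,\phi_1,k]\!]$, return $(ret,\ F\,ret_1\,ret\,(F\,ret_2\,ret\,(ret=e))\wedge\phi_2,\ R_2,C_2,D_2)$, with $e=ret_1\oplus ret_2$, respectively $e=\langle ret_1,ret_2\rangle$. \item $\mathtt{let}\ x=N\ \mathtt{in}\ N'$: as before with $N$ for $M_1$, $N'\{ret_1/x\}$ for $M_2$ and $e=ret_2$. $\ m\,N$ with $R(m)=\lambda x.N'$: the same, except that $N'\{ret_1/x\}$ is translated with bound $k-1$. \item $\mathtt{letrec}\ f=\lambda x.N\ \mathtt{in}\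 N'$: $[\![N'\{f'/f\},R[m\mapsto\lambda x.N\{f'/f\}],C,D,\phi\wedge f'=m,k]\!]$. \item $\mathtt{if}\ M_b\ \mathtt{then}\ M_1\ \mathtt{else}\ M_0$: let $(ret_b,\phi_b,R_b,C_b,D_b)=[\![M_b,R,C,D,\phi,k]\!]$, $(ret_0,\phi_0,R_0,C_0,D_0)=[\![M_0,R_b,C_b,D_b,\phi_b,k]\!]$, $(ret_1,\phi_1,R_1,C_1,D_1)=[\![M_1,R_0,C_0,D_b,\phi_0,k]\!]$, $C'=C_1[\Pi]$, $\psi_0=(ret_b=0\Rightarrow F\,ret_0\,ret\,(ret=ret_0\wedge (C'=D_0)))$, $\psi_1=(ret_b\ne0\Rightarrow F\,ret_1\,ret\,(ret=ret_1\wedge (C'=D_1)))$; return $(ret,\ F\,ret_b\,ret\,(\psi_0\wedge\psi_1)\wedge\phi_1,\ R_1,C',C')$. \item $x\,N$: let $(ret_0,\phi_0,R_0,C_0,D_0)=[\![N,R,C,D,\phi,k]\!]$ and let $m_1,\dots,m_n$ be the methods in $\mathrm{dom}(R)$ of the type of $x$, with $R(m_i)=\lambda y_i.N_i$. If $n=0$,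 return $(ret,\ ret=\mathtt{nil}\wedge\phi_0,\ R_0,C_0,D_0)$. Otherwise let $(ret_i,\phi_i,R_i,C_i,D_i)=[\![N_i\{ret_0/y_i\},R_{i-1},C_{i-1},D_0,\phi_{i-1},k-1]\!]$ for $i=1,\dots,n$, $C'=C_n[\Pi]$, $\psi=\bigwedge_{i=1}^n(x=m_i\Rightarrow F\,ret_i\,ret\,(ret=ret_i)\wedge (C'=D_i))$; return $(ret,\ F\,ret_0\,ret\,\psi\wedge\phi_n,\ R_n,C',C')$. \end{itemize} Finally $[\![M,R,S,k]\!]=[\![M,R,C_S,C_S,\phi_S,k]\!]$ with $C_S=\{r\mapsto r_0\mid r\in\mathrm{dom}(S)\}$ and $\phi_S=\bigwedge_{r\in\mathrm{dom}(S)}r_0=S(r)$. \textbf{Assignments and nominal equivalence.} An \emph{assignment} $\sigma$ is a finite map from variables to closed values of the same type; $(M,R,S,k)\{\sigma\}$ is obtained by substituting $\sigma$ in all components, and $[\![\sigma]\!]=\bigwedge_{x\in\mathrm{dom}(\sigma)}x=\sigma(x)$. For a set $\Delta$ of method names, $\chi\sim_\Delta\chi'$ means that $\pi\cdot\chi=\chi'$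 for some finite type-preserving permutation $\pi$ of the method names with $\pi(m)=m$ for all $m\in\Delta$. \textbf{Theorem (Soundness).} Let $(M,R,S,k)$ be a valid configuration of HORef whose free variables are all of ground type, and let $[\![M,R,S,k]\!]=(ret,\phi,R'',C,D)$. Let $\sigma_0$ be an assignment such that $(M,R,S,k)\{\sigma_0\}$ is closed and whose domain contains none of the fresh variables generated in the translation. Then for every $\chi'$ that is a closed value, $\mathtt{fail}$ or $\mathtt{nil}$, the following are equivalent: \begin{enumerate} \item[(i)] $(M,R,S,k)\{\sigma_0\}\Downarrow(\chi',R',S')$ for some $R',S'$; \item[(ii)] there is a $\chi\sim_{\mathrm{dom}(R)}\chi'$ such that $(\phi\wedge[\![\sigma_0]\!])\Rightarrow(ret=\chi)$. \end{enumerate} -/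

import Mathlib

namespace HORef

universe u

/-! ## Types, variables, references, methods -/

inductive Ty : Type
  | unit : Ty
  | int : Ty
  | prod : Ty → Ty → Ty
  | arr : Ty → Ty → Ty
  deriving DecidableEq

/-- Ground types: the types built without arrows. -/
def Ty.Ground : Ty → Prop
  | .unit => True
  | .int => True
  | .prod a b => a.Ground ∧ b.Ground
  | .arr _ _ => False

/-- Typed variables; there are countably many of each type. -/
structure Var : Type where
  name : ℕ
  ty : Ty
  deriving DecidableEq

/-- Typed (global) references; there are countably many of each type. -/
structure Ref : Type where
  name : ℕ
  ty : Ty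
  deriving DecidableEq

/-- Typed method names; there are countably many of each arrow type. -/
structure Meth : Type where
  name : ℕ
  dom : Ty
  cod : Ty
  deriving DecidableEq

def Meth.ty (m : Meth) : Ty := .arr m.dom m.cod

/-! ## Values and terms -/

inductive Val : Type
  | var : Var → Val
  | meth : Meth → Val
  | int : ℤ → Val
  | unit : Val
  | pair : Val → Val → Val

/-- Terms over a set `Op` of names for binary integer operators. Bound variables are named; terms
are representatives of their `α`-classes. The constant `fail` carries the type at which it is used,
so that every typable term has exactly one type. -/
inductive Term (Op : Type u) : Type u
  | fail : Ty → Term Op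
  | var : Var → Term Op
  | meth : Meth → Term Op
  | int : ℤ → Term Op
  | unit : Term Op
  | assign : Ref → Term Op → Term Op
  | deref : Ref → Term Op
  | arith : Op → Term Op → Term Op → Term Op
  | pair : Term Op → Term Op → Term Op
  | fst : Term Op → Term Op
  | snd : Term Op → Term Op
  | appVar : Var → Term Op → Term Op
  | appMeth : Meth → Term Op → Term Op
  /-- `ite M M₁ M₀` is `if M then M₁ else M₀` -/
  | ite : Term Op → Term Op → Term Op → Term Op
  /-- `letin x M N` is `let x = M in N` -/
  | letin : Var → Term Op → Term Op → Term Op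
  /-- `letrec f x M N` is `letrec f = λx.M in N` -/
  | letrec : Var → Var → Term Op → Term Op → Term Op
  | lam : Var → Term Op → Term Op

/-- A `λ`-abstraction `λ param. body`. -/
structure Lam (Op : Type u) : Type u where
  param : Var
  body : Term Op

def Lam.toTerm {Op : Type u} (L : Lam Op) : Term Op := .lam L.param L.body

def Val.toTerm {Op : Type u} : Val → Term Op
  | .var x => .var x
  | .meth m => .meth m
  | .int i => .int i
  | .unit => .unit
  | .pair v w => .pair v.toTerm w.toTerm

/-- The type of a value. -/
def Val.ty : Val → Ty
  | .var x => x.ty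
  | .meth m => m.ty
  | .int _ => .int
  | .unit => .unit
  | .pair v w => .prod v.ty w.ty

/-- Typing of terms. -/
inductive HasType {Op : Type u} : Term Op → Ty → Prop
  | fail (θ : Ty) : HasType (.fail θ) θ
  | var (x : Var) : HasType (.var x) x.ty
  | meth (m : Meth) : HasType (.meth m) m.ty
  | int (i : ℤ) : HasType (.int i) .int
  | unit : HasType .unit .unit
  | assign {r : Ref} {M : Term Op} : HasType M r.ty → HasType (.assign r M) .unit
  | deref (r : Ref) : HasType (.deref r) r.ty
  | arith {o : Op} {M N : Term Op} :
      HasType M .int → HasType N .int → HasType (.arith o M N) .int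
  | pair {M N : Term Op} {θ₁ θ₂ : Ty} :
      HasType M θ₁ → HasType N θ₂ → HasType (.pair M N) (.prod θ₁ θ₂)
  | fst {M : Term Op} {θ₁ θ₂ : Ty} : HasType M (.prod θ₁ θ₂) → HasType (.fst M) θ₁
  | snd {M : Term Op} {θ₁ θ₂ : Ty} : HasType M (.prod θ₁ θ₂) → HasType (.snd M) θ₂
  | appVar {x : Var} {M : Term Op} {θ θ' : Ty} :
      x.ty = .arr θ θ' → HasType M θ → HasType (.appVar x M) θ'
  | appMeth {m : Meth} {M : Term Op} : HasType M m.dom → HasType (.appMeth m M) m.cod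
  | ite {M M₁ M₀ : Term Op} {θ : Ty} :
      HasType M .int → HasType M₁ θ → HasType M₀ θ → HasType (.ite M M₁ M₀) θ
  | letin {x : Var} {M N : Term Op} {θ : Ty} :
      HasType M x.ty → HasType N θ → HasType (.letin x M N) θ
  | letrec {f x : Var} {M N : Term Op} {θ' θ'' : Ty} :
      f.ty = .arr x.ty θ' → HasType M θ' → HasType N θ'' → HasType (.letrec f x M N) θ''
  | lam {x : Var} {M : Term Op} {θ : Ty} : HasType M θ → HasType (.lam x M) (.arr x.ty θ)

/-- The type of a term, read off its syntax (a default value on untypable terms). -/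
def Term.ty {Op : Type u} : Term Op → Ty
  | .fail θ => θ
  | .var x => x.ty
  | .meth m => m.ty
  | .int _ => .int
  | .unit => .unit
  | .assign _ _ => .unit
  | .deref r => r.ty
  | .arith _ _ _ => .int
  | .pair M N => .prod M.ty N.ty
  | .fst M => match M.ty with
    | .prod a _ => a
    | _ => .unit
  | .snd M => match M.ty with
    | .prod _ b => b
    | _ => .unit
  | .appVar x _ => match x.ty with
    | .arr _ b => b
    | _ => .unit
  | .appMeth m _ => m.cod
  | .ite _ M₁ _ => M₁.ty
  | .letin _ _ N => N.ty
  | .letrec _ _ _ N => N.ty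
  | .lam x M => .arr x.ty M.ty

/-! ## Variables, methods and references occurring in a term -/

/-- Free variables. -/
def Val.fv : Val → Finset Var
  | .var x => {x}
  | .pair v w => v.fv ∪ w.fv
  | _ => ∅

def Val.meths : Val → Finset Meth
  | .meth m => {m}
  | .pair v w => v.meths ∪ w.meths
  | _ => ∅

section
variable {Op : Type u}

/-- Free variables. -/
def Term.fv : Term Op → Finset Var
  | .fail _ => ∅
  | .var x => {x}
  | .meth _ => ∅
  | .int _ => ∅
  | .unit => ∅
  | .assign _ M => M.fv
  | .deref _ => ∅
  | .arith _ M N => M.fv ∪ N.fv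
  | .pair M N => M.fv ∪ N.fv
  | .fst M => M.fv
  | .snd M => M.fv
  | .appVar x M => {x} ∪ M.fv
  | .appMeth _ M => M.fv
  | .ite M M₁ M₀ => M.fv ∪ M₁.fv ∪ M₀.fv
  | .letin x M N => M.fv ∪ N.fv.erase x
  | .letrec f x M N => (M.fv.erase x).erase f ∪ N.fv.erase f
  | .lam x M => M.fv.erase x

/-- All variables: free, bound and binding occurrences. -/
def Term.vars : Term Op → Finset Var
  | .fail _ => ∅
  | .var x => {x}
  | .meth _ => ∅
  | .int _ => ∅
  | .unit => ∅
  | .assign _ M => M.vars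
  | .deref _ => ∅
  | .arith _ M N => M.vars ∪ N.vars
  | .pair M N => M.vars ∪ N.vars
  | .fst M => M.vars
  | .snd M => M.vars
  | .appVar x M => {x} ∪ M.vars
  | .appMeth _ M => M.vars
  | .ite M M₁ M₀ => M.vars ∪ M₁.vars ∪ M₀.vars
  | .letin x M N => {x} ∪ M.vars ∪ N.vars
  | .letrec f x M N => {f, x} ∪ M.vars ∪ N.vars
  | .lam x M => {x} ∪ M.vars

def Term.meths : Term Op → Finset Meth
  | .fail _ => ∅
  | .var _ => ∅
  | .meth m => {m}
  | .int _ => ∅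
  | .unit => ∅
  | .assign _ M => M.meths
  | .deref _ => ∅
  | .arith _ M N => M.meths ∪ N.meths
  | .pair M N => M.meths ∪ N.meths
  | .fst M => M.meths
  | .snd M => M.meths
  | .appVar _ M => M.meths
  | .appMeth m M => {m} ∪ M.meths
  | .ite M M₁ M₀ => M.meths ∪ M₁.meths ∪ M₀.meths
  | .letin _ M N => M.meths ∪ N.meths
  | .letrec _ _ M N => M.meths ∪ N.meths
  | .lam _ M => M.meths

def Term.refs : Term Op → Finset Ref
  | .fail _ => ∅
  | .var _ => ∅
  | .meth _ => ∅
  | .int _ => ∅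
  | .unit => ∅
  | .assign r M => {r} ∪ M.refs
  | .deref r => {r}
  | .arith _ M N => M.refs ∪ N.refs
  | .pair M N => M.refs ∪ N.refs
  | .fst M => M.refs
  | .snd M => M.refs
  | .appVar _ M => M.refs
  | .appMeth _ M => M.refs
  | .ite M M₁ M₀ => M.refs ∪ M₁.refs ∪ M₀.refs
  | .letin _ M N => M.refs ∪ N.refs
  | .letrec _ _ M N => M.refs ∪ N.refs
  | .lam _ M => M.refs

end

/-! ## Substitution -/

/-- A (simultaneous) substitution of values for variables; `none` leaves the variable alone. -/
abbrev Subst : Type := Var → Option Val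

/-- The substitution `{v/x}`. -/
def Subst.single (x : Var) (v : Val) : Subst := fun y => if y = x then some v else none

/-- Forget what the substitution does to `x` (used below a binder of `x`). -/
def Subst.drop (s : Subst) (x : Var) : Subst := fun y => if y = x then none else s y

def Val.subst (s : Subst) : Val → Val
  | .var x => (s x).getD (.var x)
  | .meth m => .meth m
  | .int i => .int i
  | .unit => .unit
  | .pair v w => .pair (v.subst s) (w.subst s)

section
variable {Op : Type u}

/-- `M{s}`. Only closed values, and variables that do not occur in `M` at all, are ever
substituted, so that no variable can be captured. -/
def Term.subst (s : Subst) : Term Op → Term Op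
  | .fail θ => .fail θ
  | .var x => match s x with
    | some v => v.toTerm
    | none => .var x
  | .meth m => .meth m
  | .int i => .int i
  | .unit => .unit
  | .assign r M => .assign r (M.subst s)
  | .deref r => .deref r
  | .arith o M N => .arith o (M.subst s) (N.subst s)
  | .pair M N => .pair (M.subst s) (N.subst s)
  | .fst M => .fst (M.subst s)
  | .snd M => .snd (M.subst s)
  | .appVar x M => match s x with
    | some (.meth m) => .appMeth m (M.subst s)
    | some (.var y) => .appVar y (M.subst s)
    -- other values do not have an arrow type
    | some _ => .appVar x (M.subst s)
    | none => .appVar x (M.subst s)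
  | .appMeth m M => .appMeth m (M.subst s)
  | .ite M M₁ M₀ => .ite (M.subst s) (M₁.subst s) (M₀.subst s)
  | .letin x M N => .letin x (M.subst s) (N.subst (s.drop x))
  | .letrec f x M N => .letrec f x (M.subst ((s.drop f).drop x)) (N.subst (s.drop f))
  | .lam x M => .lam x (M.subst (s.drop x))

/-- `M{v/x}` -/
def Term.subst1 (M : Term Op) (x : Var) (v : Val) : Term Op := M.subst (Subst.single x v)

def Lam.subst (s : Subst) (L : Lam Op) : Lam Op := ⟨L.param, L.body.subst (s.drop L.param)⟩

def Lam.subst1 (L : Lam Op) (x : Var) (v : Val) : Lam Op := L.subst (Subst.single x v)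

end

/-! ## Repositories, stores, configurations -/

/-- Method repositories: finite maps from method names to `λ`-abstractions. -/
abbrev Repo (Op : Type u) : Type u := Finmap (fun _ : Meth => Lam Op)

/-- Stores: finite maps from references to values. -/
abbrev Store : Type := Finmap (fun _ : Ref => Val)

/-- Assignments: finite maps from variables to values (see `Assignment.Proper`). -/
abbrev Assignment : Type := Finmap (fun _ : Var => Val)

/-- Apply a function to all the values of a finite map. -/
def mapVals {K : Type} {V W : Type*} (f : V → W) (s : Finmap (fun _ : K => V)) :
    Finmap (fun _ : K => W) where
  entries := s.entries.map (Sigma.map id (fun _ => f))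
  nodupKeys := by
    rw [← Multiset.nodup_keys]
    have h := Multiset.nodup_keys.mpr s.nodupKeys
    have e : (s.entries.map (Sigma.map id (fun (_ : K) => f)) :
        Multiset (Sigma fun _ : K => W)).keys = s.entries.keys := by
      simp only [Multiset.keys, Multiset.map_map]
      rfl
    rw [e]; exact h

/-- The union of the finite sets attached to the values of a finite map. -/
def gather {K A : Type} {V : Type*} [DecidableEq K] [DecidableEq A] (f : V → Finset A)
    (s : Finmap (fun _ : K => V)) : Finset A :=
  s.keys.biUnion fun k => match s.lookup k with
    | some v => f v
    | none => ∅

/-- Configurations `(M, R, S, k)`. The bound ranges over `{nil} ∪ ℕ`, with `none` for `nil`. -/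
structure Config (Op : Type u) : Type u where
  term : Term Op
  repo : Repo Op
  store : Store
  bound : Option ℕ

/-- The decremented bound `k - 1`, with `0 - 1 = nil`. -/
def predBound : Option ℕ → Option ℕ
  | some (n + 1) => some n
  | _ => none

section
variable {Op : Type u}

def Lam.fv (L : Lam Op) : Finset Var := L.body.fv.erase L.param

def Lam.vars (L : Lam Op) : Finset Var := {L.param} ∪ L.body.vars

/-- The free variables of a configuration. -/
def Config.fv (K : Config Op) : Finset Var :=
  K.term.fv ∪ gather Lam.fv K.repo ∪ gather Val.fv K.store

/-- All the variables of a configuration, free or bound. -/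
def Config.vars (K : Config Op) : Finset Var :=
  K.term.vars ∪ gather Lam.vars K.repo ∪ gather Val.fv K.store

/-- All components are closed. -/
def Config.Closed (K : Config Op) : Prop := K.fv = ∅

/-- The configuration is typed, and all methods and references appearing in it are in the domains
of the repository and of the store. -/
structure Config.Valid (K : Config Op) : Prop where
  term_typed : ∃ θ, HasType K.term θ
  repo_typed : ∀ m L, K.repo.lookup m = some L → HasType L.toTerm m.ty
  store_typed : ∀ r v, K.store.lookup r = some v → v.ty = r.ty
  term_meths : K.term.meths ⊆ K.repo.keys
  repo_meths : ∀ m L, K.repo.lookup m = some L → L.body.meths ⊆ K.repo.keys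
  store_meths : ∀ r v, K.store.lookup r = some v → v.meths ⊆ K.repo.keys
  term_refs : K.term.refs ⊆ K.store.keys
  repo_refs : ∀ m L, K.repo.lookup m = some L → L.body.refs ⊆ K.store.keys

/-- Assignments map variables to closed values of the same type. -/
def Assignment.Proper (σ : Assignment) : Prop :=
  ∀ x v, σ.lookup x = some v → v.fv = ∅ ∧ v.ty = x.ty

def Assignment.toSubst (σ : Assignment) : Subst := fun x => σ.lookup x

/-- `(M, R, S, k){σ}` -/
def Config.apply (K : Config Op) (σ : Assignment) : Config Op where
  term := K.term.subst σ.toSubst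
  repo := mapVals (Lam.subst σ.toSubst) K.repo
  store := mapVals (Val.subst σ.toSubst) K.store
  bound := K.bound

end

/-! ## Bounded big-step semantics -/

/-- Outcomes of evaluation: elements of `Vals ∪ {fail, nil}`. -/
inductive Outcome : Type
  | val : Val → Outcome
  | fail : Outcome
  | nil : Outcome

/-- The outcome is in `{fail, nil}`. -/
def Outcome.Aborts : Outcome → Prop
  | .val _ => False
  | .fail => True
  | .nil => True

/-- The outcome is a closed value, `fail` or `nil`. -/
def Outcome.Closed : Outcome → Prop
  | .val v => v.fv = ∅
  | .fail => True
  | .nil => True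

/-- `Eval I M R S k χ R' S'` is `(M, R, S, k) ⇓ (χ, R', S')`, where `I` interprets the operators.
The last premise of the rules for `let`, application, `if` and `letrec` has an arbitrary outcome:
each of these is the evaluating and the aborting rule in one. -/
inductive Eval {Op : Type u} (I : Op → ℤ → ℤ → ℤ) :
    Term Op → Repo Op → Store → Option ℕ → Outcome → Repo Op → Store → Prop
  | nil {M R S} : Eval I M R S none .nil R S
  | fail {θ R S} {k : ℕ} : Eval I (.fail θ) R S (some k) .fail R S
  | val {v : Val} {R S} {k : ℕ} : Eval I v.toTerm R S (some k) (.val v) R S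
  | deref {r : Ref} {v : Val} {R} {S : Store} {k : ℕ} : S.lookup r = some v →
      Eval I (.deref r) R S (some k) (.val v) R S
  | lam {x : Var} {M : Term Op} {m : Meth} {R : Repo Op} {S} {k : ℕ} :
      m ∉ R → HasType (.lam x M) m.ty →
      Eval I (.lam x M) R S (some k) (.val (.meth m)) (R.insert m ⟨x, M⟩) S
  | fst {M : Term Op} {v w : Val} {R S R' S'} {k : ℕ} :
      Eval I M R S (some k) (.val (.pair v w)) R' S' →
      Eval I (.fst M) R S (some k) (.val v) R' S'
  | fst_abort {M : Term Op} {χ : Outcome} {R S R' S'} {k : ℕ} : χ.Aborts →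
      Eval I M R S (some k) χ R' S' → Eval I (.fst M) R S (some k) χ R' S'
  | snd {M : Term Op} {v w : Val} {R S R' S'} {k : ℕ} :
      Eval I M R S (some k) (.val (.pair v w)) R' S' →
      Eval I (.snd M) R S (some k) (.val w) R' S'
  | snd_abort {M : Term Op} {χ : Outcome} {R S R' S'} {k : ℕ} : χ.Aborts →
      Eval I M R S (some k) χ R' S' → Eval I (.snd M) R S (some k) χ R' S'
  | assign {r : Ref} {M : Term Op} {v : Val} {R S R'} {S' : Store} {k : ℕ} :
      Eval I M R S (some k) (.val v) R' S' →
      Eval I (.assign r M) R S (some k) (.val .unit) R' (S'.insert r v)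
  | assign_abort {r : Ref} {M : Term Op} {χ : Outcome} {R S R' S'} {k : ℕ} : χ.Aborts →
      Eval I M R S (some k) χ R' S' → Eval I (.assign r M) R S (some k) χ R' S'
  | arith {o : Op} {M₁ M₂ : Term Op} {i₁ i₂ : ℤ} {R S R₁ S₁ R₂ S₂} {k : ℕ} :
      Eval I M₁ R S (some k) (.val (.int i₁)) R₁ S₁ →
      Eval I M₂ R₁ S₁ (some k) (.val (.int i₂)) R₂ S₂ →
      Eval I (.arith o M₁ M₂) R S (some k) (.val (.int (I o i₁ i₂))) R₂ S₂
  | arith_abort₁ {o : Op} {M₁ M₂ : Term Op} {χ : Outcome} {R S R₁ S₁} {k : ℕ} : χ.Aborts →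
      Eval I M₁ R S (some k) χ R₁ S₁ → Eval I (.arith o M₁ M₂) R S (some k) χ R₁ S₁
  | arith_abort₂ {o : Op} {M₁ M₂ : Term Op} {i₁ : ℤ} {χ : Outcome} {R S R₁ S₁ R₂ S₂} {k : ℕ} :
      χ.Aborts → Eval I M₁ R S (some k) (.val (.int i₁)) R₁ S₁ →
      Eval I M₂ R₁ S₁ (some k) χ R₂ S₂ → Eval I (.arith o M₁ M₂) R S (some k) χ R₂ S₂
  | pair {M₁ M₂ : Term Op} {v₁ v₂ : Val} {R S R₁ S₁ R₂ S₂} {k : ℕ} :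
      Eval I M₁ R S (some k) (.val v₁) R₁ S₁ → Eval I M₂ R₁ S₁ (some k) (.val v₂) R₂ S₂ →
      Eval I (.pair M₁ M₂) R S (some k) (.val (.pair v₁ v₂)) R₂ S₂
  | pair_abort₁ {M₁ M₂ : Term Op} {χ : Outcome} {R S R₁ S₁} {k : ℕ} : χ.Aborts →
      Eval I M₁ R S (some k) χ R₁ S₁ → Eval I (.pair M₁ M₂) R S (some k) χ R₁ S₁
  | pair_abort₂ {M₁ M₂ : Term Op} {v₁ : Val} {χ : Outcome} {R S R₁ S₁ R₂ S₂} {k : ℕ} :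
      χ.Aborts → Eval I M₁ R S (some k) (.val v₁) R₁ S₁ →
      Eval I M₂ R₁ S₁ (some k) χ R₂ S₂ → Eval I (.pair M₁ M₂) R S (some k) χ R₂ S₂
  | letin {x : Var} {M N : Term Op} {v : Val} {χ : Outcome} {R S R' S' R'' S''} {k : ℕ} :
      Eval I M R S (some k) (.val v) R' S' → Eval I (N.subst1 x v) R' S' (some k) χ R'' S'' →
      Eval I (.letin x M N) R S (some k) χ R'' S''
  | letin_abort {x : Var} {M N : Term Op} {χ : Outcome} {R S R' S'} {k : ℕ} : χ.Aborts →
      Eval I M R S (some k) χ R' S' → Eval I (.letin x M N) R S (some k) χ R' S'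
  | app {m : Meth} {M : Term Op} {L : Lam Op} {v : Val} {χ : Outcome}
      {R : Repo Op} {S R' S' R'' S''} {k : ℕ} : R.lookup m = some L →
      Eval I M R S (some k) (.val v) R' S' →
      Eval I (L.body.subst1 L.param v) R' S' (predBound (some k)) χ R'' S'' →
      Eval I (.appMeth m M) R S (some k) χ R'' S''
  | app_abort {m : Meth} {M : Term Op} {χ : Outcome} {R S R' S'} {k : ℕ} : χ.Aborts →
      Eval I M R S (some k) χ R' S' → Eval I (.appMeth m M) R S (some k) χ R' S'
  | ite {M M₁ M₀ : Term Op} {i : ℤ} {χ : Outcome} {R S R' S' R'' S''} {k : ℕ} :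
      Eval I M R S (some k) (.val (.int i)) R' S' →
      Eval I (if i = 0 then M₀ else M₁) R' S' (some k) χ R'' S'' →
      Eval I (.ite M M₁ M₀) R S (some k) χ R'' S''
  | ite_abort {M M₁ M₀ : Term Op} {χ : Outcome} {R S R' S'} {k : ℕ} : χ.Aborts →
      Eval I M R S (some k) χ R' S' → Eval I (.ite M M₁ M₀) R S (some k) χ R' S'
  | letrec {f x : Var} {M N : Term Op} {m : Meth} {χ : Outcome} {R : Repo Op} {S R' S'} {k : ℕ} :
      m ∉ R → m.ty = f.ty →
      Eval I (N.subst1 f (.meth m)) (R.insert m ((Lam.mk x M).subst1 f (.meth m))) S (some k)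
        χ R' S' →
      Eval I (.letrec f x M N) R S (some k) χ R' S'

/-! ## Nominal equivalence -/

/-- Finite type-preserving permutations of method names. -/
structure IsNamePerm (π : Equiv.Perm Meth) : Prop where
  ty_eq : ∀ m, (π m).ty = m.ty
  finite : {m | π m ≠ m}.Finite

def Val.perm (π : Equiv.Perm Meth) : Val → Val
  | .var x => .var x
  | .meth m => .meth (π m)
  | .int i => .int i
  | .unit => .unit
  | .pair v w => .pair (v.perm π) (w.perm π)

def Outcome.perm (π : Equiv.Perm Meth) : Outcome → Outcome
  | .val v => .val (v.perm π)
  | .fail => .fail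
  | .nil => .nil

/-- `χ ∼_Δ χ'` -/
def NomEquiv (Δ : Finset Meth) (χ χ' : Outcome) : Prop :=
  ∃ π : Equiv.Perm Meth, IsNamePerm π ∧ χ.perm π = χ' ∧ ∀ m ∈ Δ, π m = m

/-! ## Formulas -/

/-- Variables of formulas: program variables (these include the return variables), and the SSA
variables `r_i` of the references `r`. -/
inductive FVar : Type
  | prog : Var → FVar
  | ssa : Ref → ℕ → FVar

def FVar.ty : FVar → Ty
  | .prog x => x.ty
  | .ssa r _ => r.ty

/-- Expressions of formulas. -/
inductive Expr (Op : Type u) : Type u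
  | var : FVar → Expr Op
  | meth : Meth → Expr Op
  | int : ℤ → Expr Op
  | unit : Expr Op
  | fail : Expr Op
  | nil : Expr Op
  | arith : Op → Expr Op → Expr Op → Expr Op
  | pair : Expr Op → Expr Op → Expr Op
  | fst : Expr Op → Expr Op
  | snd : Expr Op → Expr Op

/-- Quantifier-free formulas. -/
inductive Form (Op : Type u) : Type u
  | eq : Expr Op → Expr Op → Form Op
  | top : Form Op
  | not : Form Op → Form Op
  | and : Form Op → Form Op → Form Op
  | or : Form Op → Form Op → Form Op
  | imp : Form Op → Form Op → Form Op

/-- Extended assignments (total ones): every variable gets a value, `fail` or `nil`. -/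
abbrev Valuation : Type := FVar → Outcome

/-- The values assigned to variables are closed and of the right type. -/
def Valuation.Proper (ρ : Valuation) : Prop :=
  ∀ x v, ρ x = .val v → v.fv = ∅ ∧ v.ty = x.ty

section
variable {Op : Type u}

def Val.toExpr : Val → Expr Op
  | .var x => .var (.prog x)
  | .meth m => .meth m
  | .int i => .int i
  | .unit => .unit
  | .pair v w => .pair v.toExpr w.toExpr

def Outcome.toExpr : Outcome → Expr Op
  | .val v => v.toExpr
  | .fail => .fail
  | .nil => .nil

/-- The denotation of an expression. Operators, pairing and projections are undefined (`none`) on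
arguments of the wrong shape, in particular on `fail` and `nil`. -/
def Expr.eval (I : Op → ℤ → ℤ → ℤ) (ρ : Valuation) : Expr Op → Option Outcome
  | .var x => some (ρ x)
  | .meth m => some (.val (.meth m))
  | .int i => some (.val (.int i))
  | .unit => some (.val .unit)
  | .fail => some .fail
  | .nil => some .nil
  | .arith o a b => match a.eval I ρ, b.eval I ρ with
    | some (.val (.int i)), some (.val (.int j)) => some (.val (.int (I o i j)))
    | _, _ => none
  | .pair a b => match a.eval I ρ, b.eval I ρ with
    | some (.val v), some (.val w) => some (.val (.pair v w))
    | _, _ => none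
  | .fst a => match a.eval I ρ with
    | some (.val (.pair v _)) => some (.val v)
    | _ => none
  | .snd a => match a.eval I ρ with
    | some (.val (.pair _ w)) => some (.val w)
    | _ => none

/-- Truth of a formula; an equation holds if both sides are defined and equal. -/
def Form.Holds (I : Op → ℤ → ℤ → ℤ) (ρ : Valuation) : Form Op → Prop
  | .eq a b => ∃ o, a.eval I ρ = some o ∧ b.eval I ρ = some o
  | .top => True
  | .not φ => ¬ φ.Holds I ρ
  | .and φ ψ => φ.Holds I ρ ∧ ψ.Holds I ρ
  | .or φ ψ => φ.Holds I ρ ∨ ψ.Holds I ρ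
  | .imp φ ψ => φ.Holds I ρ → ψ.Holds I ρ

/-- `φ ⟹ ψ` is valid. -/
def Form.Entails (I : Op → ℤ → ℤ → ℤ) (φ ψ : Form Op) : Prop :=
  ∀ ρ : Valuation, ρ.Proper → φ.Holds I ρ → ψ.Holds I ρ

/-- Finite conjunctions. -/
def Form.conj : List (Form Op) → Form Op
  | [] => .top
  | φ :: l => .and φ (Form.conj l)

/-- The formula `⟦σ⟧`: the conjunction of the equations `x = σ(x)`. -/
noncomputable def Assignment.form (σ : Assignment) : Form Op :=
  Form.conj (σ.entries.toList.map fun e => .eq (.var (.prog e.1)) e.2.toExpr)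

/-- The guard `F a b φ`, which propagates `fail` and `nil` from `a` to `b`. -/
def Form.guard (a b : Expr Op) (φ : Form Op) : Form Op :=
  .and (.and (.imp (.eq a .fail) (.eq b .fail)) (.imp (.eq a .nil) (.eq b .nil)))
    (.or (.or (.eq a .fail) (.eq a .nil)) φ)

end

/-! ## The bounded translation -/

/-- A deterministic generator of fresh variables and method names of given types: it is told the
finite set of the objects that are already in use. -/
structure FreshGen : Type where
  var : Finset Var → Ty → Var
  var_fresh : ∀ U θ, var U θ ∉ U
  var_ty : ∀ U θ, (var U θ).ty = θ
  meth : Finset Meth → Ty → Ty → Meth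
  meth_fresh : ∀ U θ θ', meth U θ θ' ∉ U
  meth_ty : ∀ U θ θ', (meth U θ θ').ty = .arr θ θ'

instance : Nonempty FreshGen := by
  have hv : ∀ (U : Finset Var) (θ : Ty), ∃ x : Var, x ∉ U ∧ x.ty = θ := by
    intro U θ
    obtain ⟨n, hn⟩ := Infinite.exists_notMem_finset (U.image Var.name)
    exact ⟨⟨n, θ⟩, fun h => hn (Finset.mem_image.mpr ⟨_, h, rfl⟩), rfl⟩
  have hm : ∀ (U : Finset Meth) (θ θ' : Ty), ∃ m : Meth, m ∉ U ∧ m.ty = .arr θ θ' := by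
    intro U θ θ'
    obtain ⟨n, hn⟩ := Infinite.exists_notMem_finset (U.image Meth.name)
    exact ⟨⟨n, θ, θ'⟩, fun h => hn (Finset.mem_image.mpr ⟨_, h, rfl⟩), rfl⟩
  choose f hf₁ hf₂ using hv
  choose g hg₁ hg₂ using hm
  exact ⟨⟨f, hf₁, hf₂, g, hg₁, hg₂⟩⟩

/-- SSA maps; the index `i` at `r` stands for the SSA variable `r_i`. -/
abbrev SSAMap : Type := Finmap (fun _ : Ref => ℕ)

/-- The index of `C(r)`. -/
def SSAMap.idx (C : SSAMap) (r : Ref) : ℕ := (C.lookup r).getD 0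

/-- `C[r]`: increment the index of `r`. -/
def SSAMap.bump (C : SSAMap) (r : Ref) : SSAMap := C.insert r (C.idx r + 1)

/-- `C[r₁]⋯[rₙ]`, where the `rᵢ` enumerate the domain of `C`. -/
def SSAMap.bumpAll (C : SSAMap) : SSAMap := mapVals (fun i : ℕ => i + 1) C

/-- Results `(ret, φ, R, C, D)` of the translation. The additional component `used` is the set of
the program variables used so far, which serves the generation of fresh variables. -/
structure Result (Op : Type u) : Type u where
  ret : Var
  form : Form Op
  repo : Repo Op
  C : SSAMap
  D : SSAMap
  used : Finset Var

/-- The translation at some bound, as a function of `M`, `R`, `C`, `D`, `φ` and of the variables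
used so far. -/
abbrev Translator (Op : Type u) : Type u :=
  Term Op → Repo Op → SSAMap → SSAMap → Form Op → Finset Var → Result Op

section
variable {Op : Type u}

/-- The expression consisting of a program variable. -/
def pv (x : Var) : Expr Op := .var (.prog x)

/-- The expression consisting of the SSA variable `D(r)`. -/
def SSAMap.expr (D : SSAMap) (r : Ref) : Expr Op := .var (.ssa r (D.idx r))

/-- The conjunction over all `r` in the common domain of the equations `C(r) = D(r)`. -/
noncomputable def SSAMap.join (C D : SSAMap) : Form Op :=
  Form.conj (C.keys.toList.map fun r => .eq (C.expr r) (D.expr r))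

/-- Return the expression `e` in a fresh variable of type `θ`. -/
def retExpr (G : FreshGen) (θ : Ty) (e : Expr Op) (R : Repo Op) (C D : SSAMap) (φ : Form Op)
    (U : Finset Var) : Result Op :=
  let ret := G.var U θ
  ⟨ret, .and (.eq (pv ret) e) φ, R, C, D, insert ret U⟩

/-- The translation at bound `nil`. -/
def transNil (G : FreshGen) : Translator Op := fun M R C D φ U =>
  retExpr G M.ty .nil R C D φ U

/-- `R ↾ θ`: the methods of type `θ` in the repository, listed in some order. -/
noncomputable def Repo.restrict (R : Repo Op) (θ : Ty) : List Meth :=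
  (R.keys.filter fun m => m.ty = θ).toList

/-- Translate successively the application of the methods in a list (with bodies taken from `R`) to
the variable `ret₀`, by the translator `call`. All calls read the store from `D₀`; the repository,
`C`, the formula and the used variables are threaded through. The results are listed along with
the corresponding methods. -/
def callAll (call : Translator Op) (R : Repo Op) (ret₀ : Var) (D₀ : SSAMap) :
    List Meth → Repo Op → SSAMap → Form Op → Finset Var → List (Meth × Result Op)
  | [], _, _, _, _ => []
  | m :: l, R', C', φ', U' => match R.lookup m with
    | none => callAll call R ret₀ D₀ l R' C' φ' U'
    | some L =>
      let t := call (L.body.subst1 L.param (.var ret₀)) R' C' D₀ φ' U'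
      (m, t) :: callAll call R ret₀ D₀ l t.repo t.C t.form t.used

/-- A size for terms, which renaming preserves. -/
def Term.size : Term Op → ℕ
  | .assign _ M => M.size + 1
  | .arith _ M N => M.size + N.size + 1
  | .pair M N => M.size + N.size + 1
  | .fst M => M.size + 1
  | .snd M => M.size + 1
  | .appVar _ M => M.size + 1
  | .appMeth _ M => M.size + 1
  | .ite M M₁ M₀ => M.size + M₁.size + M₀.size + 1
  | .letin _ M N => M.size + N.size + 1
  | .letrec _ _ M N => M.size + N.size + 1
  | .lam _ M => M.size + 1
  | _ => 1

theorem Term.size_subst_of_renaming (M : Term Op) :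
    ∀ s : Subst, (∀ x v, s x = some v → ∃ y, v = .var y) → (M.subst s).size = M.size := by
  have hd : ∀ (s : Subst) (z : Var), (∀ x v, s x = some v → ∃ y, v = .var y) →
      ∀ x v, (s.drop z) x = some v → ∃ y, v = .var y := by
    intro s z h x v hx
    unfold Subst.drop at hx
    split_ifs at hx
    exact h x v hx
  induction M with
  | var x =>
    intro s h
    simp only [Term.subst]
    split
    · rename_i v hv
      obtain ⟨y, rfl⟩ := h x v hv
      rfl
    · rfl
  | appVar x M ih =>
    intro s h
    simp only [Term.subst]
    split <;> simp [Term.size, ih s h]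
  | letin x M N ih₁ ih₂ =>
    intro s h
    simp [Term.subst, Term.size, ih₁ s h, ih₂ _ (hd s x h)]
  | letrec f x M N ih₁ ih₂ =>
    intro s h
    simp [Term.subst, Term.size, ih₁ _ (hd _ x (hd s f h)), ih₂ _ (hd s f h)]
  | lam x M ih =>
    intro s h
    simp [Term.subst, Term.size, ih _ (hd s x h)]
  | assign r M ih => intro s h; simp [Term.subst, Term.size, ih s h]
  | arith o M N ih₁ ih₂ => intro s h; simp [Term.subst, Term.size, ih₁ s h, ih₂ s h]
  | pair M N ih₁ ih₂ => intro s h; simp [Term.subst, Term.size, ih₁ s h, ih₂ s h]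
  | fst M ih => intro s h; simp [Term.subst, Term.size, ih s h]
  | snd M ih => intro s h; simp [Term.subst, Term.size, ih s h]
  | appMeth m M ih => intro s h; simp [Term.subst, Term.size, ih s h]
  | ite M M₁ M₀ ih ih₁ ih₀ => intro s h; simp [Term.subst, Term.size, ih s h, ih₁ s h, ih₀ s h]
  | _ => intro s h; simp [Term.subst, Term.size]

theorem Term.size_subst1_var (M : Term Op) (x y : Var) : (M.subst1 x (.var y)).size = M.size := by
  apply Term.size_subst_of_renaming
  intro z v h
  unfold Subst.single at h
  split_ifs at h
  exact ⟨y, by simpa using h.symm⟩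

/-- The translation at a bound `k ≠ nil`, where `call` is the translation at bound `k - 1`. -/
noncomputable def transPos (G : FreshGen) (call : Translator Op) : Translator Op
  | .fail θ, R, C, D, φ, U => retExpr G θ .fail R C D φ U
  | .var x, R, C, D, φ, U => retExpr G x.ty (pv x) R C D φ U
  | .meth m, R, C, D, φ, U => retExpr G m.ty (.meth m) R C D φ U
  | .int i, R, C, D, φ, U => retExpr G .int (.int i) R C D φ U
  | .unit, R, C, D, φ, U => retExpr G .unit .unit R C D φ U
  | .deref r, R, C, D, φ, U => retExpr G r.ty (D.expr r) R C D φ U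
  | .lam x M, R, C, D, φ, U =>
    let m := G.meth R.keys x.ty M.ty
    retExpr G m.ty (.meth m) (R.insert m ⟨x, M⟩) C D φ U
  | .fst M, R, C, D, φ, U =>
    let t₁ := transPos G call M R C D φ U
    let ret := G.var t₁.used (Term.fst M).ty
    ⟨ret, .and (.guard (pv t₁.ret) (pv ret) (.eq (pv ret) (.fst (pv t₁.ret)))) t₁.form,
      t₁.repo, t₁.C, t₁.D, insert ret t₁.used⟩
  | .snd M, R, C, D, φ, U =>
    let t₁ := transPos G call M R C D φ U
    let ret := G.var t₁.used (Term.snd M).ty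
    ⟨ret, .and (.guard (pv t₁.ret) (pv ret) (.eq (pv ret) (.snd (pv t₁.ret)))) t₁.form,
      t₁.repo, t₁.C, t₁.D, insert ret t₁.used⟩
  | .assign r M, R, C, D, φ, U =>
    let t₁ := transPos G call M R C D φ U
    let C₁' := t₁.C.bump r
    let D₁' : SSAMap := t₁.D.insert r (C₁'.idx r)
    let ret := G.var t₁.used .unit
    ⟨ret, .and (.guard (pv t₁.ret) (pv ret)
        (.and (.eq (pv ret) .unit) (.eq (D₁'.expr r) (pv t₁.ret)))) t₁.form,
      t₁.repo, C₁', D₁', insert ret t₁.used⟩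
  | .arith o M₁ M₂, R, C, D, φ, U =>
    let t₁ := transPos G call M₁ R C D φ U
    let t₂ := transPos G call M₂ t₁.repo t₁.C t₁.D t₁.form t₁.used
    let ret := G.var t₂.used .int
    ⟨ret, .and (.guard (pv t₁.ret) (pv ret) (.guard (pv t₂.ret) (pv ret)
        (.eq (pv ret) (.arith o (pv t₁.ret) (pv t₂.ret))))) t₂.form,
      t₂.repo, t₂.C, t₂.D, insert ret t₂.used⟩
  | .pair M₁ M₂, R, C, D, φ, U =>
    let t₁ := transPos G call M₁ R C D φ U
    let t₂ := transPos G call M₂ t₁.repo t₁.C t₁.D t₁.form t₁.used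
    let ret := G.var t₂.used (.prod M₁.ty M₂.ty)
    ⟨ret, .and (.guard (pv t₁.ret) (pv ret) (.guard (pv t₂.ret) (pv ret)
        (.eq (pv ret) (.pair (pv t₁.ret) (pv t₂.ret))))) t₂.form,
      t₂.repo, t₂.C, t₂.D, insert ret t₂.used⟩
  | .letin x M N, R, C, D, φ, U =>
    let t₁ := transPos G call M R C D φ U
    let t₂ := transPos G call (N.subst1 x (.var t₁.ret)) t₁.repo t₁.C t₁.D t₁.form t₁.used
    let ret := G.var t₂.used N.ty
    ⟨ret, .and (.guard (pv t₁.ret) (pv ret) (.guard (pv t₂.ret) (pv ret)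
        (.eq (pv ret) (pv t₂.ret)))) t₂.form,
      t₂.repo, t₂.C, t₂.D, insert ret t₂.used⟩
  | .letrec f x M N, R, C, D, φ, U =>
    let m := G.meth R.keys x.ty M.ty
    let f' := G.var U f.ty
    transPos G call (N.subst1 f (.var f')) (R.insert m ((Lam.mk x M).subst1 f (.var f')))
      C D (.and φ (.eq (pv f') (.meth m))) (insert f' U)
  | .appMeth m M, R, C, D, φ, U =>
    let t₁ := transPos G call M R C D φ U
    match R.lookup m with
    -- `R(m)` is always defined when a valid configuration is translated
    | none => retExpr G m.cod .nil t₁.repo t₁.C t₁.D t₁.form t₁.used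
    | some L =>
      let t₂ := call (L.body.subst1 L.param (.var t₁.ret)) t₁.repo t₁.C t₁.D t₁.form t₁.used
      let ret := G.var t₂.used m.cod
      ⟨ret, .and (.guard (pv t₁.ret) (pv ret) (.guard (pv t₂.ret) (pv ret)
          (.eq (pv ret) (pv t₂.ret)))) t₂.form,
        t₂.repo, t₂.C, t₂.D, insert ret t₂.used⟩
  | .ite M M₁ M₀, R, C, D, φ, U =>
    let tb := transPos G call M R C D φ U
    let t₀ := transPos G call M₀ tb.repo tb.C tb.D tb.form tb.used
    let t₁ := transPos G call M₁ t₀.repo t₀.C tb.D t₀.form t₀.used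
    let C' := t₁.C.bumpAll
    let ret := G.var t₁.used M₁.ty
    let ψ₀ : Form Op := .imp (.eq (pv tb.ret) (.int 0))
      (.guard (pv t₀.ret) (pv ret) (.and (.eq (pv ret) (pv t₀.ret)) (C'.join t₀.D)))
    let ψ₁ : Form Op := .imp (.not (.eq (pv tb.ret) (.int 0)))
      (.guard (pv t₁.ret) (pv ret) (.and (.eq (pv ret) (pv t₁.ret)) (C'.join t₁.D)))
    ⟨ret, .and (.guard (pv tb.ret) (pv ret) (.and ψ₀ ψ₁)) t₁.form,
      t₁.repo, C', C', insert ret t₁.used⟩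
  | .appVar x M, R, C, D, φ, U =>
    let t₀ := transPos G call M R C D φ U
    let l := callAll call R t₀.ret t₀.D (Repo.restrict R x.ty) t₀.repo t₀.C t₀.form t₀.used
    match l.getLast? with
    | none => retExpr G (Term.appVar x M).ty .nil t₀.repo t₀.C t₀.D t₀.form t₀.used
    | some (_, tₙ) =>
      let C' := tₙ.C.bumpAll
      let ret := G.var tₙ.used (Term.appVar x M).ty
      let ψ : Form Op := Form.conj (l.map fun p => .imp (.eq (pv x) (.meth p.1))
        (.and (.guard (pv p.2.ret) (pv ret) (.eq (pv ret) (pv p.2.ret))) (C'.join p.2.D)))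
      ⟨ret, .and (.guard (pv t₀.ret) (pv ret) ψ) tₙ.form,
        tₙ.repo, C', C', insert ret tₙ.used⟩
termination_by M => M.size
decreasing_by all_goals simp only [Term.size, Term.size_subst1_var]; omega

/-- The translation at a bound `k ∈ ℕ`. -/
noncomputable def transNat (G : FreshGen) : ℕ → Translator Op
  | 0 => transPos G (transNil G)
  | k + 1 => transPos G (transNat G k)

/-- The translation `⟦M, R, C, D, φ, k⟧`. -/
noncomputable def transBound (G : FreshGen) : Option ℕ → Translator Op
  | none => transNil G
  | some k => transNat G k

/-- The initial SSA map `C_S = {r ↦ r_0 | r ∈ dom S}`. -/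
def Store.initSSA (S : Store) : SSAMap := mapVals (fun _ => 0) S

/-- The initial formula `φ_S`: the conjunction of the equations `r_0 = S(r)` for `r ∈ dom S`. -/
noncomputable def Store.initForm (S : Store) : Form Op :=
  Form.conj (S.entries.toList.map fun e => .eq (.var (.ssa e.1 0)) e.2.toExpr)

/-- `⟦M, R, S, k⟧ = ⟦M, R, C_S, C_S, φ_S, k⟧` -/
noncomputable def Config.translate (G : FreshGen) (K : Config Op) : Result Op :=
  transBound G K.bound K.term K.repo (Store.initSSA K.store) (Store.initSSA K.store)
    (Store.initForm K.store) K.vars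

end

end HORef

/-!
Translation and evaluation are compared along the one path that the evaluation takes.

Soundness. The translation explores every branch, whereas a run of the program takes one. A run is
matched with the translation by a substitution of closed values for those variables (of the program,
or fresh) that the run has determined; `LiveState` relates it to the repositories and to the store.
`sound_transPos` shows by induction on terms that, from matched states, there is an evaluation such
that every valuation which satisfies the formula and agrees with the live variables, and with the
store at the current SSA variables, gives the return variable its outcome (`Simulates`). In
particular every configuration has an evaluation, since typed terms do not get stuck and the bound
makes recursion terminate. The names that the run creates are chosen to be those of the translation,
which are fresh for the larger repository of the translation and so for that of the run. The joining
equations `C' = D` at the end of a branch make the SSA variables of the branch taken available to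
what follows. The free variables are ground, so that their values contain no method names, and every
method that can be called through a variable is found in the repository of the translation.

Satisfiability. To recover the outcome from an entailment, the formula must be satisfiable together
with the equations of the assignment. Each construct adds a constraint on a fresh return variable
and on fresh SSA variables only, and this constraint can be satisfied whatever closed values of the
right types the older variables have (`conservative_transPos`). At the joins, only the branch
selected by the condition, or by the value of the called variable, is constrained.

Names. The choice of method names by the evaluation is immaterial: evaluation is equivariant
(`Eval.perm`), and any two evaluations of one configuration agree up to a permutation of the names
that fixes the initial repository (`Eval.unique_up_to_perm`). Hence the outcome that the formula
forces is nominally equivalent to exactly the outcomes of the evaluation.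
-/

namespace HORef

universe u

/-! ### Finite maps -/

section FiniteMaps

variable {K : Type} {V W : Type*} [DecidableEq K]

theorem lookup_eq_some_iff_mem_entries (s : Finmap (fun _ : K => V)) (k : K) (v : V) :
    s.lookup k = some v ↔ (⟨k, v⟩ : Sigma fun _ : K => V) ∈ s.entries := by
  induction s using Finmap.induction_on with
  | H a =>
    rw [Finmap.lookup_toFinmap]
    exact AList.mem_lookup_iff

theorem lookup_mapVals (f : V → W) (s : Finmap (fun _ : K => V)) (k : K) :
    (mapVals f s).lookup k = (s.lookup k).map f := by
  ext w
  rw [lookup_eq_some_iff_mem_entries, Option.map_eq_some_iff]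
  simp only [mapVals, Multiset.mem_map, lookup_eq_some_iff_mem_entries]
  constructor
  · rintro ⟨⟨k', v⟩, hv, he⟩
    simp only [Sigma.map, id, Sigma.mk.injEq] at he
    obtain ⟨rfl, he⟩ := he
    exact ⟨v, hv, eq_of_heq he⟩
  · rintro ⟨v, hv, rfl⟩
    exact ⟨_, hv, rfl⟩

theorem mem_keys_iff_lookup (s : Finmap (fun _ : K => V)) (k : K) :
    k ∈ s.keys ↔ ∃ v, s.lookup k = some v := by
  rw [Finmap.mem_keys, Finmap.mem_iff]

theorem mem_keys_of_lookup {s : Finmap (fun _ : K => V)} {k : K} {v : V}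
    (h : s.lookup k = some v) : k ∈ s.keys := (mem_keys_iff_lookup s k).mpr ⟨v, h⟩

theorem lookup_eq_none_of_notMem_keys {s : Finmap (fun _ : K => V)} {k : K}
    (h : k ∉ s.keys) : s.lookup k = none :=
  Finmap.lookup_eq_none.mpr fun h' => h (Finmap.mem_keys.mpr h')

theorem keys_mapVals (f : V → W) (s : Finmap (fun _ : K => V)) :
    (mapVals f s).keys = s.keys := by
  ext k
  simp [mem_keys_iff_lookup, lookup_mapVals]

theorem keys_insert (s : Finmap (fun _ : K => V)) (k : K) (v : V) :
    (s.insert k v).keys = insert k s.keys := by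
  ext k'
  simp [Finmap.mem_keys]

theorem lookup_insert_eq_ite (s : Finmap (fun _ : K => V)) (k k' : K) (v : V) :
    (s.insert k v).lookup k' = if k' = k then some v else s.lookup k' := by
  split_ifs with h
  · subst h; exact Finmap.lookup_insert s
  · exact Finmap.lookup_insert_of_ne s h

theorem mem_gather {A : Type} [DecidableEq A] (f : V → Finset A)
    (s : Finmap (fun _ : K => V)) (a : A) :
    a ∈ gather f s ↔ ∃ k v, s.lookup k = some v ∧ a ∈ f v := by
  simp only [gather, Finset.mem_biUnion]
  constructor
  · rintro ⟨k, -, h⟩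
    split at h
    · rename_i v hv
      exact ⟨k, v, hv, h⟩
    · simp at h
  · rintro ⟨k, v, hv, h⟩
    refine ⟨k, mem_keys_of_lookup hv, ?_⟩
    rw [hv]
    exact h

end FiniteMaps

/-! ### Values and typing -/

section Typing

variable {Op : Type u}

theorem HasType.ty_eq {M : Term Op} {θ : Ty} (h : HasType M θ) : M.ty = θ := by
  induction h <;> simp_all [Term.ty]

theorem HasType.of_val (v : Val) : HasType (v.toTerm : Term Op) v.ty := by
  induction v with
  | var x => exact .var x
  | meth m => exact .meth m
  | int i => exact .int i
  | unit => exact .unit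
  | pair v w hv hw => exact .pair hv hw

theorem Val.toTerm_injective : Function.Injective (Val.toTerm : Val → Term Op) := by
  intro v
  induction v with
  | pair v w hv hw =>
    intro v' h
    cases v' <;> simp only [Val.toTerm, reduceCtorEq, Term.pair.injEq] at h
    rw [hv h.1, hw h.2]
  | _ =>
    intro v' h
    cases v' <;> simp_all [Val.toTerm]

@[simp] theorem Val.fv_toTerm (v : Val) : (v.toTerm : Term Op).fv = v.fv := by
  induction v <;> simp_all [Val.toTerm, Term.fv, Val.fv]

@[simp] theorem Val.vars_toTerm (v : Val) : (v.toTerm : Term Op).vars = v.fv := by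
  induction v <;> simp_all [Val.toTerm, Term.vars, Val.fv]

@[simp] theorem Val.meths_toTerm (v : Val) : (v.toTerm : Term Op).meths = v.meths := by
  induction v <;> simp_all [Val.toTerm, Term.meths, Val.meths]

@[simp] theorem Val.refs_toTerm (v : Val) : (v.toTerm : Term Op).refs = ∅ := by
  induction v <;> simp_all [Val.toTerm, Term.refs]

theorem Val.exists_meth_of_closed {v : Val} {a b : Ty} (hc : v.fv = ∅) (h : v.ty = .arr a b) :
    ∃ m : Meth, v = .meth m ∧ m.dom = a ∧ m.cod = b := by
  cases v <;> simp_all [Val.ty, Val.fv, Meth.ty]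

theorem Val.exists_int_of_closed {v : Val} (hc : v.fv = ∅) (h : v.ty = .int) :
    ∃ i, v = .int i := by
  cases v <;> simp_all [Val.ty, Val.fv, Meth.ty]

theorem Val.exists_pair_of_closed {v : Val} {a b : Ty} (hc : v.fv = ∅) (h : v.ty = .prod a b) :
    ∃ w w', v = .pair w w' ∧ w.fv = ∅ ∧ w'.fv = ∅ ∧ w.ty = a ∧ w'.ty = b := by
  cases v <;> simp_all [Val.ty, Val.fv, Meth.ty]

/-- Closed values of ground type contain no method names. -/
theorem Val.meths_eq_empty_of_ground {v : Val} (hc : v.fv = ∅) (h : v.ty.Ground) :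
    v.meths = ∅ := by
  induction v with
  | pair v w hv hw =>
    simp only [Val.fv, Finset.union_eq_empty] at hc
    simp [Val.meths, hv hc.1 h.1, hw hc.2 h.2]
  | meth m => exact h.elim
  | _ => rfl

theorem Term.fv_subset_vars (M : Term Op) : M.fv ⊆ M.vars := by
  induction M with
  | letin x M N ih₁ ih₂ =>
    intro y hy
    simp only [Term.fv, Term.vars, Finset.mem_union, Finset.mem_erase] at hy ⊢
    rcases hy with hy | hy
    · exact .inl (.inr (ih₁ hy))
    · exact .inr (ih₂ hy.2)
  | letrec f x M N ih₁ ih₂ =>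
    intro y hy
    simp only [Term.fv, Term.vars, Finset.mem_union, Finset.mem_erase] at hy ⊢
    rcases hy with hy | hy
    · exact .inl (.inr (ih₁ hy.2.2))
    · exact .inr (ih₂ hy.2)
  | lam x M ih =>
    intro y hy
    simp only [Term.fv, Term.vars, Finset.mem_union, Finset.mem_erase] at hy ⊢
    exact .inr (ih hy.2)
  | _ =>
    simp only [Term.fv, Term.vars]
    try grind

end Typing

/-! ### Substitution -/

section Substitution

variable {Op : Type u}

/-- The substitution preserves types. -/
def Subst.Typed (s : Subst) : Prop := ∀ x v, s x = some v → v.ty = x.ty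

theorem Subst.drop_eq_some {s : Subst} {x y : Var} {v : Val} :
    s.drop x y = some v ↔ y ≠ x ∧ s y = some v := by
  unfold Subst.drop
  split_ifs with h <;> simp [h]

theorem Subst.single_eq_some {x y : Var} {v w : Val} :
    Subst.single x v y = some w ↔ y = x ∧ v = w := by
  unfold Subst.single
  split_ifs with h <;> simp [h]

theorem Subst.Typed.drop {s : Subst} (h : s.Typed) (x : Var) : (s.drop x).Typed :=
  fun y v hv => h y v (Subst.drop_eq_some.mp hv).2

theorem Subst.Typed.single {x : Var} {v : Val} (h : v.ty = x.ty) : (Subst.single x v).Typed := by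
  intro y w hw
  obtain ⟨rfl, rfl⟩ := Subst.single_eq_some.mp hw
  exact h

/-- What becomes of the application `x M` when `v` is substituted for `x`. -/
def Val.applyHead (x : Var) (v : Val) (M : Term Op) : Term Op :=
  match v with
  | .meth m => .appMeth m M
  | .var y => .appVar y M
  | _ => .appVar x M

theorem Term.subst_appVar (s : Subst) (x : Var) (M : Term Op) :
    (Term.appVar x M).subst s = ((s x).getD (.var x)).applyHead x (M.subst s) := by
  simp only [Term.subst]
  rcases s x with _ | v
  · rfl
  · cases v <;> rfl

theorem Term.subst_var (s : Subst) (x : Var) :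
    (Term.var x : Term Op).subst s = ((s x).getD (.var x)).toTerm := by
  simp only [Term.subst]
  rcases s x with _ | v <;> rfl

theorem Val.subst_toTerm (s : Subst) (v : Val) :
    (v.toTerm : Term Op).subst s = (v.subst s).toTerm := by
  induction v with
  | var x => exact Term.subst_var s x
  | pair v w hv hw => simp [Val.toTerm, Term.subst, Val.subst, hv, hw]
  | _ => rfl

theorem Subst.Typed.getD {s : Subst} (h : s.Typed) (x : Var) :
    ((s x).getD (.var x)).ty = x.ty := by
  rcases hx : s x with _ | v
  · rfl
  · exact h x v hx

theorem Val.ty_subst {s : Subst} (hs : s.Typed) (v : Val) : (v.subst s).ty = v.ty := by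
  induction v with
  | var x => exact hs.getD x
  | pair v w hv hw => simp [Val.subst, Val.ty, hv, hw]
  | _ => rfl

theorem HasType.subst {M : Term Op} {θ : Ty} (h : HasType M θ) {s : Subst} (hs : s.Typed) :
    HasType (M.subst s) θ := by
  induction h generalizing s with
  | var x =>
    rw [Term.subst_var, ← hs.getD x]
    exact HasType.of_val _
  | @appVar x M θ θ' hx hM ih =>
    have hd := hs.getD x
    rw [Term.subst_appVar]
    generalize (s x).getD (.var x) = v at hd
    cases v with
    | meth m =>
      simp only [Val.ty, Meth.ty, hx, Ty.arr.injEq] at hd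
      obtain ⟨rfl, rfl⟩ := hd
      exact .appMeth (ih hs)
    | var y => exact .appVar (hd.trans hx) (ih hs)
    | _ => exact .appVar hx (ih hs)
  | fail θ => exact .fail θ
  | meth m => exact .meth m
  | int i => exact .int i
  | unit => exact .unit
  | assign _ ih => exact .assign (ih hs)
  | deref r => exact .deref r
  | arith _ _ ih₁ ih₂ => exact .arith (ih₁ hs) (ih₂ hs)
  | pair _ _ ih₁ ih₂ => exact .pair (ih₁ hs) (ih₂ hs)
  | fst _ ih => exact .fst (ih hs)
  | snd _ ih => exact .snd (ih hs)
  | appMeth _ ih => exact .appMeth (ih hs)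
  | ite _ _ _ ih ih₁ ih₀ => exact .ite (ih hs) (ih₁ hs) (ih₀ hs)
  | letin _ _ ih₁ ih₂ => exact .letin (ih₁ hs) (ih₂ (hs.drop _))
  | letrec hf _ _ ih₁ ih₂ =>
    exact .letrec hf (ih₁ ((hs.drop _).drop _)) (ih₂ (hs.drop _))
  | lam _ ih => exact .lam (ih (hs.drop _))

theorem HasType.subst1 {M : Term Op} {θ : Ty} (h : HasType M θ) {x : Var} {v : Val}
    (hv : v.ty = x.ty) : HasType (M.subst1 x v) θ :=
  h.subst (.single hv)

theorem Subst.drop_congr {s t : Subst} {x y : Var} (h : y ≠ x → s y = t y) :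
    s.drop x y = t.drop x y := by
  unfold Subst.drop
  split_ifs with hy
  · rfl
  · exact h hy

theorem Val.subst_congr {s t : Subst} {v : Val} (h : ∀ x ∈ v.fv, s x = t x) :
    v.subst s = v.subst t := by
  induction v with
  | var x => simp [Val.subst, h x (by simp [Val.fv])]
  | pair v w hv hw =>
    simp only [Val.fv, Finset.mem_union] at h
    simp [Val.subst, hv fun x hx => h x (.inl hx), hw fun x hx => h x (.inr hx)]
  | _ => rfl

theorem Val.subst_eq_self {s : Subst} {v : Val} (h : v.fv = ∅) : v.subst s = v := by
  induction v with
  | pair v w hv hw =>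
    simp only [Val.fv, Finset.union_eq_empty] at h
    simp [Val.subst, hv h.1, hw h.2]
  | var x => simp [Val.fv] at h
  | _ => rfl

theorem Term.subst_congr {s t : Subst} {M : Term Op} (h : ∀ x ∈ M.fv, s x = t x) :
    M.subst s = M.subst t := by
  induction M generalizing s t with
  | var x => simp [Term.subst_var, h x (by simp [Term.fv])]
  | appVar x M ih =>
    rw [Term.subst_appVar, Term.subst_appVar, h x (by simp [Term.fv]),
      ih fun y hy => h y (by simp [Term.fv, hy])]
  | letin x M N ih₁ ih₂ =>
    simp only [Term.fv, Finset.mem_union, Finset.mem_erase] at h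
    simp only [Term.subst, ih₁ fun y hy => h y (.inl hy),
      ih₂ fun y hy => Subst.drop_congr fun hn => h y (.inr ⟨hn, hy⟩)]
  | letrec f x M N ih₁ ih₂ =>
    simp only [Term.fv, Finset.mem_union, Finset.mem_erase] at h
    simp only [Term.subst,
      ih₁ fun y hy => Subst.drop_congr fun hx => Subst.drop_congr fun hf =>
        h y (.inl ⟨hf, hx, hy⟩),
      ih₂ fun y hy => Subst.drop_congr fun hn => h y (.inr ⟨hn, hy⟩)]
  | lam x M ih =>
    simp only [Term.fv, Finset.mem_erase] at h
    simp only [Term.subst, ih fun y hy => Subst.drop_congr fun hn => h y ⟨hn, hy⟩]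
  | ite M M₁ M₀ ih ih₁ ih₀ =>
    simp only [Term.fv, Finset.mem_union] at h
    simp only [Term.subst, ih fun y hy => h y (.inl (.inl hy)),
      ih₁ fun y hy => h y (.inl (.inr hy)), ih₀ fun y hy => h y (.inr hy)]
  | arith o M N ih₁ ih₂ =>
    simp only [Term.fv, Finset.mem_union] at h
    simp only [Term.subst, ih₁ fun y hy => h y (.inl hy), ih₂ fun y hy => h y (.inr hy)]
  | pair M N ih₁ ih₂ =>
    simp only [Term.fv, Finset.mem_union] at h
    simp only [Term.subst, ih₁ fun y hy => h y (.inl hy), ih₂ fun y hy => h y (.inr hy)]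
  | assign r M ih => simp only [Term.subst, ih h]
  | fst M ih => simp only [Term.subst, ih h]
  | snd M ih => simp only [Term.subst, ih h]
  | appMeth m M ih => simp only [Term.subst, ih h]
  | _ => rfl

theorem Lam.subst_congr {s t : Subst} {L : Lam Op} (h : ∀ x ∈ L.fv, s x = t x) :
    L.subst s = L.subst t := by
  simp only [Lam.fv, Finset.mem_erase] at h
  simp only [Lam.subst, Term.subst_congr
    fun y hy => Subst.drop_congr fun hn => h y ⟨hn, hy⟩]

/-- The side condition of the composition lemma passes below a binder. -/
theorem Subst.comp_drop {s t u : Subst} {x y : Var}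
    (hcap : ∀ z v, s z = some v → x ∉ v.fv)
    (h : y ≠ x → ((s y).getD (.var y)).subst t = (u y).getD (.var y)) :
    ((s.drop x y).getD (.var y)).subst (t.drop x) = (u.drop x y).getD (.var y) := by
  by_cases hy : y = x
  · simp [Subst.drop, hy, Val.subst]
  · have h' := h hy
    simp only [Subst.drop, if_neg hy]
    rw [← h']
    apply Val.subst_congr
    intro z hz
    refine if_neg ?_
    rintro rfl
    rcases hs : s y with _ | v
    · simp only [hs, Option.getD_none, Val.fv, Finset.mem_singleton] at hz
      exact hy hz.symm
    · rw [hs] at hz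
      exact hcap y v hs hz

/-- Composition of substitutions, under the proviso that the first one captures no variable. -/
theorem Term.subst_subst {M : Term Op} {θ : Ty} (hM : HasType M θ) {s t u : Subst}
    (hs : s.Typed) (ht : t.Typed) (hcap : ∀ x v, s x = some v → ∀ y ∈ v.fv, y ∉ M.vars)
    (h : ∀ x ∈ M.fv, ((s x).getD (.var x)).subst t = (u x).getD (.var x)) :
    (M.subst s).subst t = M.subst u := by
  induction hM generalizing s t u with
  | var x =>
    rw [Term.subst_var, Term.subst_var, Val.subst_toTerm, h x (by simp [Term.fv])]
  | @appVar x M θ θ' hx hM ih =>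
    have hx' := h x (by simp [Term.fv])
    have hd := hs.getD x
    have ih' := ih hs ht (fun y v hy z hz hz' => hcap y v hy z hz (by simp [Term.vars, hz']))
      (fun y hy => h y (by simp [Term.fv, hy]))
    rw [Term.subst_appVar, Term.subst_appVar, ← hx']
    generalize (s x).getD (.var x) = v at hd hx'
    cases v with
    | var y =>
      simp only [Val.applyHead, Val.subst]
      have hdt := ht.getD y
      rw [Term.subst_appVar, ih']
      generalize (t y).getD (.var y) = w at hdt
      cases w with
      | var z => rfl
      | meth m => rfl
      | _ => simp_all [Val.ty]
    | meth m => simp [Val.applyHead, Val.subst, Term.subst, ih']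
    | _ => simp_all [Val.ty]
  | @letin x M N θ hM hN ih₁ ih₂ =>
    simp only [Term.vars, Finset.mem_union, not_or] at hcap
    simp only [Term.fv, Finset.mem_union, Finset.mem_erase] at h
    simp only [Term.subst]
    rw [ih₁ hs ht (fun y v hy z hz => (hcap y v hy z hz).1.2) fun y hy => h y (.inl hy),
      ih₂ (hs.drop _) (ht.drop _)
        (fun y v hy z hz => (hcap y v (Subst.drop_eq_some.mp hy).2 z hz).2)
        fun y hy => Subst.comp_drop (fun z v hz hx => (hcap z v hz _ hx).1.1 (by simp))
          fun hn => h y (.inr ⟨hn, hy⟩)]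
  | @letrec f x M N θ' θ'' hf hM hN ih₁ ih₂ =>
    simp only [Term.vars, Finset.mem_union, not_or, Finset.mem_insert,
      Finset.mem_singleton] at hcap
    simp only [Term.fv, Finset.mem_union, Finset.mem_erase] at h
    simp only [Term.subst]
    rw [ih₁ ((hs.drop _).drop _) ((ht.drop _).drop _)
        (fun y v hy z hz => (hcap y v
          (Subst.drop_eq_some.mp (Subst.drop_eq_some.mp hy).2).2 z hz).1.2)
        fun y hy => Subst.comp_drop
          (fun z v hz hx => (hcap z v (Subst.drop_eq_some.mp hz).2 _ hx).1.1.2 rfl)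
          fun hn => Subst.comp_drop (fun z v hz hx => (hcap z v hz _ hx).1.1.1 rfl)
          fun hn' => h y (.inl ⟨hn', hn, hy⟩),
      ih₂ (hs.drop _) (ht.drop _)
        (fun y v hy z hz => (hcap y v (Subst.drop_eq_some.mp hy).2 z hz).2)
        fun y hy => Subst.comp_drop (fun z v hz hx => (hcap z v hz _ hx).1.1.1 rfl)
          fun hn => h y (.inr ⟨hn, hy⟩)]
  | @lam x M θ hM ih =>
    simp only [Term.vars, Finset.mem_union, not_or] at hcap
    simp only [Term.fv, Finset.mem_erase] at h
    simp only [Term.subst]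
    rw [ih (hs.drop _) (ht.drop _)
        (fun y v hy z hz => (hcap y v (Subst.drop_eq_some.mp hy).2 z hz).2)
        fun y hy => Subst.comp_drop (fun z v hz hx => (hcap z v hz _ hx).1 (by simp))
          fun hn => h y ⟨hn, hy⟩]
  | ite _ _ _ ih ih₁ ih₀ =>
    simp only [Term.vars, Finset.mem_union, not_or] at hcap
    simp only [Term.fv, Finset.mem_union] at h
    simp only [Term.subst]
    rw [ih hs ht (fun y v hy z hz => (hcap y v hy z hz).1.1) fun y hy => h y (.inl (.inl hy)),
      ih₁ hs ht (fun y v hy z hz => (hcap y v hy z hz).1.2) fun y hy => h y (.inl (.inr hy)),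
      ih₀ hs ht (fun y v hy z hz => (hcap y v hy z hz).2) fun y hy => h y (.inr hy)]
  | arith _ _ ih₁ ih₂ =>
    simp only [Term.vars, Finset.mem_union, not_or] at hcap
    simp only [Term.fv, Finset.mem_union] at h
    simp only [Term.subst]
    rw [ih₁ hs ht (fun y v hy z hz => (hcap y v hy z hz).1) fun y hy => h y (.inl hy),
      ih₂ hs ht (fun y v hy z hz => (hcap y v hy z hz).2) fun y hy => h y (.inr hy)]
  | pair _ _ ih₁ ih₂ =>
    simp only [Term.vars, Finset.mem_union, not_or] at hcap
    simp only [Term.fv, Finset.mem_union] at h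
    simp only [Term.subst]
    rw [ih₁ hs ht (fun y v hy z hz => (hcap y v hy z hz).1) fun y hy => h y (.inl hy),
      ih₂ hs ht (fun y v hy z hz => (hcap y v hy z hz).2) fun y hy => h y (.inr hy)]
  | assign _ ih => simp only [Term.subst, ih hs ht hcap h]
  | fst _ ih => simp only [Term.subst, ih hs ht hcap h]
  | snd _ ih => simp only [Term.subst, ih hs ht hcap h]
  | appMeth _ ih => simp only [Term.subst, ih hs ht hcap h]
  | _ => rfl

/-- Substituting a fresh variable `y` for `x` and then a closed value `v` for `y` amounts to
substituting `v` for `x`. The substitution `s` may be any restriction of `t` to a set that contains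
the free variables other than `x`. -/
theorem Term.subst1_var_subst {M : Term Op} {θ : Ty} (hM : HasType M θ) {x y : Var} {v : Val}
    {s t : Subst} (hy : y ∉ M.vars) (hxy : y.ty = x.ty) (hty : t y = some v)
    (ht : t.Typed) (htc : ∀ z w, t z = some w → w.fv = ∅)
    (hst : ∀ z ∈ M.fv, z ≠ x → s z = t z) :
    (M.subst1 x (.var y)).subst t = (M.subst (s.drop x)).subst1 x v := by
  have hvx : v.ty = x.ty := (ht y v hty).trans hxy
  have e : M.subst (s.drop x) = M.subst (t.drop x) :=
    Term.subst_congr fun z hz => Subst.drop_congr fun hn => hst z hz hn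
  rw [e]
  trans M.subst (fun z => if z = x then some v else t z)
  · refine Term.subst_subst hM (.single (v := .var y) hxy) ht ?_ ?_
    · intro z w hz y' hy'
      obtain ⟨rfl, rfl⟩ := Subst.single_eq_some.mp hz
      simp only [Val.fv, Finset.mem_singleton] at hy'
      exact hy' ▸ hy
    · intro z hz
      by_cases hzx : z = x
      · simp [Subst.single, hzx, Val.subst, hty]
      · simp [Subst.single, hzx, Val.subst]
  · symm
    refine Term.subst_subst hM (ht.drop x) (.single hvx) ?_ ?_
    · intro z w hz y' hy'
      rw [htc z w (Subst.drop_eq_some.mp hz).2] at hy'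
      simp at hy'
    · intro z hz
      by_cases hzx : z = x
      · simp [Subst.single, Subst.drop, hzx, Val.subst]
      · simp only [Subst.drop, hzx, if_false]
        rcases hs : t z with _ | w
        · simp [Val.subst, Subst.single, hzx]
        · simp [Val.subst_eq_self (htc z w hs)]

theorem Val.mem_fv_subst {s : Subst} {v : Val} {x : Var} (hx : x ∈ v.fv) (hs : s x = none) :
    x ∈ (v.subst s).fv := by
  induction v with
  | var y =>
    simp only [Val.fv, Finset.mem_singleton] at hx
    subst hx
    simp [Val.subst, hs, Val.fv]
  | pair v w hv hw =>
    simp only [Val.fv, Finset.mem_union, Val.subst] at hx ⊢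
    exact hx.imp hv hw
  | _ => simp [Val.fv] at hx

/-- A free variable that is not substituted for stays free. -/
theorem Term.mem_fv_subst {s : Subst} {M : Term Op} {x : Var} (hx : x ∈ M.fv)
    (hs : s x = none) : x ∈ (M.subst s).fv := by
  have hd : ∀ {s : Subst} {y}, s x = none → s.drop y x = none := by
    intro s y h
    unfold Subst.drop
    split_ifs <;> simp [h]
  induction M generalizing s with
  | var y =>
    simp only [Term.fv, Finset.mem_singleton] at hx
    subst hx
    simp [Term.subst, hs, Term.fv]
  | appVar y M ih =>
    simp only [Term.fv, Finset.mem_union, Finset.mem_singleton] at hx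
    rcases hx with rfl | hx
    · simp [Term.subst, hs, Term.fv]
    · rw [Term.subst_appVar]
      cases (s y).getD (.var y) <;> simp [Val.applyHead, Term.fv, ih hx hs]
  | letin y M N ih₁ ih₂ =>
    simp only [Term.fv, Term.subst, Finset.mem_union, Finset.mem_erase] at hx ⊢
    exact hx.imp (ih₁ · hs) fun h => ⟨h.1, ih₂ h.2 (hd hs)⟩
  | letrec f y M N ih₁ ih₂ =>
    simp only [Term.fv, Term.subst, Finset.mem_union, Finset.mem_erase] at hx ⊢
    exact hx.imp (fun h => ⟨h.1, h.2.1, ih₁ h.2.2 (hd (hd hs))⟩)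
      fun h => ⟨h.1, ih₂ h.2 (hd hs)⟩
  | lam y M ih =>
    simp only [Term.fv, Term.subst, Finset.mem_erase] at hx ⊢
    exact ⟨hx.1, ih hx.2 (hd hs)⟩
  | arith o M N ih₁ ih₂ =>
    simp only [Term.fv, Term.subst, Finset.mem_union] at hx ⊢
    exact hx.imp (ih₁ · hs) (ih₂ · hs)
  | pair M N ih₁ ih₂ =>
    simp only [Term.fv, Term.subst, Finset.mem_union] at hx ⊢
    exact hx.imp (ih₁ · hs) (ih₂ · hs)
  | ite M M₁ M₀ ih ih₁ ih₀ =>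
    simp only [Term.fv, Term.subst, Finset.mem_union] at hx ⊢
    exact hx.imp (Or.imp (ih · hs) (ih₁ · hs)) (ih₀ · hs)
  | assign r M ih => exact ih hx hs
  | fst M ih => exact ih hx hs
  | snd M ih => exact ih hx hs
  | appMeth m M ih => exact ih hx hs
  | _ => simp [Term.fv] at hx

theorem Val.mem_meths_subst {s : Subst} {v : Val} {m : Meth} (h : m ∈ (v.subst s).meths) :
    m ∈ v.meths ∨ ∃ x ∈ v.fv, ∃ w, s x = some w ∧ m ∈ w.meths := by
  induction v with
  | var y =>
    simp only [Val.subst] at h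
    rcases hs : s y with _ | w
    · simp [hs, Val.meths] at h
    · rw [hs] at h
      exact .inr ⟨y, by simp [Val.fv], w, hs, h⟩
  | pair v w hv hw =>
    simp only [Val.fv, Finset.mem_union, Val.subst, Val.meths] at h ⊢
    rcases h with h | h
    · rcases hv h with h | ⟨x, hx, h⟩
      · exact .inl (.inl h)
      · exact .inr ⟨x, .inl hx, h⟩
    · rcases hw h with h | ⟨x, hx, h⟩
      · exact .inl (.inr h)
      · exact .inr ⟨x, .inr hx, h⟩
  | _ => exact .inl h

theorem Term.mem_meths_subst {s : Subst} {M : Term Op} {m : Meth}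
    (h : m ∈ (M.subst s).meths) :
    m ∈ M.meths ∨ ∃ x ∈ M.fv, ∃ w, s x = some w ∧ m ∈ w.meths := by
  have key : ∀ {s : Subst} {x y : Var} {F : Finset Var} {P : Val → Prop},
      (∃ z ∈ F, ∃ w, s.drop y z = some w ∧ P w) → ∃ z ∈ F.erase y, ∃ w, s z = some w ∧ P w := by
    rintro s x y F P ⟨z, hz, w, hw, hP⟩
    obtain ⟨hn, hw⟩ := Subst.drop_eq_some.mp hw
    exact ⟨z, Finset.mem_erase.mpr ⟨hn, hz⟩, w, hw, hP⟩
  induction M generalizing s with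
  | var y =>
    rw [Term.subst_var, Val.meths_toTerm] at h
    exact (Val.mem_meths_subst (v := .var y) h)
  | appVar y M ih =>
    have hM : m ∈ (M.subst s).meths →
        m ∈ (Term.appVar y M).meths ∨
          ∃ x ∈ (Term.appVar y M).fv, ∃ w, s x = some w ∧ m ∈ w.meths := by
      intro h
      rcases ih h with h | ⟨x, hx, h⟩
      · exact .inl h
      · exact .inr ⟨x, by simp [Term.fv, hx], h⟩
    rw [Term.subst_appVar] at h
    rcases hs : s y with _ | w
    · rw [hs] at h
      exact hM h
    · rw [hs] at h
      cases w with
      | meth m' =>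
        simp only [Option.getD_some, Val.applyHead, Term.meths, Finset.mem_union,
          Finset.mem_singleton] at h
        rcases h with rfl | h
        · exact .inr ⟨y, by simp [Term.fv], _, hs, by simp [Val.meths]⟩
        · exact hM h
      | _ => exact hM h
  | letin y M N ih₁ ih₂ =>
    simp only [Term.subst, Term.meths, Term.fv, Finset.mem_union] at h ⊢
    rcases h with h | h
    · rcases ih₁ h with h | ⟨x, hx, h⟩
      · exact .inl (.inl h)
      · exact .inr ⟨x, .inl hx, h⟩
    · rcases ih₂ h with h | h
      · exact .inl (.inr h)
      · obtain ⟨x, hx, h⟩ := key (x := y) h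
        exact .inr ⟨x, .inr hx, h⟩
  | letrec f y M N ih₁ ih₂ =>
    simp only [Term.subst, Term.meths, Term.fv, Finset.mem_union] at h ⊢
    rcases h with h | h
    · rcases ih₁ h with h | h
      · exact .inl (.inl h)
      · obtain ⟨x, hx, h⟩ := key (x := y) (key (x := y) h)
        exact .inr ⟨x, .inl hx, h⟩
    · rcases ih₂ h with h | h
      · exact .inl (.inr h)
      · obtain ⟨x, hx, h⟩ := key (x := y) h
        exact .inr ⟨x, .inr hx, h⟩
  | lam y M ih =>
    simp only [Term.subst, Term.meths, Term.fv] at h ⊢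
    rcases ih h with h | h
    · exact .inl h
    · exact .inr (key (x := y) h)
  | arith o M N ih₁ ih₂ =>
    simp only [Term.subst, Term.meths, Term.fv, Finset.mem_union] at h ⊢
    rcases h with h | h
    · rcases ih₁ h with h | ⟨x, hx, h⟩
      · exact .inl (.inl h)
      · exact .inr ⟨x, .inl hx, h⟩
    · rcases ih₂ h with h | ⟨x, hx, h⟩
      · exact .inl (.inr h)
      · exact .inr ⟨x, .inr hx, h⟩
  | pair M N ih₁ ih₂ =>
    simp only [Term.subst, Term.meths, Term.fv, Finset.mem_union] at h ⊢
    rcases h with h | h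
    · rcases ih₁ h with h | ⟨x, hx, h⟩
      · exact .inl (.inl h)
      · exact .inr ⟨x, .inl hx, h⟩
    · rcases ih₂ h with h | ⟨x, hx, h⟩
      · exact .inl (.inr h)
      · exact .inr ⟨x, .inr hx, h⟩
  | ite M M₁ M₀ ih ih₁ ih₀ =>
    simp only [Term.subst, Term.meths, Term.fv, Finset.mem_union] at h ⊢
    rcases h with (h | h) | h
    · rcases ih h with h | ⟨x, hx, h⟩
      · exact .inl (.inl (.inl h))
      · exact .inr ⟨x, .inl (.inl hx), h⟩
    · rcases ih₁ h with h | ⟨x, hx, h⟩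
      · exact .inl (.inl (.inr h))
      · exact .inr ⟨x, .inl (.inr hx), h⟩
    · rcases ih₀ h with h | ⟨x, hx, h⟩
      · exact .inl (.inr h)
      · exact .inr ⟨x, .inr hx, h⟩
  | assign r M ih => exact ih h
  | fst M ih => exact ih h
  | snd M ih => exact ih h
  | appMeth m' M ih =>
    simp only [Term.subst, Term.meths, Term.fv, Finset.mem_union] at h ⊢
    rcases h with h | h
    · exact .inl (.inl h)
    · exact (ih h).imp .inr id
  | _ => exact .inl h

theorem Term.mem_vars_subst {s : Subst} {M : Term Op} {z : Var} (h : z ∈ (M.subst s).vars) :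
    z ∈ M.vars ∨ ∃ x v, s x = some v ∧ z ∈ v.fv := by
  have key : ∀ {s : Subst} {y : Var}, (∃ x v, s.drop y x = some v ∧ z ∈ v.fv) →
      ∃ x v, s x = some v ∧ z ∈ v.fv := by
    rintro s y ⟨x, v, hv, hz⟩
    exact ⟨x, v, (Subst.drop_eq_some.mp hv).2, hz⟩
  induction M generalizing s with
  | var y =>
    rw [Term.subst_var, Val.vars_toTerm] at h
    rcases hs : s y with _ | w
    · rw [hs] at h
      exact .inl h
    · rw [hs] at h
      exact .inr ⟨y, w, hs, h⟩
  | appVar y M ih =>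
    rw [Term.subst_appVar] at h
    rcases hs : s y with _ | w
    · simp only [hs, Option.getD_none, Val.applyHead, Term.vars, Finset.mem_union] at h ⊢
      rcases h with h | h
      · exact .inl (.inl h)
      · exact (ih h).imp .inr id
    · rw [hs] at h
      cases w <;>
        simp only [Option.getD_some, Val.applyHead, Term.vars, Finset.mem_union] at h ⊢
      case var z' =>
        rcases h with h | h
        · exact .inr ⟨y, _, hs, h⟩
        · exact (ih h).imp .inr id
      case meth => exact (ih h).imp .inr id
      all_goals
        rcases h with h | h
        · exact .inl (.inl h)
        · exact (ih h).imp .inr id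
  | letin y M N ih₁ ih₂ =>
    simp only [Term.subst, Term.vars, Finset.mem_union] at h ⊢
    rcases h with (h | h) | h
    · exact .inl (.inl (.inl h))
    · exact (ih₁ h).imp (fun h => .inl (.inr h)) id
    · exact (ih₂ h).imp .inr key
  | letrec f y M N ih₁ ih₂ =>
    simp only [Term.subst, Term.vars, Finset.mem_union] at h ⊢
    rcases h with (h | h) | h
    · exact .inl (.inl (.inl h))
    · exact (ih₁ h).imp (fun h => .inl (.inr h)) fun h => key (key h)
    · exact (ih₂ h).imp .inr key
  | lam y M ih =>
    simp only [Term.subst, Term.vars, Finset.mem_union] at h ⊢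
    rcases h with h | h
    · exact .inl (.inl h)
    · exact (ih h).imp .inr key
  | arith o M N ih₁ ih₂ =>
    simp only [Term.subst, Term.vars, Finset.mem_union] at h ⊢
    rcases h with h | h
    · exact (ih₁ h).imp .inl id
    · exact (ih₂ h).imp .inr id
  | pair M N ih₁ ih₂ =>
    simp only [Term.subst, Term.vars, Finset.mem_union] at h ⊢
    rcases h with h | h
    · exact (ih₁ h).imp .inl id
    · exact (ih₂ h).imp .inr id
  | ite M M₁ M₀ ih ih₁ ih₀ =>
    simp only [Term.subst, Term.vars, Finset.mem_union] at h ⊢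
    rcases h with (h | h) | h
    · exact (ih h).imp (fun h => .inl (.inl h)) id
    · exact (ih₁ h).imp (fun h => .inl (.inr h)) id
    · exact (ih₀ h).imp .inr id
  | assign r M ih => exact ih h
  | fst M ih => exact ih h
  | snd M ih => exact ih h
  | appMeth m' M ih => exact ih h
  | _ => exact .inl h

theorem Term.vars_subst1_var_subset (M : Term Op) (x y : Var) :
    (M.subst1 x (.var y)).vars ⊆ insert y M.vars := by
  intro z hz
  rcases Term.mem_vars_subst hz with h | ⟨x', v, hv, h⟩
  · exact Finset.mem_insert_of_mem h
  · obtain ⟨rfl, rfl⟩ := Subst.single_eq_some.mp hv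
    simp only [Val.fv, Finset.mem_singleton] at h
    simp [h]

theorem Term.refs_subst (s : Subst) (M : Term Op) : (M.subst s).refs = M.refs := by
  induction M generalizing s with
  | var y => rw [Term.subst_var, Val.refs_toTerm]; rfl
  | appVar y M ih =>
    rw [Term.subst_appVar]
    cases (s y).getD (.var y) <;> simp [Val.applyHead, Term.refs, ih]
  | _ => simp_all [Term.subst, Term.refs]

/-- Renaming a variable replaces it in the set of the free variables. -/
theorem Term.mem_fv_subst_renaming {s : Subst} {M : Term Op} {z : Var}
    (hs : ∀ x v, s x = some v → ∃ y, v = .var y) (h : z ∈ (M.subst s).fv) :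
    (z ∈ M.fv ∧ s z = none) ∨ ∃ x ∈ M.fv, s x = some (.var z) := by
  have hd : ∀ {s : Subst} {w : Var}, (∀ x v, s x = some v → ∃ y, v = .var y) →
      ∀ x v, s.drop w x = some v → ∃ y, v = .var y :=
    fun h x v hv => h x v (Subst.drop_eq_some.mp hv).2
  have key : ∀ {s : Subst} {w : Var} {F : Finset Var}, z ≠ w →
      ((z ∈ F ∧ s.drop w z = none) ∨ ∃ x ∈ F, s.drop w x = some (.var z)) →
      ((z ∈ F.erase w ∧ s z = none) ∨ ∃ x ∈ F.erase w, s x = some (.var z)) := by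
    rintro s w F hn (⟨h₁, h₂⟩ | ⟨x, hx, h⟩)
    · simp only [Subst.drop, if_neg hn] at h₂
      exact .inl ⟨Finset.mem_erase.mpr ⟨hn, h₁⟩, h₂⟩
    · obtain ⟨hne, h⟩ := Subst.drop_eq_some.mp h
      exact .inr ⟨x, Finset.mem_erase.mpr ⟨hne, hx⟩, h⟩
  have mono : ∀ {s : Subst} {F F' : Finset Var}, F ⊆ F' →
      ((z ∈ F ∧ s z = none) ∨ ∃ x ∈ F, s x = some (.var z)) →
      ((z ∈ F' ∧ s z = none) ∨ ∃ x ∈ F', s x = some (.var z)) := by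
    rintro s F F' hF (⟨h₁, h₂⟩ | ⟨x, hx, h⟩)
    · exact .inl ⟨hF h₁, h₂⟩
    · exact .inr ⟨x, hF hx, h⟩
  induction M generalizing s with
  | var y =>
    rw [Term.subst_var, Val.fv_toTerm] at h
    rcases hy : s y with _ | w
    · simp only [hy, Option.getD_none, Val.fv, Finset.mem_singleton] at h
      subst h
      exact .inl ⟨by simp [Term.fv], hy⟩
    · obtain ⟨w', rfl⟩ := hs y w hy
      simp only [hy, Option.getD_some, Val.fv, Finset.mem_singleton] at h
      subst h
      exact .inr ⟨y, by simp [Term.fv], hy⟩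
  | appVar y M ih =>
    rw [Term.subst_appVar] at h
    have hM : z ∈ (M.subst s).fv → _ := fun h =>
      mono (F' := (Term.appVar y M).fv) (by simp [Term.fv]) (ih hs h)
    rcases hy : s y with _ | w
    · simp only [hy, Option.getD_none, Val.applyHead, Term.fv, Finset.mem_union,
        Finset.mem_singleton] at h
      rcases h with rfl | h
      · exact .inl ⟨by simp [Term.fv], hy⟩
      · exact hM h
    · obtain ⟨w', rfl⟩ := hs y w hy
      simp only [hy, Option.getD_some, Val.applyHead, Term.fv, Finset.mem_union,
        Finset.mem_singleton] at h
      rcases h with rfl | h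
      · exact .inr ⟨y, by simp [Term.fv], hy⟩
      · exact hM h
  | letin y M N ih₁ ih₂ =>
    simp only [Term.subst, Term.fv, Finset.mem_union, Finset.mem_erase] at h
    rcases h with h | ⟨hn, h⟩
    · exact mono (by simp [Term.fv]) (ih₁ hs h)
    · exact mono (by simp [Term.fv]) (key hn (ih₂ (hd hs) h))
  | letrec f y M N ih₁ ih₂ =>
    simp only [Term.subst, Term.fv, Finset.mem_union, Finset.mem_erase] at h
    rcases h with ⟨hn, hn', h⟩ | ⟨hn, h⟩
    · exact mono (by simp [Term.fv]) (key hn (key hn' (ih₁ (hd (hd hs)) h)))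
    · exact mono (by simp [Term.fv]) (key hn (ih₂ (hd hs) h))
  | lam y M ih =>
    simp only [Term.subst, Term.fv, Finset.mem_erase] at h
    exact mono (by simp [Term.fv]) (key h.1 (ih (hd hs) h.2))
  | arith o M N ih₁ ih₂ =>
    simp only [Term.subst, Term.fv, Finset.mem_union] at h
    rcases h with h | h
    · exact mono (by simp [Term.fv]) (ih₁ hs h)
    · exact mono (by simp [Term.fv]) (ih₂ hs h)
  | pair M N ih₁ ih₂ =>
    simp only [Term.subst, Term.fv, Finset.mem_union] at h
    rcases h with h | h
    · exact mono (by simp [Term.fv]) (ih₁ hs h)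
    · exact mono (by simp [Term.fv]) (ih₂ hs h)
  | ite M M₁ M₀ ih ih₁ ih₀ =>
    simp only [Term.subst, Term.fv, Finset.mem_union] at h
    rcases h with (h | h) | h
    · refine mono ?_ (ih hs h)
      intro a ha; simp [Term.fv, ha]
    · refine mono ?_ (ih₁ hs h)
      intro a ha; simp [Term.fv, ha]
    · refine mono ?_ (ih₀ hs h)
      intro a ha; simp [Term.fv, ha]
  | assign r M ih => exact ih hs h
  | fst M ih => exact ih hs h
  | snd M ih => exact ih hs h
  | appMeth m M ih => exact ih hs h
  | _ => simp [Term.subst, Term.fv] at h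

theorem Term.fv_subst1_var_subset (M : Term Op) (x y : Var) :
    (M.subst1 x (.var y)).fv ⊆ insert y (M.fv.erase x) := by
  intro z hz
  have hr : ∀ x' v, Subst.single x (.var y) x' = some v → ∃ y, v = .var y := by
    intro x' v hv
    exact ⟨y, (Subst.single_eq_some.mp hv).2.symm⟩
  rcases Term.mem_fv_subst_renaming hr hz with ⟨h, hn⟩ | ⟨x', hx', h⟩
  · refine Finset.mem_insert_of_mem (Finset.mem_erase.mpr ⟨?_, h⟩)
    rintro rfl
    simp [Subst.single] at hn
  · obtain ⟨-, hv⟩ := Subst.single_eq_some.mp h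
    cases hv
    exact Finset.mem_insert_self _ _

end Substitution

/-! ### Renaming of method names -/

section Renaming

variable {Op : Type u}

/-- The action of a permutation of the method names on terms. -/
def Term.perm (π : Equiv.Perm Meth) : Term Op → Term Op
  | .fail θ => .fail θ
  | .var x => .var x
  | .meth m => .meth (π m)
  | .int i => .int i
  | .unit => .unit
  | .assign r M => .assign r (M.perm π)
  | .deref r => .deref r
  | .arith o M N => .arith o (M.perm π) (N.perm π)
  | .pair M N => .pair (M.perm π) (N.perm π)
  | .fst M => .fst (M.perm π)
  | .snd M => .snd (M.perm π)
  | .appVar x M => .appVar x (M.perm π)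
  | .appMeth m M => .appMeth (π m) (M.perm π)
  | .ite M M₁ M₀ => .ite (M.perm π) (M₁.perm π) (M₀.perm π)
  | .letin x M N => .letin x (M.perm π) (N.perm π)
  | .letrec f x M N => .letrec f x (M.perm π) (N.perm π)
  | .lam x M => .lam x (M.perm π)

/-- The action of a permutation of the method names on `λ`-abstractions. -/
def Lam.perm (π : Equiv.Perm Meth) (L : Lam Op) : Lam Op := ⟨L.param, L.body.perm π⟩

/-- The repository `R₂` is the image of `R` under the renaming `π`, which acts on the method names
in the domain as well as on the bodies. -/
def RepoPerm (π : Equiv.Perm Meth) (R R₂ : Repo Op) : Prop :=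
  ∀ m, R₂.lookup (π m) = (R.lookup m).map (Lam.perm π)

/-- The store `S₂` is the image of `S` under the renaming `π`. -/
def StorePerm (π : Equiv.Perm Meth) (S S₂ : Store) : Prop :=
  ∀ r, S₂.lookup r = (S.lookup r).map (Val.perm π)

theorem Val.perm_toTerm (π : Equiv.Perm Meth) (v : Val) :
    (v.toTerm : Term Op).perm π = (v.perm π).toTerm := by
  induction v <;> simp_all [Val.toTerm, Term.perm, Val.perm]

theorem Term.perm_subst (π : Equiv.Perm Meth) (s : Subst) (M : Term Op) :
    (M.subst s).perm π = (M.perm π).subst fun x => (s x).map (Val.perm π) := by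
  have hd : ∀ (s : Subst) (y : Var), (fun x => (s.drop y x).map (Val.perm π)) =
      Subst.drop (fun x => (s x).map (Val.perm π)) y := by
    intro s y
    funext x
    unfold Subst.drop
    split_ifs <;> rfl
  induction M generalizing s with
  | var x =>
    simp only [Term.subst, Term.perm]
    rcases s x with _ | v
    · rfl
    · simp [Val.perm_toTerm]
  | appVar x M ih =>
    simp only [Term.subst, Term.perm, ← ih]
    rcases s x with _ | v
    · rfl
    · cases v <;> rfl
  | _ => simp_all [Term.subst, Term.perm]

theorem Term.perm_subst1 (π : Equiv.Perm Meth) (M : Term Op) (x : Var) (v : Val) :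
    (M.subst1 x v).perm π = (M.perm π).subst1 x (v.perm π) := by
  unfold Term.subst1
  rw [Term.perm_subst]
  congr 1
  funext y
  unfold Subst.single
  split_ifs <;> rfl

theorem Lam.perm_subst1 (π : Equiv.Perm Meth) (L : Lam Op) (x : Var) (v : Val) :
    (L.subst1 x v).perm π = (L.perm π).subst1 x (v.perm π) := by
  simp only [Lam.subst1, Lam.subst, Lam.perm, Term.perm_subst, Lam.mk.injEq, true_and]
  congr 1
  funext y
  unfold Subst.drop Subst.single
  split_ifs <;> rfl

theorem HasType.perm {π : Equiv.Perm Meth} (hπ : IsNamePerm π) {M : Term Op} {θ : Ty}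
    (h : HasType M θ) : HasType (M.perm π) θ := by
  induction h with
  | meth m => rw [← hπ.ty_eq m]; exact .meth _
  | @appMeth m M hM ih =>
    have := hπ.ty_eq m
    simp only [Meth.ty, Ty.arr.injEq] at this
    rw [← this.2]
    rw [← this.1] at ih
    exact .appMeth ih
  | fail θ => exact .fail θ
  | var x => exact .var x
  | int i => exact .int i
  | unit => exact .unit
  | assign _ ih => exact .assign ih
  | deref r => exact .deref r
  | arith _ _ ih₁ ih₂ => exact .arith ih₁ ih₂
  | pair _ _ ih₁ ih₂ => exact .pair ih₁ ih₂
  | fst _ ih => exact .fst ih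
  | snd _ ih => exact .snd ih
  | appVar hx _ ih => exact .appVar hx ih
  | ite _ _ _ ih ih₁ ih₀ => exact .ite ih ih₁ ih₀
  | letin _ _ ih₁ ih₂ => exact .letin ih₁ ih₂
  | letrec hf _ _ ih₁ ih₂ => exact .letrec hf ih₁ ih₂
  | lam _ ih => exact .lam ih

theorem Val.perm_congr {π π' : Equiv.Perm Meth} {v : Val} (h : ∀ m ∈ v.meths, π' m = π m) :
    v.perm π' = v.perm π := by
  induction v <;> simp_all [Val.perm, Val.meths]

theorem Val.perm_one (v : Val) : v.perm 1 = v := by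
  induction v <;> simp_all [Val.perm]

theorem Term.perm_congr {π π' : Equiv.Perm Meth} {M : Term Op} (h : ∀ m ∈ M.meths, π' m = π m) :
    M.perm π' = M.perm π := by
  induction M <;> simp_all [Term.perm, Term.meths]

theorem Term.perm_one (M : Term Op) : M.perm 1 = M := by
  induction M <;> simp_all [Term.perm]

theorem Outcome.Aborts.perm {χ : Outcome} (h : χ.Aborts) (π : Equiv.Perm Meth) :
    χ.perm π = χ := by
  cases χ <;> simp_all [Outcome.perm, Outcome.Aborts]

theorem Val.fv_perm (π : Equiv.Perm Meth) (v : Val) : (v.perm π).fv = v.fv := by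
  induction v <;> simp_all [Val.perm, Val.fv]

theorem RepoPerm.insert {π : Equiv.Perm Meth} {R R₂ : Repo Op} (h : RepoPerm π R R₂) (m : Meth)
    (L : Lam Op) : RepoPerm π (R.insert m L) (R₂.insert (π m) (L.perm π)) := by
  intro m'
  simp only [lookup_insert_eq_ite, EmbeddingLike.apply_eq_iff_eq]
  split_ifs
  · rfl
  · exact h m'

theorem StorePerm.insert {π : Equiv.Perm Meth} {S S₂ : Store} (h : StorePerm π S S₂) (r : Ref)
    (v : Val) : StorePerm π (S.insert r v) (S₂.insert r (v.perm π)) := by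
  intro r'
  simp only [lookup_insert_eq_ite]
  split_ifs
  · rfl
  · exact h r'

theorem RepoPerm.notMem {π : Equiv.Perm Meth} {R R₂ : Repo Op} (h : RepoPerm π R R₂) {m : Meth}
    (hm : m ∉ R) : π m ∉ R₂ := by
  rw [← Finmap.lookup_eq_none, h m, Finmap.lookup_eq_none.mpr hm]
  rfl

theorem RepoPerm.mem {π : Equiv.Perm Meth} {R R₂ : Repo Op} (h : RepoPerm π R R₂) {m : Meth}
    (hm : m ∈ R) : π m ∈ R₂ := by
  obtain ⟨L, hL⟩ := Finmap.mem_iff.mp hm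
  rw [Finmap.mem_iff, h m, hL]
  exact ⟨_, rfl⟩

/-- The method names in the bodies of a repository and in a store belong to the domain of the
repository. -/
structure ScopedMeths (R : Repo Op) (S : Store) : Prop where
  repo : ∀ m L, R.lookup m = some L → L.body.meths ⊆ R.keys
  store : ∀ r v, S.lookup r = some v → v.meths ⊆ R.keys

theorem RepoPerm.congr {π π' : Equiv.Perm Meth} {R R₂ : Repo Op} {S : Store}
    (hsc : ScopedMeths R S) (h : RepoPerm π R R₂) (hπ : ∀ m ∈ R.keys, π' m = π m) :
    RepoPerm π' R R₂ := by
  intro m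
  by_cases hm : m ∈ R.keys
  · obtain ⟨L, hL⟩ := (mem_keys_iff_lookup R m).mp hm
    rw [hπ m hm, h m, hL]
    simp only [Option.map_some, Lam.perm, Option.some.injEq, Lam.mk.injEq, true_and]
    exact (Term.perm_congr fun m' hm' => hπ m' (hsc.repo m L hL hm')).symm
  · rw [lookup_eq_none_of_notMem_keys hm]
    obtain ⟨m'', hm''⟩ := π.surjective (π' m)
    rw [← hm'', h m'', lookup_eq_none_of_notMem_keys (k := m'')]
    · rfl
    · intro h'
      apply hm
      rw [← hπ m'' h'] at hm''
      exact π'.injective hm'' ▸ h'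

theorem StorePerm.congr {π π' : Equiv.Perm Meth} {R : Repo Op} {S S₂ : Store}
    (hsc : ScopedMeths R S) (h : StorePerm π S S₂) (hπ : ∀ m ∈ R.keys, π' m = π m) :
    StorePerm π' S S₂ := by
  intro r
  rw [h r]
  rcases hr : S.lookup r with _ | v
  · rfl
  · simp only [Option.map_some,
      Val.perm_congr fun m' hm' => hπ m' (hsc.store r v hr hm')]

/-- Two fresh names of the same type can be identified by changing the renaming outside the domain
of the repository. -/
theorem RepoPerm.exists_extend {π : Equiv.Perm Meth} (hπ : IsNamePerm π) {R R₂ : Repo Op}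
    (h : RepoPerm π R R₂) {m m₂ : Meth} (hm : m ∉ R) (hm₂ : m₂ ∉ R₂) (hty : m₂.ty = m.ty) :
    ∃ π' : Equiv.Perm Meth, IsNamePerm π' ∧ (∀ m' ∈ R.keys, π' m' = π m') ∧ π' m = m₂ := by
  -- neither `π m` nor `m₂` is the image of a name in the domain of `R`
  refine ⟨Equiv.swap (π m) m₂ * π, ⟨fun m' => ?_, ?_⟩, fun m' hm' => ?_, ?_⟩
  · rw [← hπ.ty_eq m', Equiv.Perm.mul_apply]
    by_cases h₁ : π m' = π m
    · rw [h₁, Equiv.swap_apply_left, hty, hπ.ty_eq]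
    · by_cases h₂ : π m' = m₂
      · rw [h₂, Equiv.swap_apply_right, hty, hπ.ty_eq]
      · rw [Equiv.swap_apply_of_ne_of_ne h₁ h₂]
  · refine (hπ.finite.union (Set.toFinite {m, π.symm m₂})).subset fun m' hm' => ?_
    by_contra hn
    simp only [Set.mem_union, Set.mem_ofPred_eq, Set.mem_insert_iff, Set.mem_singleton_iff,
      not_or, not_not] at hn
    refine hm' ?_
    rw [Equiv.Perm.mul_apply, Equiv.swap_apply_of_ne_of_ne]
    · exact hn.1
    · exact fun e => hn.2.1 (π.injective e)
    · exact fun e => hn.2.2 (by rw [← e, Equiv.symm_apply_apply])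
  · rw [Finmap.mem_keys] at hm'
    rw [Equiv.Perm.mul_apply, Equiv.swap_apply_of_ne_of_ne]
    · exact fun e => hm (π.injective e ▸ hm')
    · rintro rfl
      exact hm₂ (h.mem hm')
  · simp

end Renaming

/-! ### Evaluation: equivariance and scoping -/

section Evaluation

variable {Op : Type u} {I : Op → ℤ → ℤ → ℤ}

/-- Evaluation is equivariant under renamings of the method names. -/
theorem Eval.perm {π : Equiv.Perm Meth} (hπ : IsNamePerm π) {M : Term Op} {R R' : Repo Op}
    {S S' : Store} {k : Option ℕ} {χ : Outcome} (h : Eval I M R S k χ R' S') :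
    ∀ {R₂ : Repo Op} {S₂ : Store}, RepoPerm π R R₂ → StorePerm π S S₂ →
      ∃ R₂' S₂', RepoPerm π R' R₂' ∧ StorePerm π S' S₂' ∧
        Eval I (M.perm π) R₂ S₂ k (χ.perm π) R₂' S₂' := by
  have hab : ∀ {χ : Outcome}, χ.Aborts → (χ.perm π).Aborts := fun h => (h.perm π).symm ▸ h
  induction h with
  | nil => intro R₂ S₂ hR hS; exact ⟨R₂, S₂, hR, hS, .nil⟩
  | fail => intro R₂ S₂ hR hS; exact ⟨R₂, S₂, hR, hS, .fail⟩
  | val =>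
    intro R₂ S₂ hR hS
    rw [Val.perm_toTerm]
    exact ⟨R₂, S₂, hR, hS, .val⟩
  | deref hr =>
    intro R₂ S₂ hR hS
    exact ⟨R₂, S₂, hR, hS, .deref (by rw [hS, hr]; rfl)⟩
  | lam hm ht =>
    intro R₂ S₂ hR hS
    refine ⟨_, S₂, hR.insert _ _, hS, .lam (hR.notMem hm) ?_⟩
    rw [hπ.ty_eq]
    exact ht.perm hπ
  | fst _ ih =>
    intro R₂ S₂ hR hS
    obtain ⟨R₂', S₂', h₁, h₂, h₃⟩ := ih hR hS
    exact ⟨R₂', S₂', h₁, h₂, .fst h₃⟩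
  | fst_abort ha _ ih =>
    intro R₂ S₂ hR hS
    obtain ⟨R₂', S₂', h₁, h₂, h₃⟩ := ih hR hS
    exact ⟨R₂', S₂', h₁, h₂, .fst_abort (hab ha) h₃⟩
  | snd _ ih =>
    intro R₂ S₂ hR hS
    obtain ⟨R₂', S₂', h₁, h₂, h₃⟩ := ih hR hS
    exact ⟨R₂', S₂', h₁, h₂, .snd h₃⟩
  | snd_abort ha _ ih =>
    intro R₂ S₂ hR hS
    obtain ⟨R₂', S₂', h₁, h₂, h₃⟩ := ih hR hS
    exact ⟨R₂', S₂', h₁, h₂, .snd_abort (hab ha) h₃⟩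
  | assign _ ih =>
    intro R₂ S₂ hR hS
    obtain ⟨R₂', S₂', h₁, h₂, h₃⟩ := ih hR hS
    exact ⟨R₂', _, h₁, h₂.insert _ _, .assign h₃⟩
  | assign_abort ha _ ih =>
    intro R₂ S₂ hR hS
    obtain ⟨R₂', S₂', h₁, h₂, h₃⟩ := ih hR hS
    exact ⟨R₂', S₂', h₁, h₂, .assign_abort (hab ha) h₃⟩
  | arith _ _ ih₁ ih₂ =>
    intro R₂ S₂ hR hS
    obtain ⟨R₂', S₂', h₁, h₂, h₃⟩ := ih₁ hR hS
    obtain ⟨R₂'', S₂'', h₁', h₂', h₃'⟩ := ih₂ h₁ h₂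
    exact ⟨R₂'', S₂'', h₁', h₂', .arith h₃ h₃'⟩
  | arith_abort₁ ha _ ih =>
    intro R₂ S₂ hR hS
    obtain ⟨R₂', S₂', h₁, h₂, h₃⟩ := ih hR hS
    exact ⟨R₂', S₂', h₁, h₂, .arith_abort₁ (hab ha) h₃⟩
  | arith_abort₂ ha _ _ ih₁ ih₂ =>
    intro R₂ S₂ hR hS
    obtain ⟨R₂', S₂', h₁, h₂, h₃⟩ := ih₁ hR hS
    obtain ⟨R₂'', S₂'', h₁', h₂', h₃'⟩ := ih₂ h₁ h₂
    exact ⟨R₂'', S₂'', h₁', h₂', .arith_abort₂ (hab ha) h₃ h₃'⟩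
  | pair _ _ ih₁ ih₂ =>
    intro R₂ S₂ hR hS
    obtain ⟨R₂', S₂', h₁, h₂, h₃⟩ := ih₁ hR hS
    obtain ⟨R₂'', S₂'', h₁', h₂', h₃'⟩ := ih₂ h₁ h₂
    exact ⟨R₂'', S₂'', h₁', h₂', .pair h₃ h₃'⟩
  | pair_abort₁ ha _ ih =>
    intro R₂ S₂ hR hS
    obtain ⟨R₂', S₂', h₁, h₂, h₃⟩ := ih hR hS
    exact ⟨R₂', S₂', h₁, h₂, .pair_abort₁ (hab ha) h₃⟩
  | pair_abort₂ ha _ _ ih₁ ih₂ =>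
    intro R₂ S₂ hR hS
    obtain ⟨R₂', S₂', h₁, h₂, h₃⟩ := ih₁ hR hS
    obtain ⟨R₂'', S₂'', h₁', h₂', h₃'⟩ := ih₂ h₁ h₂
    exact ⟨R₂'', S₂'', h₁', h₂', .pair_abort₂ (hab ha) h₃ h₃'⟩
  | letin _ _ ih₁ ih₂ =>
    intro R₂ S₂ hR hS
    obtain ⟨R₂', S₂', h₁, h₂, h₃⟩ := ih₁ hR hS
    obtain ⟨R₂'', S₂'', h₁', h₂', h₃'⟩ := ih₂ h₁ h₂
    rw [Term.perm_subst1] at h₃'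
    exact ⟨R₂'', S₂'', h₁', h₂', .letin h₃ h₃'⟩
  | letin_abort ha _ ih =>
    intro R₂ S₂ hR hS
    obtain ⟨R₂', S₂', h₁, h₂, h₃⟩ := ih hR hS
    exact ⟨R₂', S₂', h₁, h₂, .letin_abort (hab ha) h₃⟩
  | app hm _ _ ih₁ ih₂ =>
    intro R₂ S₂ hR hS
    obtain ⟨R₂', S₂', h₁, h₂, h₃⟩ := ih₁ hR hS
    obtain ⟨R₂'', S₂'', h₁', h₂', h₃'⟩ := ih₂ h₁ h₂
    rw [Term.perm_subst1] at h₃'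
    exact ⟨R₂'', S₂'', h₁', h₂', .app (L := Lam.perm π _) (by rw [hR, hm]; rfl) h₃ h₃'⟩
  | app_abort ha _ ih =>
    intro R₂ S₂ hR hS
    obtain ⟨R₂', S₂', h₁, h₂, h₃⟩ := ih hR hS
    exact ⟨R₂', S₂', h₁, h₂, .app_abort (hab ha) h₃⟩
  | @ite _ _ _ i _ _ _ _ _ _ _ _ _ _ ih₁ ih₂ =>
    intro R₂ S₂ hR hS
    obtain ⟨R₂', S₂', h₁, h₂, h₃⟩ := ih₁ hR hS
    obtain ⟨R₂'', S₂'', h₁', h₂', h₃'⟩ := ih₂ h₁ h₂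
    refine ⟨R₂'', S₂'', h₁', h₂', .ite h₃ ?_⟩
    split_ifs at h₃' ⊢ <;> exact h₃'
  | ite_abort ha _ ih =>
    intro R₂ S₂ hR hS
    obtain ⟨R₂', S₂', h₁, h₂, h₃⟩ := ih hR hS
    exact ⟨R₂', S₂', h₁, h₂, .ite_abort (hab ha) h₃⟩
  | @letrec f x M N m _ R _ _ _ _ hm hty _ ih =>
    intro R₂ S₂ hR hS
    obtain ⟨R₂', S₂', h₁, h₂, h₃⟩ := ih (hR.insert m _) hS
    rw [Term.perm_subst1, Lam.perm_subst1] at h₃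
    exact ⟨R₂', S₂', h₁, h₂, .letrec (hR.notMem hm) ((hπ.ty_eq m).trans hty) h₃⟩

theorem Term.meths_subst1_subset {M : Term Op} {x : Var} {v : Val} {F : Finset Meth}
    (hM : M.meths ⊆ F) (hv : v.meths ⊆ F) : (M.subst1 x v).meths ⊆ F := by
  intro m hm
  rcases Term.mem_meths_subst hm with h | ⟨y, -, w, hw, h⟩
  · exact hM h
  · obtain ⟨-, rfl⟩ := Subst.single_eq_some.mp hw
    exact hv h

theorem ScopedMeths.insert_repo {R : Repo Op} {S : Store} (h : ScopedMeths R S) {m : Meth}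
    {L : Lam Op} (hL : L.body.meths ⊆ insert m R.keys) : ScopedMeths (R.insert m L) S := by
  constructor
  · intro m' L' h'
    rw [keys_insert]
    rw [lookup_insert_eq_ite] at h'
    split_ifs at h'
    · cases h'; exact hL
    · exact (h.repo m' L' h').trans (Finset.subset_insert _ _)
  · intro r v hv
    rw [keys_insert]
    exact (h.store r v hv).trans (Finset.subset_insert _ _)

theorem ScopedMeths.insert_store {R : Repo Op} {S : Store} (h : ScopedMeths R S) {r : Ref}
    {v : Val} (hv : v.meths ⊆ R.keys) : ScopedMeths R (S.insert r v) := by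
  refine ⟨h.repo, fun r' v' h' => ?_⟩
  rw [lookup_insert_eq_ite] at h'
  split_ifs at h'
  · cases h'; exact hv
  · exact h.store r' v' h'

theorem Lam.meths_subst1_subset {L : Lam Op} {x : Var} {v : Val} {F : Finset Meth}
    (hM : L.body.meths ⊆ F) (hv : v.meths ⊆ F) : (L.subst1 x v).body.meths ⊆ F := by
  intro m hm
  rcases Term.mem_meths_subst hm with h | ⟨y, -, w, hw, h⟩
  · exact hM h
  · obtain ⟨-, rfl⟩ := Subst.single_eq_some.mp (Subst.drop_eq_some.mp hw).2
    exact hv h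

/-- Evaluation preserves the scoping of method names. -/
theorem Eval.scoped {M : Term Op} {R R' : Repo Op} {S S' : Store} {k : Option ℕ} {χ : Outcome}
    (h : Eval I M R S k χ R' S') : M.meths ⊆ R.keys → ScopedMeths R S →
      R.keys ⊆ R'.keys ∧ ScopedMeths R' S' ∧ ∀ v, χ = .val v → v.meths ⊆ R'.keys := by
  induction h with
  | nil => intro _ hS; exact ⟨subset_rfl, hS, by simp⟩
  | fail => intro _ hS; exact ⟨subset_rfl, hS, by simp⟩
  | val => intro hM hS; exact ⟨subset_rfl, hS, by rintro _ ⟨⟩; simpa using hM⟩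
  | deref hr => intro _ hS; exact ⟨subset_rfl, hS, by rintro _ ⟨⟩; exact hS.store _ _ hr⟩
  | lam hm ht =>
    intro hM hS
    refine ⟨?_, hS.insert_repo (hM.trans (Finset.subset_insert _ _)), ?_⟩
    · rw [keys_insert]; exact Finset.subset_insert _ _
    · rintro _ ⟨⟩
      simp [Val.meths, keys_insert]
  | fst _ ih =>
    intro hM hS
    obtain ⟨h₁, h₂, h₃⟩ := ih hM hS
    refine ⟨h₁, h₂, ?_⟩
    rintro _ ⟨⟩
    exact Finset.union_subset_left (h₃ _ rfl)
  | fst_abort _ _ ih => exact ih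
  | snd _ ih =>
    intro hM hS
    obtain ⟨h₁, h₂, h₃⟩ := ih hM hS
    refine ⟨h₁, h₂, ?_⟩
    rintro _ ⟨⟩
    exact Finset.union_subset_right (h₃ _ rfl)
  | snd_abort _ _ ih => exact ih
  | assign _ ih =>
    intro hM hS
    obtain ⟨h₁, h₂, h₃⟩ := ih hM hS
    refine ⟨h₁, h₂.insert_store (h₃ _ rfl), ?_⟩
    rintro _ ⟨⟩
    simp [Val.meths]
  | assign_abort _ _ ih => exact ih
  | arith _ _ ih₁ ih₂ =>
    intro hM hS
    obtain ⟨h₁, h₂, h₃⟩ := ih₁ (Finset.union_subset_left hM) hS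
    obtain ⟨h₁', h₂', h₃'⟩ := ih₂ ((Finset.union_subset_right hM).trans h₁) h₂
    refine ⟨h₁.trans h₁', h₂', ?_⟩
    rintro _ ⟨⟩
    simp [Val.meths]
  | arith_abort₁ _ _ ih => exact fun hM hS => ih (Finset.union_subset_left hM) hS
  | arith_abort₂ _ _ _ ih₁ ih₂ =>
    intro hM hS
    obtain ⟨h₁, h₂, h₃⟩ := ih₁ (Finset.union_subset_left hM) hS
    obtain ⟨h₁', h₂', h₃'⟩ := ih₂ ((Finset.union_subset_right hM).trans h₁) h₂
    exact ⟨h₁.trans h₁', h₂', h₃'⟩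
  | pair _ _ ih₁ ih₂ =>
    intro hM hS
    obtain ⟨h₁, h₂, h₃⟩ := ih₁ (Finset.union_subset_left hM) hS
    obtain ⟨h₁', h₂', h₃'⟩ := ih₂ ((Finset.union_subset_right hM).trans h₁) h₂
    refine ⟨h₁.trans h₁', h₂', ?_⟩
    rintro _ ⟨⟩
    exact Finset.union_subset ((h₃ _ rfl).trans h₁') (h₃' _ rfl)
  | pair_abort₁ _ _ ih => exact fun hM hS => ih (Finset.union_subset_left hM) hS
  | pair_abort₂ _ _ _ ih₁ ih₂ =>
    intro hM hS
    obtain ⟨h₁, h₂, h₃⟩ := ih₁ (Finset.union_subset_left hM) hS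
    obtain ⟨h₁', h₂', h₃'⟩ := ih₂ ((Finset.union_subset_right hM).trans h₁) h₂
    exact ⟨h₁.trans h₁', h₂', h₃'⟩
  | letin _ _ ih₁ ih₂ =>
    intro hM hS
    obtain ⟨h₁, h₂, h₃⟩ := ih₁ (Finset.union_subset_left hM) hS
    obtain ⟨h₁', h₂', h₃'⟩ := ih₂ (Term.meths_subst1_subset
      ((Finset.union_subset_right hM).trans h₁) (h₃ _ rfl)) h₂
    exact ⟨h₁.trans h₁', h₂', h₃'⟩
  | letin_abort _ _ ih => exact fun hM hS => ih (Finset.union_subset_left hM) hS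
  | app hm _ _ ih₁ ih₂ =>
    intro hM hS
    obtain ⟨h₁, h₂, h₃⟩ := ih₁ (Finset.union_subset_right hM) hS
    obtain ⟨h₁', h₂', h₃'⟩ := ih₂ (Term.meths_subst1_subset
      ((hS.repo _ _ hm).trans h₁) (h₃ _ rfl)) h₂
    exact ⟨h₁.trans h₁', h₂', h₃'⟩
  | app_abort _ _ ih => exact fun hM hS => ih (Finset.union_subset_right hM) hS
  | ite _ _ ih₁ ih₂ =>
    intro hM hS
    simp only [Term.meths, Finset.union_subset_iff] at hM
    obtain ⟨h₁, h₂, h₃⟩ := ih₁ hM.1.1 hS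
    obtain ⟨h₁', h₂', h₃'⟩ := ih₂
      (by split_ifs; exacts [hM.2.trans h₁, hM.1.2.trans h₁]) h₂
    exact ⟨h₁.trans h₁', h₂', h₃'⟩
  | ite_abort _ _ ih =>
    intro hM hS
    simp only [Term.meths, Finset.union_subset_iff] at hM
    exact ih hM.1.1 hS
  | @letrec f x M N m _ R _ _ _ _ hm hty _ ih =>
    intro hM hS
    have hs : R.keys ⊆ insert m R.keys := Finset.subset_insert _ _
    have hm' : (Val.meth m).meths ⊆ insert m R.keys := by simp [Val.meths]
    obtain ⟨h₁, h₂, h₃⟩ := ih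
      (by
        rw [keys_insert]
        exact Term.meths_subst1_subset ((Finset.union_subset_right hM).trans hs) hm')
      (hS.insert_repo (Lam.meths_subst1_subset ((Finset.union_subset_left hM).trans hs) hm'))
    rw [keys_insert] at h₁
    exact ⟨hs.trans h₁, h₂, h₃⟩

end Evaluation

/-! ### Inversion of the evaluation rules -/

section Inversion

variable {Op : Type u} {I : Op → ℤ → ℤ → ℤ} {R R' : Repo Op} {S S' : Store} {k : ℕ} {χ : Outcome}

theorem Eval.nil_inv {M : Term Op} (h : Eval I M R S none χ R' S') :
    χ = .nil ∧ R' = R ∧ S' = S := by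
  cases h
  exact ⟨rfl, rfl, rfl⟩

theorem Eval.fail_inv {θ : Ty} (h : Eval I (.fail θ) R S (some k) χ R' S') :
    χ = .fail ∧ R' = R ∧ S' = S := by
  generalize hT : Term.fail θ = T at h
  cases h with
  | @val v => cases v <;> cases hT
  | fail => exact ⟨rfl, rfl, rfl⟩
  | _ => cases hT

theorem Eval.deref_inv {r : Ref} (h : Eval I (.deref r) R S (some k) χ R' S') :
    ∃ v, S.lookup r = some v ∧ χ = .val v ∧ R' = R ∧ S' = S := by
  generalize hT : Term.deref r = T at h
  cases h with
  | @val v => cases v <;> cases hT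
  | deref hr => cases hT; exact ⟨_, hr, rfl, rfl, rfl⟩
  | _ => cases hT

theorem Eval.lam_inv {x : Var} {M : Term Op} (h : Eval I (.lam x M) R S (some k) χ R' S') :
    ∃ m, m ∉ R ∧ HasType (.lam x M) m.ty ∧ χ = .val (.meth m) ∧ R' = R.insert m ⟨x, M⟩ ∧
      S' = S := by
  generalize hT : Term.lam x M = T at h
  cases h with
  | @val v => cases v <;> cases hT
  | lam hm ht => cases hT; exact ⟨_, hm, ht, rfl, rfl, rfl⟩
  | _ => cases hT

theorem Eval.fst_inv {M : Term Op} (h : Eval I (.fst M) R S (some k) χ R' S') :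
    (∃ v w, χ = .val v ∧ Eval I M R S (some k) (.val (.pair v w)) R' S') ∨
      (χ.Aborts ∧ Eval I M R S (some k) χ R' S') := by
  generalize hT : Term.fst M = T at h
  cases h with
  | @val v => cases v <;> cases hT
  | fst h => cases hT; exact .inl ⟨_, _, rfl, h⟩
  | fst_abort ha h => cases hT; exact .inr ⟨ha, h⟩
  | _ => cases hT

theorem Eval.snd_inv {M : Term Op} (h : Eval I (.snd M) R S (some k) χ R' S') :
    (∃ v w, χ = .val w ∧ Eval I M R S (some k) (.val (.pair v w)) R' S') ∨
      (χ.Aborts ∧ Eval I M R S (some k) χ R' S') := by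
  generalize hT : Term.snd M = T at h
  cases h with
  | @val v => cases v <;> cases hT
  | snd h => cases hT; exact .inl ⟨_, _, rfl, h⟩
  | snd_abort ha h => cases hT; exact .inr ⟨ha, h⟩
  | _ => cases hT

theorem Eval.assign_inv {r : Ref} {M : Term Op} (h : Eval I (.assign r M) R S (some k) χ R' S') :
    (∃ v S₁, χ = .val .unit ∧ S' = S₁.insert r v ∧ Eval I M R S (some k) (.val v) R' S₁) ∨
      (χ.Aborts ∧ Eval I M R S (some k) χ R' S') := by
  generalize hT : Term.assign r M = T at h
  cases h with
  | @val v => cases v <;> cases hT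
  | assign h => cases hT; exact .inl ⟨_, _, rfl, rfl, h⟩
  | assign_abort ha h => cases hT; exact .inr ⟨ha, h⟩
  | _ => cases hT

theorem Eval.arith_inv {o : Op} {M N : Term Op}
    (h : Eval I (.arith o M N) R S (some k) χ R' S') :
    (χ.Aborts ∧ Eval I M R S (some k) χ R' S') ∨
      ∃ i R₁ S₁, Eval I M R S (some k) (.val (.int i)) R₁ S₁ ∧
        ((∃ j, χ = .val (.int (I o i j)) ∧ Eval I N R₁ S₁ (some k) (.val (.int j)) R' S') ∨
          (χ.Aborts ∧ Eval I N R₁ S₁ (some k) χ R' S')) := by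
  generalize hT : Term.arith o M N = T at h
  cases h with
  | @val v => cases v <;> cases hT
  | arith h₁ h₂ => cases hT; exact .inr ⟨_, _, _, h₁, .inl ⟨_, rfl, h₂⟩⟩
  | arith_abort₁ ha h => cases hT; exact .inl ⟨ha, h⟩
  | arith_abort₂ ha h₁ h₂ => cases hT; exact .inr ⟨_, _, _, h₁, .inr ⟨ha, h₂⟩⟩
  | _ => cases hT

theorem Eval.pair_inv {M N : Term Op} (h : Eval I (.pair M N) R S (some k) χ R' S') :
    (χ.Aborts ∧ Eval I M R S (some k) χ R' S') ∨
      ∃ v R₁ S₁, Eval I M R S (some k) (.val v) R₁ S₁ ∧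
        ((∃ w, χ = .val (.pair v w) ∧ Eval I N R₁ S₁ (some k) (.val w) R' S') ∨
          (χ.Aborts ∧ Eval I N R₁ S₁ (some k) χ R' S')) := by
  generalize hT : Term.pair M N = T at h
  cases h with
  | @val v =>
    cases v <;> cases hT
    exact .inr ⟨_, _, _, .val, .inl ⟨_, rfl, .val⟩⟩
  | pair h₁ h₂ => cases hT; exact .inr ⟨_, _, _, h₁, .inl ⟨_, rfl, h₂⟩⟩
  | pair_abort₁ ha h => cases hT; exact .inl ⟨ha, h⟩
  | pair_abort₂ ha h₁ h₂ => cases hT; exact .inr ⟨_, _, _, h₁, .inr ⟨ha, h₂⟩⟩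
  | _ => cases hT

theorem Eval.letin_inv {x : Var} {M N : Term Op}
    (h : Eval I (.letin x M N) R S (some k) χ R' S') :
    (χ.Aborts ∧ Eval I M R S (some k) χ R' S') ∨
      ∃ v R₁ S₁, Eval I M R S (some k) (.val v) R₁ S₁ ∧
        Eval I (N.subst1 x v) R₁ S₁ (some k) χ R' S' := by
  generalize hT : Term.letin x M N = T at h
  cases h with
  | @val v => cases v <;> cases hT
  | letin h₁ h₂ => cases hT; exact .inr ⟨_, _, _, h₁, h₂⟩
  | letin_abort ha h => cases hT; exact .inl ⟨ha, h⟩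
  | _ => cases hT

theorem Eval.app_inv {m : Meth} {M : Term Op}
    (h : Eval I (.appMeth m M) R S (some k) χ R' S') :
    (χ.Aborts ∧ Eval I M R S (some k) χ R' S') ∨
      ∃ L v R₁ S₁, R.lookup m = some L ∧ Eval I M R S (some k) (.val v) R₁ S₁ ∧
        Eval I (L.body.subst1 L.param v) R₁ S₁ (predBound (some k)) χ R' S' := by
  generalize hT : Term.appMeth m M = T at h
  cases h with
  | @val v => cases v <;> cases hT
  | app hm h₁ h₂ => cases hT; exact .inr ⟨_, _, _, _, hm, h₁, h₂⟩
  | app_abort ha h => cases hT; exact .inl ⟨ha, h⟩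
  | _ => cases hT

theorem Eval.ite_inv {M M₁ M₀ : Term Op} (h : Eval I (.ite M M₁ M₀) R S (some k) χ R' S') :
    (χ.Aborts ∧ Eval I M R S (some k) χ R' S') ∨
      ∃ i R₁ S₁, Eval I M R S (some k) (.val (.int i)) R₁ S₁ ∧
        Eval I (if i = 0 then M₀ else M₁) R₁ S₁ (some k) χ R' S' := by
  generalize hT : Term.ite M M₁ M₀ = T at h
  cases h with
  | @val v => cases v <;> cases hT
  | ite h₁ h₂ => cases hT; exact .inr ⟨_, _, _, h₁, h₂⟩
  | ite_abort ha h => cases hT; exact .inl ⟨ha, h⟩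
  | _ => cases hT

theorem Eval.letrec_inv {f x : Var} {M N : Term Op}
    (h : Eval I (.letrec f x M N) R S (some k) χ R' S') :
    ∃ m, m ∉ R ∧ m.ty = f.ty ∧ Eval I (N.subst1 f (.meth m))
      (R.insert m ((Lam.mk x M).subst1 f (.meth m))) S (some k) χ R' S' := by
  generalize hT : Term.letrec f x M N = T at h
  cases h with
  | @val v => cases v <;> cases hT
  | letrec hm hty h => cases hT; exact ⟨_, hm, hty, h⟩
  | _ => cases hT

theorem Eval.val_inv {v : Val} : ∀ {χ : Outcome} {R' : Repo Op} {S' : Store},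
    Eval I v.toTerm R S (some k) χ R' S' → χ = .val v ∧ R' = R ∧ S' = S := by
  induction v with
  | pair v w hv hw =>
    intro χ R' S' h
    rcases Eval.pair_inv h with ⟨ha, h⟩ | ⟨v', R₁, S₁, h₁, h⟩
    · rw [(hv h).1] at ha; exact ha.elim
    · obtain ⟨e, rfl, rfl⟩ := hv h₁
      cases e
      rcases h with ⟨w', rfl, h₂⟩ | ⟨ha, h₂⟩
      · obtain ⟨e, rfl, rfl⟩ := hw h₂
        cases e
        exact ⟨rfl, rfl, rfl⟩
      · rw [(hw h₂).1] at ha; exact ha.elim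
  | var x =>
    intro χ R' S' h
    generalize hT : (Val.var x).toTerm = T at h
    cases h with
    | val => rw [Val.toTerm_injective hT]; exact ⟨rfl, rfl, rfl⟩
    | _ => cases hT
  | meth m =>
    intro χ R' S' h
    generalize hT : (Val.meth m).toTerm = T at h
    cases h with
    | val => rw [Val.toTerm_injective hT]; exact ⟨rfl, rfl, rfl⟩
    | _ => cases hT
  | int i =>
    intro χ R' S' h
    generalize hT : (Val.int i).toTerm = T at h
    cases h with
    | val => rw [Val.toTerm_injective hT]; exact ⟨rfl, rfl, rfl⟩
    | _ => cases hT
  | unit =>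
    intro χ R' S' h
    generalize hT : Val.unit.toTerm = T at h
    cases h with
    | val => rw [Val.toTerm_injective hT]; exact ⟨rfl, rfl, rfl⟩
    | _ => cases hT

end Inversion

/-! ### Determinacy up to the choice of names -/

section Determinacy

variable {Op : Type u} {I : Op → ℤ → ℤ → ℤ}

theorem Outcome.Aborts.not_perm_val {χ : Outcome} (h : χ.Aborts) {π : Equiv.Perm Meth} {v : Val}
    (e : χ.perm π = .val v) : False := by
  rw [h.perm] at e
  rwa [e] at h

theorem Outcome.not_aborts_perm_val {χ : Outcome} (h : χ.Aborts) {π : Equiv.Perm Meth} {v : Val}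
    (e : (Outcome.val v).perm π = χ) : False := by
  rw [← e] at h
  exact h

/-- If one evaluation starts from the `π`-image of the initial configuration of another, then it
ends in the `π'`-image of its final configuration, where `π'` differs from `π` only in the choice
of the names created on the way. -/
theorem Eval.unique_up_to_perm {M : Term Op} {R R' : Repo Op} {S S' : Store} {k : Option ℕ}
    {χ : Outcome} (h : Eval I M R S k χ R' S') :
    ∀ {π : Equiv.Perm Meth} {R₂ S₂ χ₂ R₂' S₂'}, IsNamePerm π → M.meths ⊆ R.keys →
      ScopedMeths R S → RepoPerm π R R₂ → StorePerm π S S₂ →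
      Eval I (M.perm π) R₂ S₂ k χ₂ R₂' S₂' →
      ∃ π' : Equiv.Perm Meth, IsNamePerm π' ∧ (∀ m ∈ R.keys, π' m = π m) ∧ χ.perm π' = χ₂ ∧
        RepoPerm π' R' R₂' ∧ StorePerm π' S' S₂' := by
  induction h with
  | nil =>
    intro π R₂ S₂ χ₂ R₂' S₂' hπ hM hsc hR hS hE
    obtain ⟨rfl, rfl, rfl⟩ := hE.nil_inv
    exact ⟨π, hπ, fun _ _ => rfl, rfl, hR, hS⟩
  | fail =>
    intro π R₂ S₂ χ₂ R₂' S₂' hπ hM hsc hR hS hE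
    obtain ⟨rfl, rfl, rfl⟩ := Eval.fail_inv hE
    exact ⟨π, hπ, fun _ _ => rfl, rfl, hR, hS⟩
  | val =>
    intro π R₂ S₂ χ₂ R₂' S₂' hπ hM hsc hR hS hE
    rw [Val.perm_toTerm] at hE
    obtain ⟨rfl, rfl, rfl⟩ := Eval.val_inv hE
    exact ⟨π, hπ, fun _ _ => rfl, rfl, hR, hS⟩
  | deref hr =>
    intro π R₂ S₂ χ₂ R₂' S₂' hπ hM hsc hR hS hE
    obtain ⟨v, hv, rfl, rfl, rfl⟩ := Eval.deref_inv hE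
    rw [hS, hr] at hv
    cases hv
    exact ⟨π, hπ, fun _ _ => rfl, rfl, hR, hS⟩
  | @lam x M m R S k hm ht =>
    intro π R₂ S₂ χ₂ R₂' S₂' hπ hM hsc hR hS hE
    obtain ⟨m₂, hm₂, ht₂, rfl, rfl, rfl⟩ := Eval.lam_inv hE
    have hty : m₂.ty = m.ty := by rw [← ht₂.ty_eq, ← (ht.perm hπ).ty_eq]; rfl
    -- both evaluations create a name here, and the renaming is redirected to match the two
    obtain ⟨π', hπ', hag, rfl⟩ := hR.exists_extend hπ hm hm₂ hty
    refine ⟨π', hπ', hag, rfl, ?_, hS.congr hsc hag⟩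
    have := (hR.congr hsc hag).insert m ⟨x, M⟩
    rwa [Lam.perm, Term.perm_congr (M := M) fun m' hm' => hag m' (hM hm')] at this
  | fst _ ih =>
    intro π R₂ S₂ χ₂ R₂' S₂' hπ hM hsc hR hS hE
    rcases Eval.fst_inv hE with ⟨v, w, rfl, h₂⟩ | ⟨ha, h₂⟩
    · obtain ⟨π', hπ', hag, e, hR', hS'⟩ := ih hπ hM hsc hR hS h₂
      cases e
      exact ⟨π', hπ', hag, rfl, hR', hS'⟩
    · obtain ⟨π', hπ', hag, e, hR', hS'⟩ := ih hπ hM hsc hR hS h₂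
      exact (Outcome.not_aborts_perm_val ha e).elim
  | fst_abort ha _ ih =>
    intro π R₂ S₂ χ₂ R₂' S₂' hπ hM hsc hR hS hE
    rcases Eval.fst_inv hE with ⟨v, w, rfl, h₂⟩ | ⟨ha, h₂⟩
    · obtain ⟨π', hπ', hag, e, hR', hS'⟩ := ih hπ hM hsc hR hS h₂
      exact (ha.not_perm_val e).elim
    · exact ih hπ hM hsc hR hS h₂
  | snd _ ih =>
    intro π R₂ S₂ χ₂ R₂' S₂' hπ hM hsc hR hS hE
    rcases Eval.snd_inv hE with ⟨v, w, rfl, h₂⟩ | ⟨ha, h₂⟩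
    · obtain ⟨π', hπ', hag, e, hR', hS'⟩ := ih hπ hM hsc hR hS h₂
      cases e
      exact ⟨π', hπ', hag, rfl, hR', hS'⟩
    · obtain ⟨π', hπ', hag, e, hR', hS'⟩ := ih hπ hM hsc hR hS h₂
      exact (Outcome.not_aborts_perm_val ha e).elim
  | snd_abort ha _ ih =>
    intro π R₂ S₂ χ₂ R₂' S₂' hπ hM hsc hR hS hE
    rcases Eval.snd_inv hE with ⟨v, w, rfl, h₂⟩ | ⟨ha, h₂⟩
    · obtain ⟨π', hπ', hag, e, hR', hS'⟩ := ih hπ hM hsc hR hS h₂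
      exact (ha.not_perm_val e).elim
    · exact ih hπ hM hsc hR hS h₂
  | assign _ ih =>
    intro π R₂ S₂ χ₂ R₂' S₂' hπ hM hsc hR hS hE
    rcases Eval.assign_inv hE with ⟨v, S₁, rfl, rfl, h₂⟩ | ⟨ha, h₂⟩
    · obtain ⟨π', hπ', hag, e, hR', hS'⟩ := ih hπ hM hsc hR hS h₂
      cases e
      exact ⟨π', hπ', hag, rfl, hR', hS'.insert _ _⟩
    · obtain ⟨π', hπ', hag, e, hR', hS'⟩ := ih hπ hM hsc hR hS h₂
      exact (Outcome.not_aborts_perm_val ha e).elim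
  | assign_abort ha _ ih =>
    intro π R₂ S₂ χ₂ R₂' S₂' hπ hM hsc hR hS hE
    rcases Eval.assign_inv hE with ⟨v, S₁, rfl, rfl, h₂⟩ | ⟨ha, h₂⟩
    · obtain ⟨π', hπ', hag, e, hR', hS'⟩ := ih hπ hM hsc hR hS h₂
      exact (ha.not_perm_val e).elim
    · exact ih hπ hM hsc hR hS h₂
  | arith h₁ _ ih₁ ih₂ =>
    intro π R₂ S₂ χ₂ R₂' S₂' hπ hM hsc hR hS hE
    have hM₁ := Finset.union_subset_left hM
    obtain ⟨hk, hsc', -⟩ := h₁.scoped hM₁ hsc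
    have hM₂ := (Finset.union_subset_right hM)
    rcases Eval.arith_inv hE with ⟨ha, h₂⟩ | ⟨i, R₁, S₁, h₂, h₃⟩
    · obtain ⟨π', hπ', hag, e, hR', hS'⟩ := ih₁ hπ hM₁ hsc hR hS h₂
      exact (Outcome.not_aborts_perm_val ha e).elim
    · obtain ⟨π', hπ', hag, e, hR', hS'⟩ := ih₁ hπ hM₁ hsc hR hS h₂
      cases e
      rw [← Term.perm_congr fun m hm => hag m (hM₂ hm)] at h₃
      rcases h₃ with ⟨j, rfl, h₃⟩ | ⟨ha, h₃⟩
      · obtain ⟨π'', hπ'', hag', e, hR'', hS''⟩ := ih₂ hπ' (hM₂.trans hk) hsc' hR' hS' h₃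
        cases e
        exact ⟨π'', hπ'', fun m hm => (hag' m (hk hm)).trans (hag m hm), rfl, hR'', hS''⟩
      · obtain ⟨π'', hπ'', hag', e, hR'', hS''⟩ := ih₂ hπ' (hM₂.trans hk) hsc' hR' hS' h₃
        exact (Outcome.not_aborts_perm_val ha e).elim
  | arith_abort₁ ha _ ih =>
    intro π R₂ S₂ χ₂ R₂' S₂' hπ hM hsc hR hS hE
    have hM₁ := Finset.union_subset_left hM
    rcases Eval.arith_inv hE with ⟨ha, h₂⟩ | ⟨i, R₁, S₁, h₂, h₃⟩
    · exact ih hπ hM₁ hsc hR hS h₂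
    · obtain ⟨π', hπ', hag, e, hR', hS'⟩ := ih hπ hM₁ hsc hR hS h₂
      exact (ha.not_perm_val e).elim
  | arith_abort₂ ha h₁ _ ih₁ ih₂ =>
    intro π R₂ S₂ χ₂ R₂' S₂' hπ hM hsc hR hS hE
    have hM₁ := Finset.union_subset_left hM
    obtain ⟨hk, hsc', -⟩ := h₁.scoped hM₁ hsc
    have hM₂ := (Finset.union_subset_right hM)
    rcases Eval.arith_inv hE with ⟨ha, h₂⟩ | ⟨i, R₁, S₁, h₂, h₃⟩
    · obtain ⟨π', hπ', hag, e, hR', hS'⟩ := ih₁ hπ hM₁ hsc hR hS h₂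
      exact (Outcome.not_aborts_perm_val ha e).elim
    · obtain ⟨π', hπ', hag, e, hR', hS'⟩ := ih₁ hπ hM₁ hsc hR hS h₂
      rw [← Term.perm_congr fun m hm => hag m (hM₂ hm)] at h₃
      rcases h₃ with ⟨j, rfl, h₃⟩ | ⟨ha, h₃⟩
      · obtain ⟨π'', hπ'', hag', e, hR'', hS''⟩ := ih₂ hπ' (hM₂.trans hk) hsc' hR' hS' h₃
        exact (ha.not_perm_val e).elim
      · obtain ⟨π'', hπ'', hag', e, hR'', hS''⟩ := ih₂ hπ' (hM₂.trans hk) hsc' hR' hS' h₃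
        exact ⟨π'', hπ'', fun m hm => (hag' m (hk hm)).trans (hag m hm), e, hR'', hS''⟩
  | @pair _ _ v₁ v₂ _ _ _ _ _ _ k h₁ h₁' ih₁ ih₂ =>
    intro π R₂ S₂ χ₂ R₂' S₂' hπ hM hsc hR hS hE
    have hM₁ := Finset.union_subset_left hM
    obtain ⟨hk, hsc', hv⟩ := h₁.scoped hM₁ hsc
    have hM₂ := (Finset.union_subset_right hM)
    rcases Eval.pair_inv hE with ⟨ha, h₂⟩ | ⟨i, R₁, S₁, h₂, h₃⟩
    · obtain ⟨π', hπ', hag, e, hR', hS'⟩ := ih₁ hπ hM₁ hsc hR hS h₂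
      exact (Outcome.not_aborts_perm_val ha e).elim
    · obtain ⟨π', hπ', hag, e, hR', hS'⟩ := ih₁ hπ hM₁ hsc hR hS h₂
      cases e
      rw [← Term.perm_congr fun m hm => hag m (hM₂ hm)] at h₃
      rcases h₃ with ⟨j, rfl, h₃⟩ | ⟨ha, h₃⟩
      · obtain ⟨π'', hπ'', hag', e, hR'', hS''⟩ := ih₂ hπ' (hM₂.trans hk) hsc' hR' hS' h₃
        cases e
        refine ⟨π'', hπ'', fun m hm => (hag' m (hk hm)).trans (hag m hm), ?_, hR'', hS''⟩
        simp only [Outcome.perm, Val.perm]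
        rw [Val.perm_congr (v := v₁) fun m hm => hag' m (hv _ rfl hm)]
      · obtain ⟨π'', hπ'', hag', e, hR'', hS''⟩ := ih₂ hπ' (hM₂.trans hk) hsc' hR' hS' h₃
        exact (Outcome.not_aborts_perm_val ha e).elim
  | pair_abort₁ ha _ ih =>
    intro π R₂ S₂ χ₂ R₂' S₂' hπ hM hsc hR hS hE
    have hM₁ := Finset.union_subset_left hM
    rcases Eval.pair_inv hE with ⟨ha, h₂⟩ | ⟨i, R₁, S₁, h₂, h₃⟩
    · exact ih hπ hM₁ hsc hR hS h₂
    · obtain ⟨π', hπ', hag, e, hR', hS'⟩ := ih hπ hM₁ hsc hR hS h₂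
      exact (ha.not_perm_val e).elim
  | pair_abort₂ ha h₁ _ ih₁ ih₂ =>
    intro π R₂ S₂ χ₂ R₂' S₂' hπ hM hsc hR hS hE
    have hM₁ := Finset.union_subset_left hM
    obtain ⟨hk, hsc', -⟩ := h₁.scoped hM₁ hsc
    have hM₂ := (Finset.union_subset_right hM)
    rcases Eval.pair_inv hE with ⟨ha, h₂⟩ | ⟨i, R₁, S₁, h₂, h₃⟩
    · obtain ⟨π', hπ', hag, e, hR', hS'⟩ := ih₁ hπ hM₁ hsc hR hS h₂
      exact (Outcome.not_aborts_perm_val ha e).elim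
    · obtain ⟨π', hπ', hag, e, hR', hS'⟩ := ih₁ hπ hM₁ hsc hR hS h₂
      rw [← Term.perm_congr fun m hm => hag m (hM₂ hm)] at h₃
      rcases h₃ with ⟨j, rfl, h₃⟩ | ⟨ha, h₃⟩
      · obtain ⟨π'', hπ'', hag', e, hR'', hS''⟩ := ih₂ hπ' (hM₂.trans hk) hsc' hR' hS' h₃
        exact (ha.not_perm_val e).elim
      · obtain ⟨π'', hπ'', hag', e, hR'', hS''⟩ := ih₂ hπ' (hM₂.trans hk) hsc' hR' hS' h₃
        exact ⟨π'', hπ'', fun m hm => (hag' m (hk hm)).trans (hag m hm), e, hR'', hS''⟩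
  | letin h₁ _ ih₁ ih₂ =>
    intro π R₂ S₂ χ₂ R₂' S₂' hπ hM hsc hR hS hE
    have hM₁ := Finset.union_subset_left hM
    obtain ⟨hk, hsc', hv⟩ := h₁.scoped hM₁ hsc
    have hM₂ := (Finset.union_subset_right hM)
    rcases Eval.letin_inv hE with ⟨ha, h₂⟩ | ⟨w, R₁, S₁, h₂, h₃⟩
    · obtain ⟨π', hπ', hag, e, hR', hS'⟩ := ih₁ hπ hM₁ hsc hR hS h₂
      exact (Outcome.not_aborts_perm_val ha e).elim
    · obtain ⟨π', hπ', hag, e, hR', hS'⟩ := ih₁ hπ hM₁ hsc hR hS h₂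
      cases e
      rw [← Term.perm_congr fun m hm => hag m (hM₂ hm), ← Term.perm_subst1] at h₃
      obtain ⟨π'', hπ'', hag', e, hR'', hS''⟩ :=
        ih₂ hπ' (Term.meths_subst1_subset (hM₂.trans hk) (hv _ rfl)) hsc' hR' hS' h₃
      exact ⟨π'', hπ'', fun m hm => (hag' m (hk hm)).trans (hag m hm), e, hR'', hS''⟩
  | letin_abort ha _ ih =>
    intro π R₂ S₂ χ₂ R₂' S₂' hπ hM hsc hR hS hE
    have hM₁ := Finset.union_subset_left hM
    rcases Eval.letin_inv hE with ⟨ha, h₂⟩ | ⟨i, R₁, S₁, h₂, h₃⟩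
    · exact ih hπ hM₁ hsc hR hS h₂
    · obtain ⟨π', hπ', hag, e, hR', hS'⟩ := ih hπ hM₁ hsc hR hS h₂
      exact (ha.not_perm_val e).elim
  | app hm h₁ _ ih₁ ih₂ =>
    intro π R₂ S₂ χ₂ R₂' S₂' hπ hM hsc hR hS hE
    have hM₁ := Finset.union_subset_right hM
    obtain ⟨hk, hsc', hv⟩ := h₁.scoped hM₁ hsc
    rcases Eval.app_inv hE with ⟨ha, h₂⟩ | ⟨L₂, w, R₁, S₁, hL₂, h₂, h₃⟩
    · obtain ⟨π', hπ', hag, e, hR', hS'⟩ := ih₁ hπ hM₁ hsc hR hS h₂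
      exact (Outcome.not_aborts_perm_val ha e).elim
    · obtain ⟨π', hπ', hag, e, hR', hS'⟩ := ih₁ hπ hM₁ hsc hR hS h₂
      cases e
      rw [hR, hm] at hL₂
      cases hL₂
      have hL := hsc.repo _ _ hm
      simp only [Lam.perm] at h₃
      rw [← Term.perm_congr fun m hm => hag m (hL hm), ← Term.perm_subst1] at h₃
      obtain ⟨π'', hπ'', hag', e, hR'', hS''⟩ :=
        ih₂ hπ' (Term.meths_subst1_subset (hL.trans hk) (hv _ rfl)) hsc' hR' hS' h₃
      exact ⟨π'', hπ'', fun m hm => (hag' m (hk hm)).trans (hag m hm), e, hR'', hS''⟩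
  | app_abort ha _ ih =>
    intro π R₂ S₂ χ₂ R₂' S₂' hπ hM hsc hR hS hE
    have hM₁ := Finset.union_subset_right hM
    rcases Eval.app_inv hE with ⟨ha, h₂⟩ | ⟨L₂, i, R₁, S₁, hL₂, h₂, h₃⟩
    · exact ih hπ hM₁ hsc hR hS h₂
    · obtain ⟨π', hπ', hag, e, hR', hS'⟩ := ih hπ hM₁ hsc hR hS h₂
      exact (ha.not_perm_val e).elim
  | @ite M M₁ M₀ i _ R _ _ _ _ _ _ h₁ _ ih₁ ih₂ =>
    intro π R₂ S₂ χ₂ R₂' S₂' hπ hM hsc hR hS hE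
    simp only [Term.meths, Finset.union_subset_iff] at hM
    obtain ⟨hk, hsc', -⟩ := h₁.scoped hM.1.1 hsc
    have hM₂ : (if i = 0 then M₀ else M₁).meths ⊆ R.keys := by
      split_ifs; exacts [hM.2, hM.1.2]
    rcases Eval.ite_inv hE with ⟨ha, h₂⟩ | ⟨j, R₁, S₁, h₂, h₃⟩
    · obtain ⟨π', hπ', hag, e, hR', hS'⟩ := ih₁ hπ hM.1.1 hsc hR hS h₂
      exact (Outcome.not_aborts_perm_val ha e).elim
    · obtain ⟨π', hπ', hag, e, hR', hS'⟩ := ih₁ hπ hM.1.1 hsc hR hS h₂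
      cases e
      rw [← apply_ite (Term.perm π), ← Term.perm_congr fun m hm => hag m (hM₂ hm)] at h₃
      obtain ⟨π'', hπ'', hag', e, hR'', hS''⟩ := ih₂ hπ' (hM₂.trans hk) hsc' hR' hS' h₃
      exact ⟨π'', hπ'', fun m hm => (hag' m (hk hm)).trans (hag m hm), e, hR'', hS''⟩
  | ite_abort ha _ ih =>
    intro π R₂ S₂ χ₂ R₂' S₂' hπ hM hsc hR hS hE
    simp only [Term.meths, Finset.union_subset_iff] at hM
    rcases Eval.ite_inv hE with ⟨ha, h₂⟩ | ⟨i, R₁, S₁, h₂, h₃⟩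
    · exact ih hπ hM.1.1 hsc hR hS h₂
    · obtain ⟨π', hπ', hag, e, hR', hS'⟩ := ih hπ hM.1.1 hsc hR hS h₂
      exact (ha.not_perm_val e).elim
  | @letrec f x M N m _ R _ _ _ _ hm hty _ ih =>
    intro π R₂ S₂ χ₂ R₂' S₂' hπ hM hsc hR hS hE
    obtain ⟨m₂, hm₂, hty₂, h₂⟩ := Eval.letrec_inv hE
    obtain ⟨π', hπ', hag, rfl⟩ := hR.exists_extend hπ hm hm₂ (hty₂.trans hty.symm)
    have hMM := Finset.union_subset_left hM
    have hN := Finset.union_subset_right hM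
    have hs : R.keys ⊆ insert m R.keys := Finset.subset_insert _ _
    have hm' : (Val.meth m).meths ⊆ insert m R.keys := by simp [Val.meths]
    have hR' := (hR.congr hsc hag).insert m ((Lam.mk x M).subst1 f (.meth m))
    have hL : (Lam.mk x M).perm π' = ⟨x, M.perm π⟩ := by
      rw [Lam.perm, Term.perm_congr fun m' hm' => hag m' (hMM hm')]
    rw [Lam.perm_subst1, hL] at hR'
    rw [← Term.perm_congr fun m' hm' => hag m' (hN hm')] at h₂
    change Eval I ((N.perm π').subst1 f ((Val.meth m).perm π')) _ _ _ _ _ _ at h₂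
    rw [← Term.perm_subst1] at h₂
    obtain ⟨π'', hπ'', hag', e, hR'', hS''⟩ := ih hπ'
      (by rw [keys_insert]; exact Term.meths_subst1_subset (hN.trans hs) hm')
      (hsc.insert_repo (Lam.meths_subst1_subset (hMM.trans hs) hm'))
      hR' (hS.congr hsc hag) h₂
    refine ⟨π'', hπ'', fun m' hm' => ?_, e, hR'', hS''⟩
    rw [hag' m' (by rw [keys_insert]; exact hs hm'), hag m' hm']

end Determinacy

/-! ### Invariants of the translation -/

section Invariants

variable {Op : Type u}

/-- The term `M` has type `θ`, its variables (free or bound) are among `U`, and its references are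
among `Θ`. -/
structure Term.Admissible (M : Term Op) (θ : Ty) (U : Finset Var) (Θ : Finset Ref) : Prop where
  typed : HasType M θ
  vars : M.vars ⊆ U
  refs : M.refs ⊆ Θ

/-- The `λ`-abstraction `L` may be stored under the name `m`; its variables are among `U`, and its
references are among `Θ`. -/
structure Lam.Admissible (L : Lam Op) (m : Meth) (U : Finset Var) (Θ : Finset Ref) : Prop where
  typed : HasType L.toTerm m.ty
  vars : L.vars ⊆ U
  refs : L.body.refs ⊆ Θ

/-- The inputs `R`, `C`, `D` of the translation are in order: `U` contains all variables used so
far, and the SSA map `C` bounds the SSA variables used so far. -/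
structure TransEnv (R : Repo Op) (C D : SSAMap) (U : Finset Var) (Θ : Finset Ref) : Prop where
  repo : ∀ m L, R.lookup m = some L → L.Admissible m U Θ
  keysC : C.keys = Θ
  keysD : D.keys = Θ
  idx_le : ∀ r, D.idx r ≤ C.idx r

/-- The result `t` extends the inputs `R`, `C`, `φ`, `U` of the translation, and its components are
in order. -/
structure TransExt (t : Result Op) (R : Repo Op) (C : SSAMap) (φ : Form Op) (U : Finset Var)
    (Θ : Finset Ref) : Prop where
  env : TransEnv t.repo t.C t.D t.used Θ
  used : U ⊆ t.used
  repo : ∀ m L, R.lookup m = some L → t.repo.lookup m = some L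
  idx : ∀ r, C.idx r ≤ t.C.idx r
  form : ∀ (I : Op → ℤ → ℤ → ℤ) ρ, t.form.Holds I ρ → φ.Holds I ρ

/-- The result `t` extends the inputs `R`, `C`, `φ`, `U` of the translation, and its return variable
is a fresh one of type `θ`. -/
structure TransSpec (t : Result Op) (θ : Ty) (R : Repo Op) (C : SSAMap) (φ : Form Op)
    (U : Finset Var) (Θ : Finset Ref) : Prop extends TransExt t R C φ U Θ where
  ret_ty : t.ret.ty = θ
  ret_mem : t.ret ∈ t.used
  ret_fresh : t.ret ∉ U

/-- The translator extends its inputs, and returns fresh variables. -/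
def Translator.WellBehaved (T : Translator Op) : Prop :=
  ∀ M R C D φ U Θ θ, Term.Admissible M θ U Θ → TransEnv R C D U Θ →
    TransSpec (T M R C D φ U) θ R C φ U Θ

theorem Term.Admissible.mono {M : Term Op} {θ : Ty} {U U' : Finset Var} {Θ : Finset Ref}
    (h : M.Admissible θ U Θ) (hU : U ⊆ U') : M.Admissible θ U' Θ :=
  ⟨h.typed, h.vars.trans hU, h.refs⟩

theorem Lam.Admissible.mono {L : Lam Op} {m : Meth} {U U' : Finset Var} {Θ : Finset Ref}
    (h : L.Admissible m U Θ) (hU : U ⊆ U') : L.Admissible m U' Θ :=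
  ⟨h.typed, h.vars.trans hU, h.refs⟩

theorem Lam.Admissible.param_ty {L : Lam Op} {m : Meth} {U : Finset Var} {Θ : Finset Ref}
    (h : L.Admissible m U Θ) : L.param.ty = m.dom := by
  have := h.typed.ty_eq
  simp only [Lam.toTerm, Term.ty, Meth.ty, Ty.arr.injEq] at this
  exact this.1

theorem Lam.Admissible.body {L : Lam Op} {m : Meth} {U : Finset Var} {Θ : Finset Ref}
    (h : L.Admissible m U Θ) : L.body.Admissible m.cod U Θ := by
  refine ⟨?_, (Finset.subset_union_right).trans h.vars, h.refs⟩
  have ht := h.typed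
  generalize e : m.ty = θ at ht
  unfold Lam.toTerm at ht
  cases ht with
  | lam hb =>
    rw [(Ty.arr.inj e).2]
    exact hb

theorem Term.Admissible.subst1_var {M : Term Op} {θ : Ty} {U : Finset Var} {Θ : Finset Ref}
    (h : M.Admissible θ U Θ) {x y : Var} (hy : y ∈ U) (hty : y.ty = x.ty) :
    (M.subst1 x (.var y)).Admissible θ U Θ :=
  ⟨h.typed.subst1 hty,
    (Term.vars_subst1_var_subset M x y).trans (Finset.insert_subset hy h.vars),
    (Term.refs_subst _ M).le.trans h.refs⟩

theorem TransEnv.mono {R : Repo Op} {C C' D : SSAMap} {U U' : Finset Var} {Θ : Finset Ref}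
    (h : TransEnv R C D U Θ) (hU : U ⊆ U') (hC : C'.keys = Θ)
    (hle : ∀ r, C.idx r ≤ C'.idx r) : TransEnv R C' D U' Θ :=
  ⟨fun m L hL => (h.repo m L hL).mono hU, hC, h.keysD, fun r => (h.idx_le r).trans (hle r)⟩

theorem TransEnv.refl_ext {R : Repo Op} {C D : SSAMap} {U : Finset Var} {Θ : Finset Ref}
    (h : TransEnv R C D U Θ) (φ : Form Op) (ret : Var) :
    TransExt ⟨ret, φ, R, C, D, U⟩ R C φ U Θ :=
  ⟨h, subset_rfl, fun _ _ h => h, fun _ => le_rfl, fun _ _ h => h⟩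

theorem TransExt.trans {t t' : Result Op} {R : Repo Op} {C : SSAMap} {φ : Form Op}
    {U : Finset Var} {Θ : Finset Ref} (h' : TransExt t' t.repo t.C t.form t.used Θ)
    (h : TransExt t R C φ U Θ) : TransExt t' R C φ U Θ :=
  ⟨h'.env, h.used.trans h'.used, fun m L hL => h'.repo m L (h.repo m L hL),
    fun r => (h.idx r).trans (h'.idx r), fun I ρ hρ => h.form I ρ (h'.form I ρ hρ)⟩

/-- Adding a conjunct and a fresh return variable to an extension. -/
theorem TransExt.finish {t : Result Op} {R : Repo Op} {C : SSAMap} {φ : Form Op}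
    {U : Finset Var} {Θ : Finset Ref} (h : TransExt t R C φ U Θ) (G : FreshGen) (θ : Ty)
    (ψ : Form Op) {C' D' : SSAMap} (hC : C'.keys = Θ) (hD : D'.keys = Θ)
    (hle : ∀ r, t.C.idx r ≤ C'.idx r) (hle' : ∀ r, D'.idx r ≤ C'.idx r) :
    TransSpec ⟨G.var t.used θ, .and ψ t.form, t.repo, C', D', insert (G.var t.used θ) t.used⟩
      θ R C φ U Θ where
  env := ⟨fun m L hL => (h.env.repo m L hL).mono (Finset.subset_insert _ _), hC, hD, hle'⟩
  used := h.used.trans (Finset.subset_insert _ _)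
  repo := h.repo
  idx r := (h.idx r).trans (hle r)
  form I ρ hρ := h.form I ρ hρ.2
  ret_ty := G.var_ty _ _
  ret_mem := Finset.mem_insert_self _ _
  ret_fresh hr := G.var_fresh _ _ (h.used hr)

theorem TransExt.finish' {t : Result Op} {R : Repo Op} {C : SSAMap} {φ : Form Op}
    {U : Finset Var} {Θ : Finset Ref} (h : TransExt t R C φ U Θ) (G : FreshGen) (θ : Ty)
    (ψ : Form Op) :
    TransSpec ⟨G.var t.used θ, .and ψ t.form, t.repo, t.C, t.D, insert (G.var t.used θ) t.used⟩
      θ R C φ U Θ :=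
  h.finish G θ ψ h.env.keysC h.env.keysD (fun _ => le_rfl) h.env.idx_le

theorem TransEnv.retExpr {R : Repo Op} {C D : SSAMap} {U : Finset Var} {Θ : Finset Ref}
    (h : TransEnv R C D U Θ) (G : FreshGen) (θ : Ty) (e : Expr Op) (φ : Form Op) :
    TransSpec (retExpr G θ e R C D φ U) θ R C φ U Θ :=
  (h.refl_ext φ (G.var U θ)).finish' G θ _

theorem SSAMap.idx_bump (C : SSAMap) (r r' : Ref) :
    (C.bump r).idx r' = if r' = r then C.idx r + 1 else C.idx r' := by
  unfold SSAMap.bump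
  conv_lhs => unfold SSAMap.idx
  rw [lookup_insert_eq_ite]
  split_ifs <;> rfl

theorem SSAMap.idx_insert (C : SSAMap) (r r' : Ref) (i : ℕ) :
    SSAMap.idx (C.insert r i) r' = if r' = r then i else C.idx r' := by
  unfold SSAMap.idx
  rw [lookup_insert_eq_ite]
  split_ifs <;> rfl

theorem SSAMap.idx_bumpAll (C : SSAMap) (r : Ref) :
    C.bumpAll.idx r = if r ∈ C.keys then C.idx r + 1 else 0 := by
  unfold SSAMap.bumpAll SSAMap.idx
  rw [lookup_mapVals]
  split_ifs with h
  · obtain ⟨v, hv⟩ := (mem_keys_iff_lookup C r).mp h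
    simp [hv]
  · simp [lookup_eq_none_of_notMem_keys h]

theorem SSAMap.idx_le_bumpAll (C : SSAMap) (r : Ref) : C.idx r ≤ C.bumpAll.idx r := by
  rw [SSAMap.idx_bumpAll]
  split_ifs with h
  · exact Nat.le_succ _
  · simp [SSAMap.idx, lookup_eq_none_of_notMem_keys h]

theorem SSAMap.keys_bumpAll (C : SSAMap) : C.bumpAll.keys = C.keys := keys_mapVals _ _

/-- The last of a list of results, and `t` if there is none. -/
def callEnd (t : Result Op) (l : List (Meth × Result Op)) : Result Op :=
  (l.getLast?.map Prod.snd).getD t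

theorem callEnd_cons (t : Result Op) (p : Meth × Result Op) (l : List (Meth × Result Op)) :
    callEnd t (p :: l) = callEnd p.2 l := by
  unfold callEnd
  rw [List.getLast?_cons]
  rcases l.getLast? with _ | q <;> rfl

/-- How the result of one of the calls made by `callAll` from the state `t` arises: it is the
translation of a call in an intermediate state `t'`. -/
structure CallSpec (call : Translator Op) (R : Repo Op) (ret₀ : Var) (D₀ : SSAMap)
    (Θ : Finset Ref) (t tₙ : Result Op) (p : Meth × Result Op) (L : Lam Op) (t' : Result Op) :
    Prop where
  lookup : R.lookup p.1 = some L
  body : L.Admissible p.1 t'.used Θ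
  ext : TransExt t' t.repo t.C t.form t.used Θ
  env : TransEnv t'.repo t'.C D₀ t'.used Θ
  eq : p.2 = call (L.body.subst1 L.param (.var ret₀)) t'.repo t'.C D₀ t'.form t'.used
  adm : (L.body.subst1 L.param (.var ret₀)).Admissible p.1.cod t'.used Θ
  spec : TransSpec p.2 p.1.cod t'.repo t'.C t'.form t'.used Θ
  last : TransExt tₙ p.2.repo p.2.C p.2.form p.2.used Θ

theorem callAll_spec {call : Translator Op} (hcall : call.WellBehaved) {R : Repo Op} {ret₀ : Var}
    {D₀ : SSAMap} {Θ : Finset Ref} : ∀ (ms : List Meth) (t : Result Op),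
    TransEnv t.repo t.C t.D t.used Θ → D₀.keys = Θ → (∀ r, D₀.idx r ≤ t.C.idx r) →
    ret₀ ∈ t.used → (∀ m L, R.lookup m = some L → L.Admissible m t.used Θ) →
    (∀ m ∈ ms, m.dom = ret₀.ty) →
    TransExt (callEnd t (callAll call R ret₀ D₀ ms t.repo t.C t.form t.used))
      t.repo t.C t.form t.used Θ ∧
    ∀ p ∈ callAll call R ret₀ D₀ ms t.repo t.C t.form t.used, p.1 ∈ ms ∧ ∃ L t',
      CallSpec call R ret₀ D₀ Θ t
        (callEnd t (callAll call R ret₀ D₀ ms t.repo t.C t.form t.used)) p L t'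
  | [], t, henv, _, _, _, _, _ => ⟨henv.refl_ext t.form t.ret, by simp [callAll]⟩
  | m :: ms, t, henv, hk, hle, hret, hR, hms => by
    rw [callAll]
    rcases hm : R.lookup m with _ | L
    · obtain ⟨h₁, h₂⟩ := callAll_spec hcall ms t henv hk hle hret hR
        fun m hm => hms m (List.mem_cons_of_mem _ hm)
      exact ⟨h₁, fun p hp => ⟨List.mem_cons_of_mem _ (h₂ p hp).1, (h₂ p hp).2⟩⟩
    · have hL := hR m L hm
      have hadm := hL.body.subst1_var hret
        ((hms m List.mem_cons_self).symm.trans hL.param_ty.symm)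
      have henv₀ : TransEnv t.repo t.C D₀ t.used Θ := ⟨henv.repo, henv.keysC, hk, hle⟩
      have hs := hcall _ t.repo t.C D₀ t.form t.used Θ _ hadm henv₀
      dsimp only
      rw [callEnd_cons]
      generalize ht₁ : call (L.body.subst1 L.param (.var ret₀)) t.repo t.C D₀ t.form t.used = t₁
        at hs
      obtain ⟨h₁, h₂⟩ := callAll_spec hcall ms t₁ hs.env hk
        (fun r => (hle r).trans (hs.idx r)) (hs.used hret)
        (fun m L h => (hR m L h).mono hs.used) fun m hm => hms m (List.mem_cons_of_mem _ hm)
      refine ⟨h₁.trans hs.toTransExt, fun p hp => ?_⟩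
      rcases List.mem_cons.mp hp with rfl | hp
      · exact ⟨List.mem_cons_self, L, t, ⟨hm, hL, henv.refl_ext t.form t.ret, henv₀, ht₁.symm,
          hadm, hs, h₁⟩⟩
      · obtain ⟨hmem, L', t', h⟩ := h₂ p hp
        exact ⟨List.mem_cons_of_mem _ hmem, L', t', ⟨h.lookup, h.body, h.ext.trans hs.toTransExt,
          h.env, h.eq, h.adm, h.spec, h.last⟩⟩

theorem exists_mem_callAll {call : Translator Op} {R : Repo Op} {ret₀ : Var}
    {D₀ : SSAMap} {m : Meth} {L : Lam Op} (hm : R.lookup m = some L) :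
    ∀ (ms : List Meth), m ∈ ms → ∀ (R' : Repo Op) C φ U,
    ∃ t, (m, t) ∈ callAll call R ret₀ D₀ ms R' C φ U
  | [], h, _, _, _, _ => by simp at h
  | m' :: ms, h, R', C, φ, U => by
    rw [callAll]
    rcases List.mem_cons.mp h with rfl | h
    · rw [hm]
      exact ⟨_, List.mem_cons_self⟩
    · rcases R.lookup m' with _ | L'
      · exact exists_mem_callAll hm ms h _ _ _ _
      · obtain ⟨t, ht⟩ := exists_mem_callAll hm ms h _ _ _ _
        exact ⟨t, List.mem_cons_of_mem _ ht⟩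

/-- A method is called at most once, if it is listed only once. -/
theorem callAll_fst_sublist {call : Translator Op} {R : Repo Op} {ret₀ : Var} {D₀ : SSAMap} :
    ∀ (ms : List Meth) (R' : Repo Op) C φ U,
    ((callAll call R ret₀ D₀ ms R' C φ U).map Prod.fst).Sublist ms
  | [], _, _, _, _ => by simp [callAll]
  | m' :: ms, R', C, φ, U => by
    rw [callAll]
    rcases R.lookup m' with _ | L'
    · exact (callAll_fst_sublist ms _ _ _ _).cons _
    · exact (callAll_fst_sublist ms _ _ _ _).cons_cons _

theorem Repo.nodup_restrict (R : Repo Op) (θ : Ty) : (Repo.restrict R θ).Nodup :=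
  Finset.nodup_toList _

theorem Repo.mem_restrict {R : Repo Op} {θ : Ty} {m : Meth} :
    m ∈ Repo.restrict R θ ↔ m ∈ R.keys ∧ m.ty = θ := by
  simp [Repo.restrict]

theorem wellBehaved_transNil (G : FreshGen) : (transNil G : Translator Op).WellBehaved := by
  intro M R C D φ U Θ θ hM henv
  rw [← hM.typed.ty_eq]
  exact henv.retExpr G _ _ _

theorem Term.size_induction {P : Term Op → Prop}
    (h : ∀ M, (∀ N : Term Op, N.size < M.size → P N) → P M) (M : Term Op) : P M :=
  (measure Term.size).wf.induction M h

theorem TransEnv.insert_repo {R : Repo Op} {C D : SSAMap} {U : Finset Var} {Θ : Finset Ref}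
    (h : TransEnv R C D U Θ) {m : Meth} {L : Lam Op} (hL : L.Admissible m U Θ) :
    TransEnv (R.insert m L) C D U Θ := by
  refine ⟨fun m' L' h' => ?_, h.keysC, h.keysD, h.idx_le⟩
  rw [lookup_insert_eq_ite] at h'
  split_ifs at h' with e
  · cases h'; exact e ▸ hL
  · exact h.repo m' L' h'

theorem lookup_insert_of_fresh {R : Repo Op} {m m' : Meth} {L L' : Lam Op} (hm : m ∉ R.keys)
    (h : R.lookup m' = some L') : (R.insert m L).lookup m' = some L' := by
  rw [lookup_insert_eq_ite, if_neg, h]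
  rintro rfl
  exact hm (mem_keys_of_lookup h)

/-- The components of the term of a `letrec`, renamed as the translation does. -/
theorem Lam.Admissible.subst1_var {x f f' : Var} {M : Term Op} {m : Meth} {U : Finset Var}
    {Θ : Finset Ref} (h : (Lam.mk x M).Admissible m U Θ) (hf : f' ∈ U) (hty : f'.ty = f.ty) :
    ((Lam.mk x M).subst1 f (.var f')).Admissible m U Θ := by
  refine ⟨?_, ?_, ?_⟩
  · exact h.typed.subst (.single (v := .var f') hty)
  · intro z hz
    have hv := h.vars
    simp only [Lam.subst1, Lam.subst, Lam.vars, Finset.mem_union, Finset.mem_singleton] at hz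
    rcases hz with rfl | hz
    · exact hv (by simp [Lam.vars])
    · rcases Term.mem_vars_subst hz with hz | ⟨y, v, hy, hz⟩
      · exact hv (by simp [Lam.vars, hz])
      · obtain ⟨-, rfl⟩ := Subst.single_eq_some.mp (Subst.drop_eq_some.mp hy).2
        simp only [Val.fv, Finset.mem_singleton] at hz
        exact hz ▸ hf
  · simp only [Lam.subst1, Lam.subst, Term.refs_subst]
    exact h.refs

/-- The induction is on the size of terms, as the bodies of binders are renamed before they are
translated. -/
theorem wellBehaved_transPos (G : FreshGen) {call : Translator Op} (hcall : call.WellBehaved) :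
    (transPos G call).WellBehaved := by
  intro M
  induction M using Term.size_induction with
  | h M ih =>
  intro R C D φ U Θ θ hM henv
  have ht := hM.typed.ty_eq
  have hv := hM.vars
  have hr := hM.refs
  cases hM.typed with
  | fail θ => rw [transPos]; exact henv.retExpr G _ _ _
  | var x => rw [transPos]; exact henv.retExpr G _ _ _
  | meth m => rw [transPos]; exact henv.retExpr G _ _ _
  | int i => rw [transPos]; exact henv.retExpr G _ _ _
  | unit => rw [transPos]; exact henv.retExpr G _ _ _
  | deref r => rw [transPos]; exact henv.retExpr G _ _ _
  | @lam x M θ' hM' =>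
    rw [transPos]
    have hm : G.meth R.keys x.ty M.ty ∉ R.keys := G.meth_fresh _ _ _
    have hty := G.meth_ty R.keys x.ty M.ty
    generalize G.meth R.keys x.ty M.ty = m at hm hty
    have henv' : TransEnv (R.insert m ⟨x, M⟩) C D U Θ :=
      henv.insert_repo ⟨by rw [hty, hM'.ty_eq]; exact .lam hM', hv, hr⟩
    have h := henv'.retExpr G m.ty (.meth m) φ
    have e : m.ty = x.ty.arr θ' := by rw [hty, hM'.ty_eq]
    rw [e] at h ⊢
    exact ⟨⟨h.env, h.used, fun m' L' h' => lookup_insert_of_fresh hm h', h.idx, h.form⟩,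
      h.ret_ty, h.ret_mem, h.ret_fresh⟩
  | @fst M θ₁ θ₂ hM' =>
    rw [transPos]
    have h₁ := ih M (by simp only [Term.size]; omega) R C D φ U Θ _ ⟨hM', hv, hr⟩ henv
    rw [ht]
    exact h₁.toTransExt.finish' G _ _
  | @snd M θ₁ θ₂ hM' =>
    rw [transPos]
    have h₁ := ih M (by simp only [Term.size]; omega) R C D φ U Θ _ ⟨hM', hv, hr⟩ henv
    rw [ht]
    exact h₁.toTransExt.finish' G _ _
  | @assign r M hM' =>
    rw [transPos]
    simp only [Term.refs, Finset.union_subset_iff, Finset.singleton_subset_iff] at hr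
    have h₁ := ih M (by simp only [Term.size]; omega) R C D φ U Θ _ ⟨hM', hv, hr.2⟩ henv
    refine h₁.toTransExt.finish G _ _ ?_ ?_ ?_ ?_
    · rw [SSAMap.bump, keys_insert, h₁.env.keysC, Finset.insert_eq_of_mem hr.1]
    · rw [keys_insert, h₁.env.keysD, Finset.insert_eq_of_mem hr.1]
    · intro r'
      rw [SSAMap.idx_bump]
      split_ifs with e
      · subst e; exact Nat.le_succ _
      · exact le_rfl
    · intro r'
      rw [SSAMap.idx_insert]
      split_ifs with e
      · rw [e]
      · rw [SSAMap.idx_bump, if_neg e]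
        exact h₁.env.idx_le r'
  | @arith o M N hM' hN =>
    rw [transPos]
    simp only [Term.refs, Term.vars, Finset.union_subset_iff] at hr hv
    have h₁ := ih M (by simp only [Term.size]; omega) R C D φ U Θ _ ⟨hM', hv.1, hr.1⟩ henv
    have h₂ := ih N (by simp only [Term.size]; omega) _ _ _ (transPos G call M R C D φ U).form _ Θ _
      ⟨hN, hv.2.trans h₁.used, hr.2⟩ h₁.env
    exact (h₂.toTransExt.trans h₁.toTransExt).finish' G _ _
  | @pair M N θ₁ θ₂ hM' hN =>
    rw [transPos]
    simp only [Term.refs, Term.vars, Finset.union_subset_iff] at hr hv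
    have h₁ := ih M (by simp only [Term.size]; omega) R C D φ U Θ _ ⟨hM', hv.1, hr.1⟩ henv
    have h₂ := ih N (by simp only [Term.size]; omega) _ _ _ (transPos G call M R C D φ U).form _ Θ _
      ⟨hN, hv.2.trans h₁.used, hr.2⟩ h₁.env
    rw [hM'.ty_eq, hN.ty_eq]
    exact (h₂.toTransExt.trans h₁.toTransExt).finish' G _ _
  | @letin x M N θ hM' hN =>
    rw [transPos]
    simp only [Term.refs, Term.vars, Finset.union_subset_iff] at hr hv
    have h₁ := ih M (by simp only [Term.size]; omega) R C D φ U Θ _ ⟨hM', hv.1.2, hr.1⟩ henv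
    have h₂ := ih (N.subst1 x (.var (transPos G call M R C D φ U).ret))
     
      (by rw [Term.size_subst1_var]; simp only [Term.size]; omega) _ _ _
      (transPos G call M R C D φ U).form _ Θ θ
      (Term.Admissible.subst1_var ⟨hN, hv.2.trans h₁.used, hr.2⟩ h₁.ret_mem h₁.ret_ty) h₁.env
    rw [hN.ty_eq]
    exact (h₂.toTransExt.trans h₁.toTransExt).finish' G _ _
  | @letrec f x M N θ' θ'' hf hM' hN =>
    rw [transPos]
    simp only [Term.refs, Term.vars, Finset.union_subset_iff, Finset.insert_subset_iff,
      Finset.singleton_subset_iff] at hr hv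
    have hm : G.meth R.keys x.ty M.ty ∉ R.keys := G.meth_fresh _ _ _
    have hty := G.meth_ty R.keys x.ty M.ty
    generalize G.meth R.keys x.ty M.ty = m at hm hty
    have hff := G.var_fresh U f.ty
    have hfty := G.var_ty U f.ty
    generalize G.var U f.ty = f' at hff hfty
    have hs : U ⊆ insert f' U := Finset.subset_insert _ _
    have hL : ((Lam.mk x M).subst1 f (.var f')).Admissible m (insert f' U) Θ := by
      refine Lam.Admissible.subst1_var ⟨?_, ?_, hr.1⟩ (Finset.mem_insert_self _ _) hfty
      · rw [hty, hM'.ty_eq]; exact .lam hM'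
      · exact (Finset.union_subset (Finset.singleton_subset_iff.mpr hv.1.1.2) hv.1.2).trans hs
    have h := ih (N.subst1 f (.var f'))
      (by rw [Term.size_subst1_var]; simp only [Term.size]; omega) _ _ _
      (.and φ (.eq (pv f') (.meth m))) (insert f' U) Θ _
      (Term.Admissible.subst1_var ⟨hN, hv.2.trans hs, hr.2⟩ (Finset.mem_insert_self _ _) hfty)
      ((henv.mono hs henv.keysC fun _ => le_rfl).insert_repo hL)
    exact ⟨⟨h.env, hs.trans h.used,
      fun m' L' h' => h.repo _ _ (lookup_insert_of_fresh hm h'), h.idx,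
      fun I ρ hρ => (h.form I ρ hρ).1⟩, h.ret_ty, h.ret_mem, fun h' => h.ret_fresh (hs h')⟩
  | @appMeth m M hM' =>
    rw [transPos]
    simp only [Term.vars] at hv
    have h₁ := ih M (by simp only [Term.size]; omega) R C D φ U Θ _ ⟨hM', hv, hr⟩ henv
    rcases hL : R.lookup m with _ | L
    · exact h₁.toTransExt.finish' G _ _
    · dsimp only
      have hL' := (henv.repo m L hL).mono h₁.used
      have h₂ := hcall (L.body.subst1 L.param (.var (transPos G call M R C D φ U).ret)) _ _ _
        (transPos G call M R C D φ U).form _ Θ m.cod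
        (hL'.body.subst1_var h₁.ret_mem (h₁.ret_ty.trans hL'.param_ty.symm)) h₁.env
      exact (h₂.toTransExt.trans h₁.toTransExt).finish' G _ _
  | @ite M M₁ M₀ θ hM' hM₁ hM₀ =>
    rw [transPos]
    simp only [Term.refs, Term.vars, Finset.union_subset_iff] at hr hv
    have hb := ih M (by simp only [Term.size]; omega) R C D φ U Θ _ ⟨hM', hv.1.1, hr.1.1⟩ henv
    generalize transPos G call M R C D φ U = tb at hb
    have h₀ := ih M₀ (by simp only [Term.size]; omega) tb.repo tb.C tb.D tb.form tb.used Θ _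
      ⟨hM₀, hv.2.trans hb.used, hr.2⟩ hb.env
    generalize transPos G call M₀ tb.repo tb.C tb.D tb.form tb.used = t₀ at h₀
    have h₁ := ih M₁ (by simp only [Term.size]; omega) t₀.repo t₀.C tb.D t₀.form t₀.used Θ _
      ⟨hM₁, (hv.1.2.trans hb.used).trans h₀.used, hr.1.2⟩
      ⟨h₀.env.repo, h₀.env.keysC, hb.env.keysD, fun r => (hb.env.idx_le r).trans (h₀.idx r)⟩
    generalize transPos G call M₁ t₀.repo t₀.C tb.D t₀.form t₀.used = t₁ at h₁
    rw [hM₁.ty_eq]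
    have hk : t₁.C.bumpAll.keys = Θ := t₁.C.keys_bumpAll.trans h₁.env.keysC
    exact (h₁.toTransExt.trans (h₀.toTransExt.trans hb.toTransExt)).finish G _ _ hk hk
      t₁.C.idx_le_bumpAll fun _ => le_rfl
  | @appVar x M θ' θ hx hM' =>
    rw [transPos]
    simp only [Term.vars, Finset.union_subset_iff] at hv
    have h₁ := ih M (by simp only [Term.size]; omega) R C D φ U Θ _ ⟨hM', hv.2, hr⟩ henv
    dsimp only
    rw [ht]
    generalize transPos G call M R C D φ U = t₀ at h₁
    have hl := (callAll_spec hcall (R := R) (ret₀ := t₀.ret) (D₀ := t₀.D) (Repo.restrict R x.ty)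
      t₀ h₁.env h₁.env.keysD h₁.env.idx_le h₁.ret_mem
      (fun m L h => (henv.repo m L h).mono h₁.used) (fun m hm => by
        have := (Repo.mem_restrict.mp hm).2
        rw [hx] at this
        rw [h₁.ret_ty]
        exact (Ty.arr.inj this).1)).1
    unfold callEnd at hl
    rcases hg : (callAll call R t₀.ret t₀.D (Repo.restrict R x.ty) t₀.repo t₀.C t₀.form
      t₀.used).getLast? with _ | ⟨m, tₙ⟩
    · exact h₁.toTransExt.finish' G _ _
    · rw [hg] at hl
      have hk : tₙ.C.bumpAll.keys = Θ := tₙ.C.keys_bumpAll.trans hl.env.keysC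
      exact (hl.trans h₁.toTransExt).finish G _ _ hk hk tₙ.C.idx_le_bumpAll fun _ => le_rfl

theorem wellBehaved_transNat (G : FreshGen) :
    ∀ k, (transNat G k : Translator Op).WellBehaved
  | 0 => wellBehaved_transPos G (wellBehaved_transNil G)
  | k + 1 => wellBehaved_transPos G (wellBehaved_transNat G k)

end Invariants

/-! ### Truth of the formulas used by the translation -/

section Formulas

variable {Op : Type u} {I : Op → ℤ → ℤ → ℤ} {ρ : Valuation}

theorem Form.holds_eq_pv {x : Var} {e : Expr Op} :
    (Form.eq (pv x) e).Holds I ρ ↔ e.eval I ρ = some (ρ (.prog x)) := by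
  simp [Form.Holds, pv, Expr.eval]

theorem Form.holds_eq_ssa {r : Ref} {D : SSAMap} {e : Expr Op} :
    (Form.eq (D.expr r) e).Holds I ρ ↔ e.eval I ρ = some (ρ (.ssa r (D.idx r))) := by
  simp [Form.Holds, SSAMap.expr, Expr.eval]

/-- A guard between variables: `b` equals `a` if `a` is `fail` or `nil`, and `ψ` holds otherwise. -/
theorem Form.holds_guard {a b : Var} {ψ : Form Op} :
    (Form.guard (pv a) (pv b) ψ).Holds I ρ ↔
      (∀ χ : Outcome, χ.Aborts → ρ (.prog a) = χ → ρ (.prog b) = χ) ∧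
        (∀ v, ρ (.prog a) = .val v → ψ.Holds I ρ) := by
  simp only [Form.guard, Form.Holds, pv, Expr.eval, Option.some.injEq, exists_eq_left']
  rcases ρ (.prog a) with v | _ | _
  · simp only [reduceCtorEq, false_implies, true_and, false_or]
    refine ⟨fun h => ⟨fun χ hχ e => ?_, fun _ _ => h⟩, fun h => h.2 v rfl⟩
    rw [← e] at hχ
    exact hχ.elim
  · refine ⟨fun h => ⟨fun χ _ e => e ▸ (h.1.1 rfl).symm, by simp⟩, fun h => ?_⟩
    exact ⟨⟨fun _ => (h.1 .fail trivial rfl).symm, by simp⟩, by simp⟩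
  · refine ⟨fun h => ⟨fun χ _ e => e ▸ (h.1.2 rfl).symm, by simp⟩, fun h => ?_⟩
    exact ⟨⟨by simp, fun _ => (h.1 .nil trivial rfl).symm⟩, by simp⟩

theorem Form.holds_conj {l : List (Form Op)} :
    (Form.conj l).Holds I ρ ↔ ∀ φ ∈ l, φ.Holds I ρ := by
  induction l with
  | nil => simp [Form.conj, Form.Holds]
  | cons φ l ih => simp [Form.conj, Form.Holds, ih]

theorem SSAMap.holds_join {C D : SSAMap} :
    (C.join D : Form Op).Holds I ρ ↔
      ∀ r ∈ C.keys, ρ (.ssa r (C.idx r)) = ρ (.ssa r (D.idx r)) := by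
  simp only [SSAMap.join, Form.holds_conj, List.mem_map, Finset.mem_toList,
    forall_exists_index, and_imp, forall_apply_eq_imp_iff₂, Form.holds_eq_ssa]
  simp [SSAMap.expr, Expr.eval, eq_comm]

end Formulas

/-! ### The evaluation described by the translation -/

section Simulation

variable {Op : Type u} {I : Op → ℤ → ℤ → ℤ}

/-- The substitution `s'` extends `s`. -/
def Subst.Extends (s' s : Subst) : Prop := ∀ x v, s x = some v → s' x = some v

/-- The substitution `s` is defined on `F`. -/
def Subst.Covers (s : Subst) (F : Finset Var) : Prop := ∀ x ∈ F, ∃ v, s x = some v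

/-- The substitution that behaves like `s`, except that it sends `x` to `v`. -/
def Subst.set (s : Subst) (x : Var) (v : Val) : Subst := fun y => if y = x then some v else s y

theorem Subst.set_self (s : Subst) (x : Var) (v : Val) : s.set x v x = some v := if_pos rfl

theorem Subst.set_eq_some {s : Subst} {x y : Var} {v w : Val} (h : s.set x v y = some w) :
    (y = x ∧ w = v) ∨ s y = some w := by
  unfold Subst.set at h
  split_ifs at h with e
  · exact .inl ⟨e, (Option.some.inj h).symm⟩
  · exact .inr h

theorem Subst.Extends.refl (s : Subst) : s.Extends s := fun _ _ h => h

theorem Subst.Extends.trans {s s' s'' : Subst} (h : s''.Extends s') (h' : s'.Extends s) :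
    s''.Extends s := fun x v hv => h x v (h' x v hv)

theorem Subst.Covers.mono {s s' : Subst} {F F' : Finset Var} (h : s.Covers F) (hs : s'.Extends s)
    (hF : F' ⊆ F) : s'.Covers F' := fun x hx => (h x (hF hx)).imp (hs x)

theorem Subst.Extends.eq_of_covers {s s' : Subst} {F : Finset Var} (hs : s'.Extends s)
    (h : s.Covers F) : ∀ x ∈ F, s x = s' x := by
  intro x hx
  obtain ⟨v, hv⟩ := h x hx
  rw [hv, hs x v hv]

/-- A run of the program that follows the translation: `R₀` and `S` are the repository and store
reached by the run, and `η` gives the values of those variables of the translation that the run has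
determined. The translation explores all branches, so that its repository `R` may contain more
methods than `R₀`. -/
structure LiveState (η : Subst) (R₀ : Repo Op) (S : Store) (R : Repo Op) (U : Finset Var)
    (Θ : Finset Ref) : Prop where
  dom : ∀ x v, η x = some v → x ∈ U
  closed : ∀ x v, η x = some v → v.fv = ∅
  typed : η.Typed
  meths : ∀ x v, η x = some v → v.meths ⊆ R₀.keys
  store_keys : S.keys = Θ
  store : ∀ r v, S.lookup r = some v → v.fv = ∅ ∧ v.ty = r.ty ∧ v.meths ⊆ R₀.keys
  repo : ∀ m L₀, R₀.lookup m = some L₀ →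
    ∃ L, R.lookup m = some L ∧ L₀ = L.subst η ∧ η.Covers L.fv ∧ L.body.meths ⊆ R₀.keys

/-- The valuation `ρ` agrees with the live variables `η`, and with the store `S` at the SSA
variables given by `D`. -/
structure Valuation.Models (ρ : Valuation) (η : Subst) (D : SSAMap) (S : Store) : Prop where
  env : ∀ x v, η x = some v → ρ (.prog x) = .val v
  store : ∀ r v, S.lookup r = some v → ρ (.ssa r (D.idx r)) = .val v

/-- The term `N` has an evaluation from `R₀`, `S` that is described by the result `t` of the
translation: every valuation that satisfies the formula of `t` and agrees with the initial state
assigns the outcome to the return variable and, unless the evaluation aborts, agrees with the final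
state. -/
inductive Simulates (I : Op → ℤ → ℤ → ℤ) (t : Result Op) (b : Option ℕ) (N : Term Op) (η : Subst)
    (R₀ : Repo Op) (S : Store) (D : SSAMap) (Θ : Finset Ref) : Prop
  | abort (χ : Outcome) (R₀' : Repo Op) (S' : Store) (ha : χ.Aborts)
      (he : Eval I N R₀ S b χ R₀' S')
      (hρ : ∀ ρ : Valuation, t.form.Holds I ρ → ρ.Models η D S → ρ (.prog t.ret) = χ) :
      Simulates I t b N η R₀ S D Θ
  | value (v : Val) (R₀' : Repo Op) (S' : Store) (η' : Subst)
      (he : Eval I N R₀ S b (.val v) R₀' S') (hv : η' t.ret = some v) (hη : η'.Extends η)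
      (hR : R₀.keys ⊆ R₀'.keys) (hl : LiveState η' R₀' S' t.repo t.used Θ)
      (hρ : ∀ ρ : Valuation, t.form.Holds I ρ → ρ.Models η D S → ρ.Models η' t.D S') :
      Simulates I t b N η R₀ S D Θ

/-- The translator describes the evaluation with bound `b`. -/
def Translator.Sound (I : Op → ℤ → ℤ → ℤ) (T : Translator Op) (b : Option ℕ) : Prop :=
  ∀ M R C D φ U Θ θ, Term.Admissible M θ U Θ → TransEnv R C D U Θ →
    ∀ (η : Subst) (R₀ : Repo Op) (S : Store), LiveState η R₀ S R U Θ → η.Covers M.fv →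
      M.meths ⊆ R₀.keys → Simulates I (T M R C D φ U) b (M.subst η) η R₀ S D Θ

theorem LiveState.mono {η : Subst} {R₀ R R' : Repo Op} {S : Store} {U U' : Finset Var}
    {Θ : Finset Ref} (h : LiveState η R₀ S R U Θ) (hU : U ⊆ U')
    (hR : ∀ m L, R.lookup m = some L → R'.lookup m = some L) : LiveState η R₀ S R' U' Θ where
  dom x v hv := hU (h.dom x v hv)
  closed := h.closed
  typed := h.typed
  meths := h.meths
  store_keys := h.store_keys
  store := h.store
  repo m L₀ hm := by
    obtain ⟨L, hL, h'⟩ := h.repo m L₀ hm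
    exact ⟨L, hR m L hL, h'⟩

theorem Lam.subst_extends {η η' : Subst} {L : Lam Op} (hη : η'.Extends η)
    (h : η.Covers L.fv) : L.subst η = L.subst η' :=
  Lam.subst_congr (hη.eq_of_covers h)

theorem LiveState.set {η : Subst} {R₀ R : Repo Op} {S : Store} {U : Finset Var}
    {Θ : Finset Ref} (h : LiveState η R₀ S R U Θ) {x : Var} {v : Val} (hx : x ∉ U)
    (hc : v.fv = ∅) (hty : v.ty = x.ty) (hm : v.meths ⊆ R₀.keys) :
    (η.set x v).Extends η ∧ LiveState (η.set x v) R₀ S R (insert x U) Θ := by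
  have hext : (η.set x v).Extends η := by
    intro y w hw
    unfold Subst.set
    rw [if_neg, hw]
    rintro rfl
    exact hx (h.dom _ w hw)
  refine ⟨hext, ?_, ?_, ?_, ?_, h.store_keys, h.store, ?_⟩
  · intro y w hw
    rcases Subst.set_eq_some hw with ⟨rfl, rfl⟩ | hw
    · exact Finset.mem_insert_self _ _
    · exact Finset.mem_insert_of_mem (h.dom y w hw)
  · intro y w hw
    rcases Subst.set_eq_some hw with ⟨rfl, rfl⟩ | hw
    · exact hc
    · exact h.closed y w hw
  · intro y w hw
    rcases Subst.set_eq_some hw with ⟨rfl, rfl⟩ | hw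
    · exact hty
    · exact h.typed y w hw
  · intro y w hw
    rcases Subst.set_eq_some hw with ⟨rfl, rfl⟩ | hw
    · exact hm
    · exact h.meths y w hw
  · intro m L₀ hL₀
    obtain ⟨L, hL, rfl, hcov, hms⟩ := h.repo m L₀ hL₀
    exact ⟨L, hL, Lam.subst_extends hext hcov, hcov.mono hext subset_rfl, hms⟩

theorem LiveState.keys_subset {η : Subst} {R₀ R : Repo Op} {S : Store} {U : Finset Var}
    {Θ : Finset Ref} (h : LiveState η R₀ S R U Θ) : R₀.keys ⊆ R.keys := by
  intro m hm
  obtain ⟨L₀, hL₀⟩ := (mem_keys_iff_lookup _ _).mp hm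
  obtain ⟨L, hL, -⟩ := h.repo m L₀ hL₀
  exact mem_keys_of_lookup hL

/-- Storing a new method, whose name may become the value of new variables. -/
theorem LiveState.insert_repo {η η' : Subst} {R₀ R : Repo Op} {S : Store} {U U' : Finset Var}
    {Θ : Finset Ref} (h : LiveState η R₀ S R U Θ) (hext : η'.Extends η) {m : Meth} {L : Lam Op}
    (hη' : ∀ x v, η' x = some v → x ∈ U' ∧ v.fv = ∅ ∧ v.ty = x.ty ∧ v.meths ⊆ insert m R₀.keys)
    (hcov : η'.Covers L.fv) (hL : L.body.meths ⊆ insert m R₀.keys) :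
    LiveState η' (R₀.insert m (L.subst η')) S (R.insert m L) U' Θ where
  dom x v hv := (hη' x v hv).1
  closed x v hv := (hη' x v hv).2.1
  typed x v hv := (hη' x v hv).2.2.1
  meths x v hv := by rw [keys_insert]; exact (hη' x v hv).2.2.2
  store_keys := h.store_keys
  store r v hv := by
    rw [keys_insert]
    obtain ⟨h₁, h₂, h₃⟩ := h.store r v hv
    exact ⟨h₁, h₂, h₃.trans (Finset.subset_insert _ _)⟩
  repo m' L₀ hL₀ := by
    rw [keys_insert]
    rw [lookup_insert_eq_ite] at hL₀ ⊢
    split_ifs at hL₀ ⊢ with e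
    · cases hL₀
      exact ⟨L, rfl, rfl, hcov, hL⟩
    · obtain ⟨L', hL', rfl, hcov', hms⟩ := h.repo m' L₀ hL₀
      exact ⟨L', hL', Lam.subst_extends hext hcov', hcov'.mono hext subset_rfl,
        hms.trans (Finset.subset_insert _ _)⟩

theorem LiveState.insert_store {η : Subst} {R₀ R : Repo Op} {S : Store} {U : Finset Var}
    {Θ : Finset Ref} (h : LiveState η R₀ S R U Θ) {r : Ref} {v : Val} (hr : r ∈ Θ)
    (hc : v.fv = ∅) (hty : v.ty = r.ty) (hm : v.meths ⊆ R₀.keys) :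
    LiveState η R₀ (S.insert r v) R U Θ where
  dom := h.dom
  closed := h.closed
  typed := h.typed
  meths := h.meths
  store_keys := by rw [keys_insert, h.store_keys, Finset.insert_eq_of_mem hr]
  store r' v' h' := by
    rw [lookup_insert_eq_ite] at h'
    split_ifs at h' with e
    · cases h'; exact ⟨hc, e ▸ hty, hm⟩
    · exact h.store r' v' h'
  repo := h.repo

/-- The body of a binder of `x`, once the bound expression has been evaluated to `v` and its return
variable `ret` has been substituted for `x` by the translation. -/
theorem LiveState.subst1_var {η η' : Subst} {R₀ R₀' R' : Repo Op} {S' : Store}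
    {U U' : Finset Var} {Θ : Finset Ref} {N : Term Op} {θ : Ty} {x ret : Var} {v : Val}
    (hl' : LiveState η' R₀' S' R' U' Θ) (hN : N.Admissible θ U Θ)
    (hcov : η.Covers (N.fv.erase x)) (hms : N.meths ⊆ R₀.keys)
    (hext : η'.Extends η) (hR : R₀.keys ⊆ R₀'.keys) (hret : ret ∉ U) (hty : ret.ty = x.ty)
    (hv : η' ret = some v) :
    (N.subst1 x (.var ret)).subst η' = (N.subst (η.drop x)).subst1 x v ∧
      η'.Covers (N.subst1 x (.var ret)).fv ∧ (N.subst1 x (.var ret)).meths ⊆ R₀'.keys := by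
  refine ⟨?_, ?_, ?_⟩
  · exact Term.subst1_var_subst hN.typed (fun h => hret (hN.vars h)) hty hv hl'.typed hl'.closed
      fun z hz hn => hext.eq_of_covers hcov z (Finset.mem_erase.mpr ⟨hn, hz⟩)
  · intro z hz
    rcases Finset.mem_insert.mp (Term.fv_subst1_var_subset N x ret hz) with rfl | hz
    · exact ⟨v, hv⟩
    · exact (hcov z hz).imp (hext z)
  · exact Term.meths_subst1_subset (hms.trans hR) (by simp [Val.meths])

theorem Valuation.Models.set {ρ : Valuation} {η : Subst} {D : SSAMap} {S : Store}
    (h : ρ.Models η D S) {x : Var} {v : Val} (hx : ρ (.prog x) = .val v) :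
    ρ.Models (η.set x v) D S := by
  refine ⟨fun y w hw => ?_, h.store⟩
  rcases Subst.set_eq_some hw with ⟨rfl, rfl⟩ | hw
  · exact hx
  · exact h.env y w hw

/-- The last step of a construct that returns a value in a fresh variable. -/
theorem Simulates.return_value {G : FreshGen} {θ : Ty} {b : Option ℕ} {N : Term Op} {η η' : Subst}
    {R₀ R₀' R' : Repo Op} {S S' : Store} {C' D D' : SSAMap} {U' : Finset Var} {Θ : Finset Ref}
    {form : Form Op} {v : Val} (he : Eval I N R₀ S b (.val v) R₀' S') (hη : η'.Extends η)
    (hR : R₀.keys ⊆ R₀'.keys) (hl : LiveState η' R₀' S' R' U' Θ) (hc : v.fv = ∅)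
    (hty : v.ty = θ) (hm : v.meths ⊆ R₀'.keys)
    (hρ : ∀ ρ : Valuation, form.Holds I ρ → ρ.Models η D S →
      ρ.Models η' D' S' ∧ ρ (.prog (G.var U' θ)) = .val v) :
    Simulates I ⟨G.var U' θ, form, R', C', D', insert (G.var U' θ) U'⟩ b N η R₀ S D Θ := by
  obtain ⟨hext, hl'⟩ := hl.set (G.var_fresh U' θ) hc (hty.trans (G.var_ty U' θ).symm) hm
  exact .value v R₀' S' _ he (Subst.set_self _ _ _) (hext.trans hη) hR hl'
    fun ρ h h' => (hρ ρ h h').1.set (hρ ρ h h').2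

theorem Simulates.retExpr {G : FreshGen} {θ : Ty} {e : Expr Op} {b : Option ℕ} {N : Term Op}
    {η : Subst} {R₀ R₀' R : Repo Op} {S : Store} {C D : SSAMap} {U : Finset Var} {Θ : Finset Ref}
    {φ : Form Op} {v : Val} (he : Eval I N R₀ S b (.val v) R₀' S) (hR : R₀.keys ⊆ R₀'.keys)
    (hl : LiveState η R₀' S R U Θ) (hc : v.fv = ∅) (hty : v.ty = θ) (hm : v.meths ⊆ R₀'.keys)
    (hρ : ∀ ρ : Valuation, ρ.Models η D S → e.eval I ρ = some (.val v)) :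
    Simulates I (HORef.retExpr G θ e R C D φ U) b N η R₀ S D Θ := by
  refine Simulates.return_value he (.refl η) hR hl hc hty hm fun ρ h h' => ⟨h', ?_⟩
  have := Form.holds_eq_pv.mp h.1
  rw [hρ ρ h'] at this
  exact (Option.some.inj this).symm

/-- A construct aborts if its first component does. -/
theorem Simulates.abort_guard {t₁ : Result Op} {b : Option ℕ} {N : Term Op} {η : Subst}
    {R₀ R₀' R' : Repo Op} {S S' : Store} {C' D D' : SSAMap} {U' : Finset Var} {Θ : Finset Ref}
    {form ψ : Form Op} {ret : Var} {χ : Outcome} (ha : χ.Aborts)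
    (he : Eval I N R₀ S b χ R₀' S')
    (hρ₁ : ∀ ρ : Valuation, t₁.form.Holds I ρ → ρ.Models η D S → ρ (.prog t₁.ret) = χ)
    (hform : ∀ ρ : Valuation, form.Holds I ρ → t₁.form.Holds I ρ) :
    Simulates I ⟨ret, .and (.guard (pv t₁.ret) (pv ret) ψ) form, R', C', D', U'⟩
      b N η R₀ S D Θ := by
  refine .abort χ R₀' S' ha he fun ρ h h' => ?_
  exact (Form.holds_guard.mp h.1).1 χ ha (hρ₁ ρ (hform ρ h.2) h')

/-- A construct ends with the outcome of its last component `N'`, which the run reaches in the state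
`η₁`, `R₁`, `S₁`. -/
theorem Simulates.tail {G : FreshGen} {θ : Ty} {t : Result Op} {b b' : Option ℕ} {N N' : Term Op}
    {η η₁ : Subst} {R₀ R₁ R' : Repo Op} {S S₁ : Store} {C' D D₁ D' : SSAMap} {U' : Finset Var}
    {Θ : Finset Ref} {form : Form Op}
    (h : Simulates I t b' N' η₁ R₁ S₁ D₁ Θ) (hθ : t.ret.ty = θ)
    (he : ∀ χ R'' S'', Eval I N' R₁ S₁ b' χ R'' S'' → Eval I N R₀ S b χ R'' S'')
    (hη : η₁.Extends η) (hR : R₀.keys ⊆ R₁.keys)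
    (hU : t.used ⊆ U') (hR' : ∀ m L, t.repo.lookup m = some L → R'.lookup m = some L)
    (hρ : ∀ ρ : Valuation, form.Holds I ρ → ρ.Models η D S → t.form.Holds I ρ ∧
      ρ.Models η₁ D₁ S₁ ∧ ρ (.prog (G.var U' θ)) = ρ (.prog t.ret) ∧
      ∀ v, ρ (.prog t.ret) = .val v →
        ∀ r ∈ Θ, ρ (.ssa r (D'.idx r)) = ρ (.ssa r (t.D.idx r))) :
    Simulates I ⟨G.var U' θ, form, R', C', D', insert (G.var U' θ) U'⟩ b N η R₀ S D Θ := by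
  rcases h with ⟨χ, R'', S'', ha, he', h⟩ | ⟨v, R'', S'', η', he', hv, hη', hR'', hl, h⟩
  · refine .abort χ R'' S'' ha (he _ _ _ he') fun ρ h₁ h₂ => ?_
    obtain ⟨h₃, h₄, h₅, -⟩ := hρ ρ h₁ h₂
    exact h₅.trans (h ρ h₃ h₄)
  · refine Simulates.return_value (he _ _ _ he') (hη'.trans hη) (hR.trans hR'') (hl.mono hU hR')
      (hl.closed _ v hv) ((hl.typed _ v hv).trans hθ) (hl.meths _ v hv) fun ρ h₁ h₂ => ?_
    obtain ⟨h₃, h₄, h₅, h₆⟩ := hρ ρ h₁ h₂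
    have h₇ := h ρ h₃ h₄
    have h₈ := h₇.env _ v hv
    refine ⟨⟨h₇.env, fun r w hw => ?_⟩, h₅.trans h₈⟩
    rw [h₆ v h₈ r (hl.store_keys ▸ mem_keys_of_lookup hw)]
    exact h₇.store r w hw

/-- The return variable of a guarded equation has the same value as the variable it copies. -/
theorem Form.holds_guard_copy {ρ : Valuation} {a b : Var} {ψ : Form Op}
    (h : (Form.guard (pv a) (pv b) ψ).Holds I ρ)
    (h' : ψ.Holds I ρ → ρ (.prog b) = ρ (.prog a)) : ρ (.prog b) = ρ (.prog a) := by
  obtain ⟨h₁, h₂⟩ := Form.holds_guard.mp h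
  rcases ha : ρ (.prog a) with v | _ | _
  · rw [← ha]
    exact h' (h₂ v ha)
  · exact h₁ _ trivial ha
  · exact h₁ _ trivial ha

theorem Form.holds_eq_pv_pv {ρ : Valuation} {a b : Var} :
    (Form.eq (pv b) (pv a) : Form Op).Holds I ρ ↔ ρ (.prog b) = ρ (.prog a) := by
  rw [Form.holds_eq_pv]
  simp [pv, Expr.eval, eq_comm]

theorem Ty.ne_arr_self (a b : Ty) : a ≠ .arr a b := by
  intro h
  have := congrArg sizeOf h
  simp only [Ty.arr.sizeOf_spec] at this
  omega

theorem Subst.drop_single {x y : Var} (h : x ≠ y) (v : Val) :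
    (Subst.single x v).drop y = Subst.single x v := by
  funext z
  unfold Subst.drop Subst.single
  split_ifs with h₁ h₂
  · exact (h (h₂.symm.trans h₁)).elim
  · rfl
  · rfl
  · rfl

theorem Subst.drop_comm (s : Subst) (x y : Var) : (s.drop x).drop y = (s.drop y).drop x := by
  funext z
  unfold Subst.drop
  split_ifs <;> rfl

theorem sound_transNil (G : FreshGen) : (transNil G : Translator Op).Sound I none := by
  intro M R C D φ U Θ θ hM henv η R₀ S hl hcov hms
  refine .abort .nil R₀ S trivial .nil fun ρ h _ => ?_
  have := Form.holds_eq_pv.mp h.1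
  exact (Option.some.inj this).symm

theorem Subst.Covers.union {s : Subst} {F F' : Finset Var} :
    s.Covers (F ∪ F') ↔ s.Covers F ∧ s.Covers F' := by
  simp only [Subst.Covers, Finset.mem_union]
  exact ⟨fun h => ⟨fun x hx => h x (.inl hx), fun x hx => h x (.inr hx)⟩,
    fun h x hx => hx.elim (h.1 x) (h.2 x)⟩

theorem Term.subst_extends {η η' : Subst} {M : Term Op} (hη : η'.Extends η)
    (h : η.Covers M.fv) : M.subst η = M.subst η' :=
  Term.subst_congr (hη.eq_of_covers h)

end Simulation

/-! ### Soundness of one level of the translation -/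

section Soundness

variable {Op : Type u} {I : Op → ℤ → ℤ → ℤ}

/-- The translation at bound `k` is sound if the translation of the calls at bound `k - 1` is. The
evaluation whose existence is claimed creates the same method names as the translation. -/
theorem sound_transPos (G : FreshGen) {call : Translator Op} (hcall : call.WellBehaved) {k : ℕ}
    (hs : call.Sound I (predBound (some k))) : (transPos G call).Sound I (some k) := by
  intro M
  induction M using Term.size_induction with
  | h M ih =>
  intro R C D φ U Θ θ hM henv η R₀ S hl hcov hms
  have ht := hM.typed.ty_eq
  have hv := hM.vars
  have hr := hM.refs
  have hwb := wellBehaved_transPos G hcall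
  cases hM.typed with
  | fail θ =>
    rw [transPos]
    refine .abort .fail R₀ S trivial .fail fun ρ h _ => ?_
    exact (Option.some.inj (Form.holds_eq_pv.mp h.1)).symm
  | var x =>
    rw [transPos, Term.subst_var]
    obtain ⟨v, hx⟩ := hcov x (by simp [Term.fv])
    rw [hx]
    exact Simulates.retExpr .val subset_rfl hl (hl.closed x v hx) (hl.typed x v hx)
      (hl.meths x v hx) fun ρ h => by simp [pv, Expr.eval, h.env x v hx]
  | meth m =>
    rw [transPos]
    exact Simulates.retExpr (v := .meth m) (.val (v := .meth m)) subset_rfl hl rfl rfl hms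
      fun ρ h => rfl
  | int i =>
    rw [transPos]
    exact Simulates.retExpr (v := .int i) (.val (v := .int i)) subset_rfl hl rfl rfl
      (by simp [Val.meths]) fun ρ h => rfl
  | unit =>
    rw [transPos]
    exact Simulates.retExpr (v := .unit) (.val (v := .unit)) subset_rfl hl rfl rfl
      (by simp [Val.meths]) fun ρ h => rfl
  | deref r =>
    rw [transPos]
    obtain ⟨v, hSr⟩ := (mem_keys_iff_lookup S r).mp (hl.store_keys ▸ hr (by simp [Term.refs]))
    obtain ⟨h₁, h₂, h₃⟩ := hl.store r v hSr
    exact Simulates.retExpr (.deref hSr) subset_rfl hl h₁ h₂ h₃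
      fun ρ h => by simp [SSAMap.expr, Expr.eval, h.store r v hSr]
  | @lam x M θ' hM' =>
    rw [transPos]
    have hm : G.meth R.keys x.ty M.ty ∉ R.keys := G.meth_fresh _ _ _
    have hty := G.meth_ty R.keys x.ty M.ty
    generalize G.meth R.keys x.ty M.ty = m at hm hty
    -- the name is fresh for `R`, hence for the smaller repository `R₀` of the run
    have hs : R₀.keys ⊆ insert m R₀.keys := Finset.subset_insert _ _
    have hl' := hl.insert_repo (m := m) (L := ⟨x, M⟩) (.refl η)
      (fun y v hy => ⟨hl.dom y v hy, hl.closed y v hy, hl.typed y v hy,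
        (hl.meths y v hy).trans hs⟩) hcov (hms.trans hs)
    refine Simulates.retExpr (v := .meth m) (.lam (fun h => hm (hl.keys_subset ?_)) ?_) ?_ hl'
      rfl rfl ?_ fun ρ h => rfl
    · exact Finmap.mem_keys.mpr h
    · rw [hty, hM'.ty_eq]
      exact .lam (hM'.subst (hl.typed.drop x))
    · rw [keys_insert]; exact hs
    · rw [keys_insert]; simp [Val.meths]
  | @fst M θ₁ θ₂ hM' =>
    rw [transPos, ht]
    have h₁ := ih M (by simp only [Term.size]; omega) R C D φ U Θ _ ⟨hM', hv, hr⟩ henv η R₀ S hl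
      hcov hms
    have hw := hwb M R C D φ U Θ _ ⟨hM', hv, hr⟩ henv
    generalize transPos G call M R C D φ U = t₁ at h₁ hw
    rcases h₁ with ⟨χ, R₁, S₁, ha, he, h⟩ | ⟨v, R₁, S₁, η₁, he, hv, hη, hR, hl₁, h⟩
    · exact Simulates.abort_guard ha (.fst_abort ha he) h fun _ h => h
    · obtain ⟨w, w', rfl, hc, -, hty, -⟩ := Val.exists_pair_of_closed (hl₁.closed _ _ hv)
        ((hl₁.typed _ _ hv).trans hw.ret_ty)
      refine Simulates.return_value (.fst he) hη hR hl₁ hc hty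
        (Finset.union_subset_left (hl₁.meths _ _ hv)) fun ρ hρ hm => ⟨h ρ hρ.2 hm, ?_⟩
      have e := (h ρ hρ.2 hm).env _ _ hv
      have := Form.holds_eq_pv.mp ((Form.holds_guard.mp hρ.1).2 _ e)
      simpa [pv, Expr.eval, e, eq_comm] using this
  | @snd M θ₁ θ₂ hM' =>
    rw [transPos, ht]
    have h₁ := ih M (by simp only [Term.size]; omega) R C D φ U Θ _ ⟨hM', hv, hr⟩ henv η R₀ S hl
      hcov hms
    have hw := hwb M R C D φ U Θ _ ⟨hM', hv, hr⟩ henv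
    generalize transPos G call M R C D φ U = t₁ at h₁ hw
    rcases h₁ with ⟨χ, R₁, S₁, ha, he, h⟩ | ⟨v, R₁, S₁, η₁, he, hv, hη, hR, hl₁, h⟩
    · exact Simulates.abort_guard ha (.snd_abort ha he) h fun _ h => h
    · obtain ⟨w, w', rfl, -, hc, -, hty⟩ := Val.exists_pair_of_closed (hl₁.closed _ _ hv)
        ((hl₁.typed _ _ hv).trans hw.ret_ty)
      refine Simulates.return_value (.snd he) hη hR hl₁ hc hty
        (Finset.union_subset_right (hl₁.meths _ _ hv)) fun ρ hρ hm => ⟨h ρ hρ.2 hm, ?_⟩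
      have e := (h ρ hρ.2 hm).env _ _ hv
      have := Form.holds_eq_pv.mp ((Form.holds_guard.mp hρ.1).2 _ e)
      simpa [pv, Expr.eval, e, eq_comm] using this
  | @assign r M hM' =>
    rw [transPos]
    simp only [Term.refs, Finset.union_subset_iff, Finset.singleton_subset_iff] at hr
    have h₁ := ih M (by simp only [Term.size]; omega) R C D φ U Θ _ ⟨hM', hv, hr.2⟩ henv η R₀ S hl
      hcov hms
    have hw := hwb M R C D φ U Θ _ ⟨hM', hv, hr.2⟩ henv
    generalize transPos G call M R C D φ U = t₁ at h₁ hw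
    rcases h₁ with ⟨χ, R₁, S₁, ha, he, h⟩ | ⟨v, R₁, S₁, η₁, he, hv, hη, hR, hl₁, h⟩
    · exact Simulates.abort_guard ha (.assign_abort ha he) h fun _ h => h
    · have hl₂ := hl₁.insert_store hr.1 (hl₁.closed _ _ hv)
        ((hl₁.typed _ _ hv).trans hw.ret_ty) (hl₁.meths _ _ hv)
      refine Simulates.return_value (v := .unit) (.assign he) hη hR hl₂ rfl rfl
        (by simp [Val.meths]) fun ρ hρ hm => ?_
      have hm₁ := h ρ hρ.2 hm
      have e := hm₁.env _ _ hv
      obtain ⟨h₂, h₃⟩ := (Form.holds_guard.mp hρ.1).2 _ e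
      rw [Form.holds_eq_ssa] at h₃
      rw [Form.holds_eq_pv] at h₂
      refine ⟨⟨hm₁.env, fun r' w hr' => ?_⟩, (Option.some.inj h₂).symm⟩
      rw [lookup_insert_eq_ite] at hr'
      split_ifs at hr' with e'
      · subst e'
        cases hr'
        rw [← e]
        exact (Option.some.inj h₃).symm
      · rw [SSAMap.idx_insert, if_neg e']
        exact hm₁.store r' w hr'
  | @arith o M N hM' hN =>
    rw [transPos]
    simp only [Term.refs, Term.vars, Term.meths, Finset.union_subset_iff] at hr hv hms
    simp only [Term.fv, Subst.Covers.union] at hcov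
    have hM₁ : M.Admissible .int U Θ := ⟨hM', hv.1, hr.1⟩
    have h₁ := ih M (by simp only [Term.size]; omega) R C D φ U Θ _ hM₁ henv η R₀ S hl
      hcov.1 hms.1
    have hw := hwb M R C D φ U Θ _ hM₁ henv
    generalize transPos G call M R C D φ U = t₁ at h₁ hw
    have hN₁ : N.Admissible .int t₁.used Θ := ⟨hN, hv.2.trans hw.used, hr.2⟩
    have hw₂ := hwb N t₁.repo t₁.C t₁.D t₁.form t₁.used Θ _ hN₁ hw.env
    rcases h₁ with ⟨χ, R₁, S₁, ha, he, h⟩ | ⟨v, R₁, S₁, η₁, he, hv, hη, hR, hl₁, h⟩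
    · exact Simulates.abort_guard ha (.arith_abort₁ ha he) h (hw₂.form I)
    · obtain ⟨i, rfl⟩ := Val.exists_int_of_closed (hl₁.closed _ _ hv)
        ((hl₁.typed _ _ hv).trans hw.ret_ty)
      have h₂ := ih N (by simp only [Term.size]; omega) t₁.repo t₁.C t₁.D t₁.form t₁.used Θ _ hN₁
        hw.env η₁ R₁ S₁ hl₁ (hcov.2.mono hη subset_rfl) (hms.2.trans hR)
      rw [← Term.subst_extends hη hcov.2] at h₂
      generalize transPos G call N t₁.repo t₁.C t₁.D t₁.form t₁.used = t₂ at h₂ hw₂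
      rcases h₂ with ⟨χ, R₂, S₂, ha, he₂, h₂⟩ | ⟨v, R₂, S₂, η₂, he₂, hv₂, hη₂, hR₂, hl₂, h₂⟩
      · refine .abort χ R₂ S₂ ha (.arith_abort₂ ha he he₂) fun ρ hρ hm => ?_
        have hm₁ := h ρ (hw₂.form I ρ hρ.2) hm
        exact (Form.holds_guard.mp ((Form.holds_guard.mp hρ.1).2 _ (hm₁.env _ _ hv))).1 χ ha
          (h₂ ρ hρ.2 hm₁)
      · obtain ⟨j, rfl⟩ := Val.exists_int_of_closed (hl₂.closed _ _ hv₂)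
          ((hl₂.typed _ _ hv₂).trans hw₂.ret_ty)
        refine Simulates.return_value (v := .int (I o i j)) (.arith he he₂) (hη₂.trans hη)
          (hR.trans hR₂) hl₂ rfl rfl (by simp [Val.meths]) fun ρ hρ hm => ?_
        have hm₁ := h ρ (hw₂.form I ρ hρ.2) hm
        have hm₂ := h₂ ρ hρ.2 hm₁
        refine ⟨hm₂, ?_⟩
        have e₁ := hm₁.env _ _ hv
        have e₂ := hm₂.env _ _ hv₂
        have := Form.holds_eq_pv.mp
          ((Form.holds_guard.mp ((Form.holds_guard.mp hρ.1).2 _ e₁)).2 _ e₂)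
        simpa [pv, Expr.eval, e₁, e₂, eq_comm] using this
  | @pair M N θ₁ θ₂ hM' hN =>
    rw [transPos, hM'.ty_eq, hN.ty_eq]
    simp only [Term.refs, Term.vars, Term.meths, Finset.union_subset_iff] at hr hv hms
    simp only [Term.fv, Subst.Covers.union] at hcov
    have hM₁ : M.Admissible _ U Θ := ⟨hM', hv.1, hr.1⟩
    have h₁ := ih M (by simp only [Term.size]; omega) R C D φ U Θ _ hM₁ henv η R₀ S hl
      hcov.1 hms.1
    have hw := hwb M R C D φ U Θ _ hM₁ henv
    generalize transPos G call M R C D φ U = t₁ at h₁ hw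
    have hN₁ : N.Admissible _ t₁.used Θ := ⟨hN, hv.2.trans hw.used, hr.2⟩
    have hw₂ := hwb N t₁.repo t₁.C t₁.D t₁.form t₁.used Θ _ hN₁ hw.env
    rcases h₁ with ⟨χ, R₁, S₁, ha, he, h⟩ | ⟨v, R₁, S₁, η₁, he, hv, hη, hR, hl₁, h⟩
    · exact Simulates.abort_guard ha (.pair_abort₁ ha he) h (hw₂.form I)
    · have h₂ := ih N (by simp only [Term.size]; omega) t₁.repo t₁.C t₁.D t₁.form t₁.used Θ _ hN₁
        hw.env η₁ R₁ S₁ hl₁ (hcov.2.mono hη subset_rfl) (hms.2.trans hR)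
      rw [← Term.subst_extends hη hcov.2] at h₂
      generalize transPos G call N t₁.repo t₁.C t₁.D t₁.form t₁.used = t₂ at h₂ hw₂
      rcases h₂ with ⟨χ, R₂, S₂, ha, he₂, h₂⟩ | ⟨w, R₂, S₂, η₂, he₂, hv₂, hη₂, hR₂, hl₂, h₂⟩
      · refine .abort χ R₂ S₂ ha (.pair_abort₂ ha he he₂) fun ρ hρ hm => ?_
        have hm₁ := h ρ (hw₂.form I ρ hρ.2) hm
        exact (Form.holds_guard.mp ((Form.holds_guard.mp hρ.1).2 _ (hm₁.env _ _ hv))).1 χ ha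
          (h₂ ρ hρ.2 hm₁)
      · refine Simulates.return_value (v := .pair v w) (.pair he he₂) (hη₂.trans hη)
          (hR.trans hR₂) hl₂ ?_ ?_ ?_ fun ρ hρ hm => ?_
        · simp [Val.fv, hl₁.closed _ _ hv, hl₂.closed _ _ hv₂]
        · simp [Val.ty, hl₁.typed _ _ hv, hl₂.typed _ _ hv₂, hw.ret_ty, hw₂.ret_ty]
        · exact Finset.union_subset ((hl₁.meths _ _ hv).trans hR₂) (hl₂.meths _ _ hv₂)
        have hm₁ := h ρ (hw₂.form I ρ hρ.2) hm
        have hm₂ := h₂ ρ hρ.2 hm₁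
        refine ⟨hm₂, ?_⟩
        have e₁ := hm₁.env _ _ hv
        have e₂ := hm₂.env _ _ hv₂
        have := Form.holds_eq_pv.mp
          ((Form.holds_guard.mp ((Form.holds_guard.mp hρ.1).2 _ e₁)).2 _ e₂)
        simpa [pv, Expr.eval, e₁, e₂, eq_comm] using this
  | @letin x M N θ hM' hN =>
    rw [transPos, hN.ty_eq]
    simp only [Term.refs, Term.vars, Term.meths, Finset.union_subset_iff] at hr hv hms
    simp only [Term.fv, Subst.Covers.union] at hcov
    have hM₁ : M.Admissible _ U Θ := ⟨hM', hv.1.2, hr.1⟩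
    have hN₀ : N.Admissible θ U Θ := ⟨hN, hv.2, hr.2⟩
    have h₁ := ih M (by simp only [Term.size]; omega) R C D φ U Θ _ hM₁ henv η R₀ S hl
      hcov.1 hms.1
    have hw := hwb M R C D φ U Θ _ hM₁ henv
    generalize transPos G call M R C D φ U = t₁ at h₁ hw
    have hN₁ := (hN₀.mono hw.used).subst1_var hw.ret_mem hw.ret_ty
    have hw₂ := hwb _ t₁.repo t₁.C t₁.D t₁.form t₁.used Θ _ hN₁ hw.env
    rcases h₁ with ⟨χ, R₁, S₁, ha, he, h⟩ | ⟨v, R₁, S₁, η₁, he, hv, hη, hR, hl₁, h⟩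
    · exact Simulates.abort_guard ha (.letin_abort ha he) h (hw₂.form I)
    · obtain ⟨e, hc, hms'⟩ := hl₁.subst1_var hN₀ hcov.2 hms.2 hη hR hw.ret_fresh hw.ret_ty hv
      have h₂ := ih (N.subst1 x (.var t₁.ret))
        (by rw [Term.size_subst1_var]; simp only [Term.size]; omega)
        t₁.repo t₁.C t₁.D t₁.form t₁.used Θ _ hN₁ hw.env η₁ R₁ S₁ hl₁ hc hms'
      rw [e] at h₂
      generalize transPos G call (N.subst1 x (.var t₁.ret)) t₁.repo t₁.C t₁.D t₁.form t₁.used = t₂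
        at h₂ hw₂
      refine Simulates.tail h₂ hw₂.ret_ty (fun χ R'' S'' h => .letin he h) hη hR subset_rfl
        (fun _ _ h => h) fun ρ hρ hm => ?_
      have hm₁ := h ρ (hw₂.form I ρ hρ.2) hm
      exact ⟨hρ.2, hm₁, Form.holds_guard_copy
        ((Form.holds_guard.mp hρ.1).2 _ (hm₁.env _ _ hv)) Form.holds_eq_pv_pv.mp,
        fun _ _ _ _ => rfl⟩
  | @letrec f x M N θ' θ hf hM' hN =>
    rw [transPos]
    simp only [Term.refs, Term.vars, Term.meths, Finset.union_subset_iff,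
      Finset.insert_subset_iff, Finset.singleton_subset_iff] at hr hv hms
    simp only [Term.fv, Subst.Covers.union] at hcov
    have hm : G.meth R.keys x.ty M.ty ∉ R.keys := G.meth_fresh _ _ _
    have hty := G.meth_ty R.keys x.ty M.ty
    generalize G.meth R.keys x.ty M.ty = m at hm hty
    have hff := G.var_fresh U f.ty
    have hfty := G.var_ty U f.ty
    generalize G.var U f.ty = f' at hff hfty
    have hsU : U ⊆ insert f' U := Finset.subset_insert _ _
    have hsm : R₀.keys ⊆ insert m R₀.keys := Finset.subset_insert _ _
    have hmf : m.ty = f.ty := by rw [hty, hM'.ty_eq, hf]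
    -- the type of `f` is built from that of `x`
    have hxf : f ≠ x := by
      rintro rfl
      exact Ty.ne_arr_self _ _ hf
    have hN₀ : N.Admissible θ U Θ := ⟨hN, hv.2, hr.2⟩
    have hL : ((Lam.mk x M).subst1 f (.var f')).Admissible m (insert f' U) Θ := by
      refine Lam.Admissible.subst1_var ⟨?_, ?_, hr.1⟩ (Finset.mem_insert_self _ _) hfty
      · rw [hty, hM'.ty_eq]; exact .lam hM'
      · exact (Finset.union_subset (Finset.singleton_subset_iff.mpr hv.1.1.2) hv.1.2).trans hsU
    have hN₁ : (N.subst1 f (.var f')).Admissible θ (insert f' U) Θ :=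
      (hN₀.mono hsU).subst1_var (Finset.mem_insert_self _ _) hfty
    have henv₁ := (henv.mono hsU henv.keysC fun _ => le_rfl).insert_repo hL
    have hext : (η.set f' (.meth m)).Extends η := by
      intro y w hw
      rw [Subst.set, if_neg, hw]
      rintro rfl
      exact hff (hl.dom _ w hw)
    have hη₁ : ∀ y w, η.set f' (.meth m) y = some w →
        y ∈ insert f' U ∧ w.fv = ∅ ∧ w.ty = y.ty ∧ w.meths ⊆ insert m R₀.keys := by
      intro y w hw
      rcases Subst.set_eq_some hw with ⟨rfl, rfl⟩ | hw
      · exact ⟨Finset.mem_insert_self _ _, rfl, hmf.trans hfty.symm, by simp [Val.meths]⟩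
      · exact ⟨hsU (hl.dom y w hw), hl.closed y w hw, hl.typed y w hw,
          (hl.meths y w hw).trans hsm⟩
    have hself : η.set f' (.meth m) f' = some (.meth m) := Subst.set_self _ _ _
    have hmod : ∀ ρ : Valuation, Form.Holds I ρ (.and φ (.eq (pv f') (.meth m))) →
        ρ.Models η D S → ρ.Models (η.set f' (.meth m)) D S := fun ρ hρ hm =>
      hm.set (Option.some.inj (Form.holds_eq_pv.mp hρ.2)).symm
    generalize η.set f' (.meth m) = η₁ at hext hη₁ hself hmod
    have hLbody : (Lam.mk x M).subst1 f (.var f') = ⟨x, M.subst1 f (.var f')⟩ := by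
      simp only [Lam.subst1, Lam.subst, Subst.drop_single hxf, Term.subst1]
    have hf'x : f' ≠ x := by
      rintro rfl
      exact hff hv.1.1.2
    have hl₁ := hl.insert_repo (m := m) (L := (Lam.mk x M).subst1 f (.var f')) hext hη₁
      (by
        rw [hLbody]
        intro z hz
        obtain ⟨hzx, hz⟩ := Finset.mem_erase.mp hz
        rcases Finset.mem_insert.mp (Term.fv_subst1_var_subset M f f' hz) with rfl | hz
        · exact ⟨_, hself⟩
        · obtain ⟨hzf, hz⟩ := Finset.mem_erase.mp hz
          exact (hcov.1 z (by simp [hzf, hzx, hz])).imp (hext z))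
      (Lam.meths_subst1_subset (hms.1.trans hsm) (by simp [Val.meths]))
    -- the method that the run stores is the instance of the one stored by the translation
    have hstored : ((Lam.mk x M).subst1 f (.var f')).subst η₁ =
        (Lam.mk x (M.subst ((η.drop f).drop x))).subst1 f (.meth m) := by
      rw [hLbody]
      simp only [Lam.subst1, Lam.subst, Subst.drop_single hxf, Lam.mk.injEq, true_and]
      rw [Subst.drop_comm]
      refine Term.subst1_var_subst (s := η.drop x) hM' (fun h => hff (hv.1.2 h)) hfty ?_ ?_ ?_ ?_
      · exact Subst.drop_eq_some.mpr ⟨hf'x, hself⟩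
      · exact Subst.Typed.drop (fun y w hw => (hη₁ y w hw).2.2.1) x
      · exact fun y w hw => (hη₁ y w (Subst.drop_eq_some.mp hw).2).2.1
      · intro z hz hzf
        refine Subst.drop_congr fun hzx => ?_
        exact hext.eq_of_covers hcov.1 z (by simp [hzf, hzx, hz])
    rw [hstored] at hl₁
    obtain ⟨e, hc, hms'⟩ := hl₁.subst1_var hN₀ hcov.2 hms.2 hext
      (by rw [keys_insert]; exact hsm) hff hfty hself
    have h := ih (N.subst1 f (.var f'))
      (by rw [Term.size_subst1_var]; simp only [Term.size]; omega) _ _ _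
      (.and φ (.eq (pv f') (.meth m))) (insert f' U) Θ _ hN₁ henv₁ η₁ _ S hl₁ hc hms'
    have hw := hwb (N.subst1 f (.var f')) _ _ _
      (.and φ (.eq (pv f') (.meth m))) (insert f' U) Θ _ hN₁ henv₁
    rw [e] at h
    have hmR₀ : m ∉ R₀ := fun h => hm (hl.keys_subset (Finmap.mem_keys.mpr h))
    rcases h with ⟨χ, R₁, S₁, ha, he, h⟩ | ⟨v, R₁, S₁, η₂, he, hv, hη₂, hR, hl₂, h⟩
    · exact .abort χ R₁ S₁ ha (.letrec hmR₀ hmf he) fun ρ hρ hm =>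
        h ρ hρ (hmod ρ (hw.form I ρ hρ) hm)
    · rw [keys_insert] at hR
      exact .value v R₁ S₁ η₂ (.letrec hmR₀ hmf he) hv (hη₂.trans hext) (hsm.trans hR) hl₂
        fun ρ hρ hm => h ρ hρ (hmod ρ (hw.form I ρ hρ) hm)
  | @appMeth m M hM' =>
    rw [transPos]
    simp only [Term.vars, Term.meths, Finset.union_subset_iff, Finset.singleton_subset_iff]
      at hv hms
    have hM₁ : M.Admissible _ U Θ := ⟨hM', hv, hr⟩
    have h₁ := ih M (by simp only [Term.size]; omega) R C D φ U Θ _ hM₁ henv η R₀ S hl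
      hcov hms.2
    have hw := hwb M R C D φ U Θ _ hM₁ henv
    obtain ⟨L₀, hL₀⟩ := (mem_keys_iff_lookup _ _).mp hms.1
    obtain ⟨L, hL, rfl, hcovL, hmsL⟩ := hl.repo m L₀ hL₀
    generalize transPos G call M R C D φ U = t₁ at h₁ hw
    rw [hL]
    have hLa := henv.repo m L hL
    have hN₁ := ((hLa.mono hw.used).body).subst1_var hw.ret_mem
      (hw.ret_ty.trans hLa.param_ty.symm)
    have hw₂ := hcall _ t₁.repo t₁.C t₁.D t₁.form t₁.used Θ _ hN₁ hw.env
    rcases h₁ with ⟨χ, R₁, S₁, ha, he, h⟩ | ⟨v, R₁, S₁, η₁, he, hv, hη, hR, hl₁, h⟩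
    · exact Simulates.abort_guard ha (.app_abort ha he) h (hw₂.form I)
    · obtain ⟨e, hc, hms'⟩ := hl₁.subst1_var hLa.body hcovL hmsL hη hR hw.ret_fresh
        (hw.ret_ty.trans hLa.param_ty.symm) hv
      have h₂ := hs (L.body.subst1 L.param (.var t₁.ret))
        t₁.repo t₁.C t₁.D t₁.form t₁.used Θ _ hN₁ hw.env η₁ R₁ S₁ hl₁ hc hms'
      rw [e] at h₂
      dsimp only
      generalize call (L.body.subst1 L.param (.var t₁.ret)) t₁.repo t₁.C t₁.D t₁.form t₁.used = t₂
        at h₂ hw₂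
      refine Simulates.tail h₂ hw₂.ret_ty (fun χ R'' S'' h => .app hL₀ he h) hη hR subset_rfl
        (fun _ _ h => h) fun ρ hρ hm => ?_
      have hm₁ := h ρ (hw₂.form I ρ hρ.2) hm
      exact ⟨hρ.2, hm₁, Form.holds_guard_copy
        ((Form.holds_guard.mp hρ.1).2 _ (hm₁.env _ _ hv)) Form.holds_eq_pv_pv.mp,
        fun _ _ _ _ => rfl⟩
  | @ite M M₁ M₀ θ hM' hM₁ hM₀ =>
    rw [transPos, hM₁.ty_eq]
    simp only [Term.refs, Term.vars, Term.meths, Finset.union_subset_iff] at hr hv hms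
    simp only [Term.fv, Subst.Covers.union] at hcov
    have hMa : M.Admissible _ U Θ := ⟨hM', hv.1.1, hr.1.1⟩
    have hb := ih M (by simp only [Term.size]; omega) R C D φ U Θ _ hMa henv η R₀ S hl
      hcov.1.1 hms.1.1
    have hwb' := hwb M R C D φ U Θ _ hMa henv
    generalize transPos G call M R C D φ U = tb at hb hwb'
    have hM₀a : M₀.Admissible θ tb.used Θ := ⟨hM₀, hv.2.trans hwb'.used, hr.2⟩
    have hw₀ := hwb M₀ tb.repo tb.C tb.D tb.form tb.used Θ _ hM₀a hwb'.env
    have ih₀ := ih M₀ (by simp only [Term.size]; omega) tb.repo tb.C tb.D tb.form tb.used Θ _ hM₀a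
      hwb'.env
    generalize transPos G call M₀ tb.repo tb.C tb.D tb.form tb.used = t₀ at hw₀ ih₀
    have hM₁a : M₁.Admissible θ t₀.used Θ := ⟨hM₁, (hv.1.2.trans hwb'.used).trans hw₀.used, hr.1.2⟩
    have henv₁ : TransEnv t₀.repo t₀.C tb.D t₀.used Θ :=
      ⟨hw₀.env.repo, hw₀.env.keysC, hwb'.env.keysD,
        fun r => (hwb'.env.idx_le r).trans (hw₀.idx r)⟩
    have hw₁ := hwb M₁ t₀.repo t₀.C tb.D t₀.form t₀.used Θ _ hM₁a henv₁
    have ih₁ := ih M₁ (by simp only [Term.size]; omega) t₀.repo t₀.C tb.D t₀.form t₀.used Θ _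
      hM₁a henv₁
    generalize transPos G call M₁ t₀.repo t₀.C tb.D t₀.form t₀.used = t₁ at hw₁ ih₁
    have hk : t₁.C.bumpAll.keys = Θ := t₁.C.keys_bumpAll.trans hw₁.env.keysC
    rcases hb with ⟨χ, R₁, S₁, ha, he, h⟩ | ⟨v, R₁, S₁, η₁, he, hv, hη, hR, hl₁, h⟩
    · exact Simulates.abort_guard ha (.ite_abort ha he) h
        fun ρ h => hw₀.form I ρ (hw₁.form I ρ h)
    · obtain ⟨i, rfl⟩ := Val.exists_int_of_closed (hl₁.closed _ _ hv)
        ((hl₁.typed _ _ hv).trans hwb'.ret_ty)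
      -- The formula of the first branch is implied by that of the second one. The latter is
      -- translated in the state reached by the first one, but it reads the store from `tb.D`.
      by_cases hi : i = 0
      · have h₂ := ih₀ η₁ R₁ S₁ hl₁ (hcov.2.mono hη subset_rfl) (hms.2.trans hR)
        rw [← Term.subst_extends hη hcov.2] at h₂
        refine Simulates.tail h₂ hw₀.ret_ty
          (fun χ R'' S'' h => .ite he (by rw [if_pos hi]; exact h)) hη hR hw₁.used hw₁.repo
          fun ρ hρ hm => ?_
        have hf := hw₁.form I ρ hρ.2
        have hm₁ := h ρ (hw₀.form I ρ hf) hm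
        have e := hm₁.env _ _ hv
        have hψ := ((Form.holds_guard.mp hρ.1).2 _ e).1
          (Form.holds_eq_pv.mpr (by rw [e, hi]; rfl))
        refine ⟨hf, hm₁, Form.holds_guard_copy hψ fun h => Form.holds_eq_pv_pv.mp h.1,
          fun w hw r hr => ?_⟩
        exact SSAMap.holds_join.mp ((Form.holds_guard.mp hψ).2 w hw).2 r (hk ▸ hr)
      · have h₂ := ih₁ η₁ R₁ S₁ (hl₁.mono hw₀.used hw₀.repo) (hcov.1.2.mono hη subset_rfl)
          (hms.1.2.trans hR)
        rw [← Term.subst_extends hη hcov.1.2] at h₂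
        refine Simulates.tail h₂ hw₁.ret_ty
          (fun χ R'' S'' h => .ite he (by rw [if_neg hi]; exact h)) hη hR subset_rfl
          (fun _ _ h => h) fun ρ hρ hm => ?_
        have hm₁ := h ρ (hw₀.form I ρ (hw₁.form I ρ hρ.2)) hm
        have e := hm₁.env _ _ hv
        have hψ := ((Form.holds_guard.mp hρ.1).2 _ e).2 (fun h' => by
          have := Form.holds_eq_pv.mp h'
          rw [e] at this
          simp only [Expr.eval, Option.some.injEq, Outcome.val.injEq, Val.int.injEq] at this
          exact hi this.symm)
        refine ⟨hρ.2, hm₁, Form.holds_guard_copy hψ fun h => Form.holds_eq_pv_pv.mp h.1,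
          fun w hw r hr => ?_⟩
        exact SSAMap.holds_join.mp ((Form.holds_guard.mp hψ).2 w hw).2 r (hk ▸ hr)
  | @appVar x M θ' θ hx hM' =>
    rw [transPos, ht]
    simp only [Term.vars, Finset.union_subset_iff] at hv
    simp only [Term.fv, Subst.Covers.union] at hcov
    obtain ⟨w, hw⟩ := hcov.1 x (Finset.mem_singleton_self x)
    -- the function is a method that exists when the application is translated
    obtain ⟨m, rfl, rfl, rfl⟩ :=
      Val.exists_meth_of_closed (hl.closed x w hw) ((hl.typed x w hw).trans hx)
    have hmR₀ : m ∈ R₀.keys := hl.meths x _ hw (by simp [Val.meths])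
    rw [Term.subst_appVar, hw]
    have hMa : M.Admissible _ U Θ := ⟨hM', hv.2, hr⟩
    have h₁ := ih M (by simp only [Term.size]; omega) R C D φ U Θ _ hMa henv η R₀ S hl
      hcov.2 hms
    have hw₁ := hwb M R C D φ U Θ _ hMa henv
    generalize transPos G call M R C D φ U = t₀ at h₁ hw₁
    obtain ⟨L₀, hL₀⟩ := (mem_keys_iff_lookup _ _).mp hmR₀
    obtain ⟨L, hL, rfl, hcovL, hmsL⟩ := hl.repo m L₀ hL₀
    have hLa := henv.repo m L hL
    obtain ⟨hend, hspec⟩ := callAll_spec hcall (R := R) (ret₀ := t₀.ret) (D₀ := t₀.D)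
      (Repo.restrict R x.ty)
      t₀ hw₁.env hw₁.env.keysD hw₁.env.idx_le hw₁.ret_mem
      (fun m L h => (henv.repo m L h).mono hw₁.used) (fun m' hm' => by
        have := (Repo.mem_restrict.mp hm').2
        rw [hx] at this
        rw [hw₁.ret_ty]
        exact (Ty.arr.inj this).1)
    obtain ⟨t, hmem⟩ := exists_mem_callAll (call := call) (ret₀ := t₀.ret) (D₀ := t₀.D) hL
      (Repo.restrict R x.ty) (Repo.mem_restrict.mpr ⟨mem_keys_of_lookup hL, by rw [hx]; rfl⟩)
      t₀.repo t₀.C t₀.form t₀.used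
    -- `t` is the translation of the call of `m`, in the state `t'` reached after earlier calls
    obtain ⟨-, L', t', hspec⟩ := hspec _ hmem
    have hLL : L = L' := Option.some.inj (hL.symm.trans hspec.lookup)
    subst hLL
    unfold callEnd at hend hspec
    rcases hg : (callAll call R t₀.ret t₀.D (Repo.restrict R x.ty) t₀.repo t₀.C t₀.form
      t₀.used).getLast? with _ | ⟨m', tₙ⟩
    · rw [List.getLast?_eq_none_iff] at hg
      rw [hg] at hmem
      simp at hmem
    rw [hg] at hend hspec
    simp only [Option.map_some, Option.getD_some] at hend hspec
    have hk : tₙ.C.bumpAll.keys = Θ := tₙ.C.keys_bumpAll.trans hend.env.keysC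
    simp only [Option.getD_some, Val.applyHead]
    rcases h₁ with ⟨χ, R₁, S₁, ha, he, h⟩ | ⟨v, R₁, S₁, η₁, he, hv, hη, hR, hl₁, h⟩
    · exact Simulates.abort_guard ha (.app_abort ha he) h (hend.form I)
    · obtain ⟨e, hc, hms'⟩ := hl₁.subst1_var hLa.body hcovL hmsL hη hR hw₁.ret_fresh
        (hw₁.ret_ty.trans hLa.param_ty.symm) hv
      have h₂ := hs _ t'.repo t'.C t₀.D t'.form t'.used Θ _ hspec.adm hspec.env η₁ R₁ S₁
        (hl₁.mono hspec.ext.used hspec.ext.repo) hc hms'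
      rw [e, ← hspec.eq] at h₂
      refine Simulates.tail h₂ hspec.spec.ret_ty (fun χ R'' S'' h => .app hL₀ he h) hη hR
        hspec.last.used hspec.last.repo fun ρ hρ hm => ?_
      have hm₁ := h ρ (hend.form I ρ hρ.2) hm
      have e := hm₁.env _ _ hv
      have hψ := Form.holds_conj.mp ((Form.holds_guard.mp hρ.1).2 _ e) _
        (List.mem_map.mpr ⟨_, hmem, rfl⟩)
        (Form.holds_eq_pv.mpr (by rw [hm.env x _ hw]; rfl))
      refine ⟨hspec.last.form I ρ hρ.2, hm₁,
        Form.holds_guard_copy hψ.1 Form.holds_eq_pv_pv.mp, fun w hw r hr => ?_⟩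
      exact SSAMap.holds_join.mp hψ.2 r (hk ▸ hr)

end Soundness

/-! ### Satisfiability of the formulas of the translation -/

section Satisfiability

variable {Op : Type u} {I : Op → ℤ → ℤ → ℤ}

/-- If the outcome is a value, then it is a closed one of type `θ`. -/
def Outcome.HasTy (o : Outcome) (θ : Ty) : Prop := ∀ v, o = .val v → v.fv = ∅ ∧ v.ty = θ

theorem Outcome.Aborts.hasTy {o : Outcome} (h : o.Aborts) (θ : Ty) : o.HasTy θ := by
  rintro v rfl
  exact h.elim

theorem Outcome.hasTy_fail (θ : Ty) : Outcome.fail.HasTy θ := by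
  rintro v ⟨⟩

theorem Outcome.hasTy_nil (θ : Ty) : Outcome.nil.HasTy θ := by
  rintro v ⟨⟩

theorem Outcome.hasTy_val {v : Val} {θ : Ty} (h : v.fv = ∅) (h' : v.ty = θ) :
    (Outcome.val v).HasTy θ := by
  rintro w ⟨⟩
  exact ⟨h, h'⟩

theorem Valuation.Proper.hasTy {ρ : Valuation} (h : ρ.Proper) (x : FVar) :
    (ρ x).HasTy x.ty := fun v hv => h x v hv

/-- The valuation `ρ'` agrees with `ρ` at the program variables in `U` and at the SSA variables
bounded by `C`. -/
structure Valuation.Agree (U : Finset Var) (C : SSAMap) (ρ ρ' : Valuation) : Prop where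
  prog : ∀ x ∈ U, ρ' (.prog x) = ρ (.prog x)
  ssa : ∀ r i, i ≤ C.idx r → ρ' (.ssa r i) = ρ (.ssa r i)

/-- The formula holds at `ρ`, whatever the values of the variables not used so far. -/
def Form.Stable (I : Op → ℤ → ℤ → ℤ) (φ : Form Op) (U : Finset Var) (C : SSAMap)
    (ρ : Valuation) : Prop :=
  ∀ ρ' : Valuation, Valuation.Agree U C ρ ρ' → φ.Holds I ρ'

/-- Some values of the variable `ret` and of the SSA variables between `C` and `C'` make `ψ` true,
given the values that `ρ` assigns to the variables used so far. -/
def Form.Fillable (I : Op → ℤ → ℤ → ℤ) (ψ : Form Op) (U : Finset Var) (C C' : SSAMap) (ret : Var)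
    (ρ : Valuation) : Prop :=
  ∃ (o : Outcome) (g : Ref → Outcome), o.HasTy ret.ty ∧ (∀ r, (g r).HasTy r.ty) ∧
    ∀ ρ' : Valuation, Valuation.Agree U C ρ ρ' → ρ' (.prog ret) = o →
      (∀ r i, C.idx r < i → i ≤ C'.idx r → ρ' (.ssa r i) = g r) → ψ.Holds I ρ'

/-- The valuation `ρ` can be changed at unused variables so that the formula of the result `t`
becomes true. -/
def Result.Satisfiable (I : Op → ℤ → ℤ → ℤ) (t : Result Op) (U : Finset Var) (C : SSAMap)
    (ρ : Valuation) : Prop :=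
  ∃ ρ' : Valuation, ρ'.Proper ∧ Valuation.Agree U C ρ ρ' ∧ t.form.Stable I t.used t.C ρ'

/-- The translator only adds satisfiable constraints on fresh variables. -/
def Translator.Conservative (I : Op → ℤ → ℤ → ℤ) (T : Translator Op) : Prop :=
  ∀ M R C D φ U Θ θ, Term.Admissible M θ U Θ → TransEnv R C D U Θ →
    ∀ ρ : Valuation, ρ.Proper → φ.Stable I U C ρ → (T M R C D φ U).Satisfiable I U C ρ

theorem Valuation.Agree.refl (U : Finset Var) (C : SSAMap) (ρ : Valuation) :
    Valuation.Agree U C ρ ρ := ⟨fun _ _ => rfl, fun _ _ _ => rfl⟩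

theorem Valuation.Agree.trans {U U' : Finset Var} {C C' : SSAMap} {ρ ρ' ρ'' : Valuation}
    (h : Valuation.Agree U C ρ ρ') (h' : Valuation.Agree U' C' ρ' ρ'') (hU : U ⊆ U')
    (hC : ∀ r, C.idx r ≤ C'.idx r) : Valuation.Agree U C ρ ρ'' :=
  ⟨fun x hx => (h'.prog x (hU hx)).trans (h.prog x hx),
    fun r i hi => (h'.ssa r i (hi.trans (hC r))).trans (h.ssa r i hi)⟩

theorem Form.Stable.mono {φ : Form Op} {U U' : Finset Var} {C C' : SSAMap} {ρ ρ' : Valuation}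
    (h : φ.Stable I U C ρ) (h' : Valuation.Agree U C ρ ρ') (hU : U ⊆ U')
    (hC : ∀ r, C.idx r ≤ C'.idx r) : φ.Stable I U' C' ρ' :=
  fun ρ'' h'' => h ρ'' (h'.trans h'' hU hC)

/-- The fresh variables can be given the values that make the constraint true. -/
theorem Form.Fillable.exists_valuation {ψ : Form Op} {U : Finset Var} {C C' : SSAMap} {ret : Var}
    {ρ : Valuation} (h : ψ.Fillable I U C C' ret ρ) (hρ : ρ.Proper) (hret : ret ∉ U)
    (hC : ∀ r, C.idx r ≤ C'.idx r) :
    ∃ ρ' : Valuation, ρ'.Proper ∧ Valuation.Agree U C ρ ρ' ∧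
      ψ.Stable I (insert ret U) C' ρ' := by
  obtain ⟨o, g, ho, hg, h⟩ := h
  let ρ' : Valuation := fun
    | .prog x => if x = ret then o else ρ (.prog x)
    | .ssa r i => if i ≤ C.idx r then ρ (.ssa r i) else g r
  have hag : Valuation.Agree U C ρ ρ' := by
    refine ⟨fun x hx => if_neg ?_, fun r i hi => if_pos hi⟩
    rintro rfl
    exact hret hx
  refine ⟨ρ', ?_, hag, fun ρ'' h'' => h ρ'' (hag.trans h'' (Finset.subset_insert _ _) hC) ?_ ?_⟩
  · rintro (x | ⟨r, i⟩) v hv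
    · by_cases hx : x = ret
      · simp only [ρ', if_pos hx] at hv
        exact hx ▸ ho v hv
      · simp only [ρ', if_neg hx] at hv
        exact hρ _ v hv
    · by_cases hi : i ≤ C.idx r
      · simp only [ρ', if_pos hi] at hv
        exact hρ _ v hv
      · simp only [ρ', if_neg hi] at hv
        exact hg r v hv
  · rw [h''.prog ret (Finset.mem_insert_self _ _)]
    exact if_pos rfl
  · intro r i hi hi'
    rw [h''.ssa r i hi']
    exact if_neg (not_le.mpr hi)

/-- The last step of a construct, which adds the constraint `ψ` on a fresh return variable. -/
theorem Result.Satisfiable.finish {t : Result Op} {G : FreshGen} {θ : Ty} {R R' : Repo Op}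
    {C₀ C' D' : SSAMap} {φ : Form Op} {U₀ : Finset Var} {Θ : Finset Ref} {ψ : Form Op}
    {ρ : Valuation} (h : t.Satisfiable I U₀ C₀ ρ) (hw : TransExt t R C₀ φ U₀ Θ)
    (hC : ∀ r, t.C.idx r ≤ C'.idx r)
    (hψ : ∀ ρ' : Valuation, ρ'.Proper → ψ.Fillable I t.used t.C C' (G.var t.used θ) ρ') :
    Result.Satisfiable I
      ⟨G.var t.used θ, .and ψ t.form, R', C', D', insert (G.var t.used θ) t.used⟩ U₀ C₀ ρ := by
  obtain ⟨ρ₁, hρ₁, hag₁, hst₁⟩ := h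
  obtain ⟨ρ₂, hρ₂, hag₂, hst₂⟩ := (hψ ρ₁ hρ₁).exists_valuation hρ₁ (G.var_fresh _ _) hC
  exact ⟨ρ₂, hρ₂, hag₁.trans hag₂ hw.used hw.idx, fun ρ' h' =>
    ⟨hst₂ ρ' h', hst₁.mono hag₂ (Finset.subset_insert _ _) hC ρ' h'⟩⟩

theorem Form.Fillable.mono {ψ ψ' : Form Op} {U : Finset Var} {C C' : SSAMap} {ret : Var}
    {ρ : Valuation} (h : ψ.Fillable I U C C' ret ρ)
    (h' : ∀ ρ' : Valuation, Valuation.Agree U C ρ ρ' → ψ.Holds I ρ' → ψ'.Holds I ρ') :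
    ψ'.Fillable I U C C' ret ρ := by
  obtain ⟨o, g, ho, hg, h⟩ := h
  exact ⟨o, g, ho, hg, fun ρ' h₁ h₂ h₃ => h' ρ' h₁ (h ρ' h₁ h₂ h₃)⟩

/-- If `a` aborts, then the return variable is given the same value, and the new SSA variables are
unconstrained. -/
theorem Form.Fillable.guard {ψ : Form Op} {U : Finset Var} {C C' : SSAMap} {a ret : Var}
    {ρ : Valuation} (ha : a ∈ U)
    (h : ∀ v, ρ (.prog a) = .val v → ψ.Fillable I U C C' ret ρ) :
    (Form.guard (pv a) (pv ret) ψ).Fillable I U C C' ret ρ := by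
  by_cases hv : ∃ v, ρ (.prog a) = .val v
  · obtain ⟨v, hv⟩ := hv
    refine (h v hv).mono fun ρ' hρ' hψ => Form.holds_guard.mpr ⟨fun χ hχ e => ?_, fun _ _ => hψ⟩
    rw [hρ'.prog a ha, hv] at e
    exact (e ▸ hχ : Outcome.Aborts (.val v)).elim
  · have hab : (ρ (.prog a)).Aborts := by
      rcases h' : ρ (.prog a) with v | _ | _
      · exact (hv ⟨v, h'⟩).elim
      · trivial
      · trivial
    refine ⟨ρ (.prog a), fun _ => .fail, hab.hasTy _, fun r => ?_, fun ρ' hρ' hret _ => ?_⟩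
    · exact Outcome.hasTy_fail _
    · rw [Form.holds_guard, hρ'.prog a ha, hret]
      exact ⟨fun _ _ h => h, fun v hv' => (hv ⟨v, hv'⟩).elim⟩

theorem Form.Fillable.eq {e : Expr Op} {U : Finset Var} {C C' : SSAMap} {ret : Var}
    {ρ : Valuation} {o : Outcome} (ho : o.HasTy ret.ty)
    (h : ∀ ρ' : Valuation, Valuation.Agree U C ρ ρ' → e.eval I ρ' = some o) :
    (Form.eq (pv ret) e).Fillable I U C C' ret ρ :=
  ⟨o, fun _ => .fail, ho, fun _ => Outcome.hasTy_fail _, fun ρ' hρ' hret _ =>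
    Form.holds_eq_pv.mpr (by rw [h ρ' hρ', hret])⟩

/-- The return variable copies the variable `a`, and the new SSA variables copy those of `D`. -/
theorem Form.Fillable.copy {ψ : Form Op} {U : Finset Var} {C C' D : SSAMap} {a ret : Var}
    {ρ : Valuation} (hρ : ρ.Proper) (ha : a ∈ U) (hty : a.ty = ret.ty)
    (hD : ∀ r, D.idx r ≤ C.idx r)
    (h : ∀ ρ' : Valuation, Valuation.Agree U C ρ ρ' → ρ' (.prog ret) = ρ' (.prog a) →
      (∀ r, C.idx r < C'.idx r → ρ' (.ssa r (C'.idx r)) = ρ' (.ssa r (D.idx r))) →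
      ψ.Holds I ρ') :
    ψ.Fillable I U C C' ret ρ := by
  refine ⟨ρ (.prog a), fun r => ρ (.ssa r (D.idx r)), hty ▸ hρ.hasTy (.prog a),
    fun r => hρ.hasTy (.ssa r _), fun ρ' hρ' hret hg => h ρ' hρ' ?_ fun r hr => ?_⟩
  · rw [hret, hρ'.prog a ha]
  · rw [hg r _ hr le_rfl, hρ'.ssa r _ (hD r)]

theorem Form.holds_guard_of_copy {ρ : Valuation} {a b : Var} {ψ : Form Op}
    (h : ρ (.prog b) = ρ (.prog a)) (hψ : ψ.Holds I ρ) :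
    (Form.guard (pv a) (pv b) ψ).Holds I ρ :=
  Form.holds_guard.mpr ⟨fun _ _ e => h.trans e, fun _ _ => hψ⟩

theorem SSAMap.idx_lt_bumpAll {C : SSAMap} {r : Ref} (h : r ∈ C.keys) :
    C.idx r < C.bumpAll.idx r := by
  rw [SSAMap.idx_bumpAll, if_pos h]
  exact Nat.lt_succ_self _

theorem SSAMap.holds_join_bumpAll {C D : SSAMap} {ρ : Valuation}
    (h : ∀ r, C.idx r < C.bumpAll.idx r →
      ρ (.ssa r (C.bumpAll.idx r)) = ρ (.ssa r (D.idx r))) :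
    (C.bumpAll.join D : Form Op).Holds I ρ :=
  SSAMap.holds_join.mpr fun r hr => h r (SSAMap.idx_lt_bumpAll (C.keys_bumpAll ▸ hr))

theorem Result.Satisfiable.refl {φ : Form Op} {U : Finset Var} {C D : SSAMap} {R : Repo Op}
    {ret : Var} {ρ : Valuation} (hρ : ρ.Proper) (h : φ.Stable I U C ρ) :
    Result.Satisfiable I ⟨ret, φ, R, C, D, U⟩ U C ρ :=
  ⟨ρ, hρ, .refl _ _ _, h⟩

theorem Result.Satisfiable.retExpr {G : FreshGen} {θ : Ty} {e : Expr Op} {φ : Form Op}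
    {U : Finset Var} {C D : SSAMap} {R : Repo Op} {ρ : Valuation} {Θ : Finset Ref}
    (henv : TransEnv R C D U Θ) (hρ : ρ.Proper) (h : φ.Stable I U C ρ)
    (he : ∀ ρ' : Valuation, ρ'.Proper → ∃ o : Outcome, o.HasTy θ ∧
      ∀ ρ'' : Valuation, Valuation.Agree U C ρ' ρ'' → e.eval I ρ'' = some o) :
    (HORef.retExpr G θ e R C D φ U).Satisfiable I U C ρ := by
  refine (Result.Satisfiable.refl hρ h).finish (G := G) (henv.refl_ext φ (G.var U θ))
    (fun _ => le_rfl) fun ρ' hρ' => ?_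
  obtain ⟨o, ho, h'⟩ := he ρ' hρ'
  exact .eq ((G.var_ty U θ).symm ▸ ho) h'

theorem Result.Satisfiable.trans {t t' : Result Op} {U : Finset Var} {C : SSAMap} {ρ : Valuation}
    {R : Repo Op} {φ : Form Op} {Θ : Finset Ref} (h : t.Satisfiable I U C ρ)
    (hw : TransExt t R C φ U Θ)
    (h' : ∀ ρ' : Valuation, ρ'.Proper → t.form.Stable I t.used t.C ρ' →
      t'.Satisfiable I t.used t.C ρ') : t'.Satisfiable I U C ρ := by
  obtain ⟨ρ₁, hρ₁, hag₁, hst₁⟩ := h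
  obtain ⟨ρ₂, hρ₂, hag₂, hst₂⟩ := h' ρ₁ hρ₁ hst₁
  exact ⟨ρ₂, hρ₂, hag₁.trans hag₂ hw.used hw.idx, hst₂⟩

theorem conservative_transNil (G : FreshGen) : (transNil G : Translator Op).Conservative I := by
  intro M R C D φ U Θ θ hM henv ρ hρ hst
  exact Result.Satisfiable.retExpr henv hρ hst fun ρ' _ =>
    ⟨.nil, Outcome.hasTy_nil _, fun _ _ => rfl⟩

/-- Successive calls add satisfiable constraints, whichever of them the run makes. -/
theorem callAll_satisfiable {call : Translator Op} (hcall : call.WellBehaved)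
    (hcons : call.Conservative I) {R : Repo Op} {ret₀ : Var}
    {D₀ : SSAMap} {Θ : Finset Ref} : ∀ (ms : List Meth) (t : Result Op),
    TransEnv t.repo t.C t.D t.used Θ → D₀.keys = Θ → (∀ r, D₀.idx r ≤ t.C.idx r) →
    ret₀ ∈ t.used → (∀ m L, R.lookup m = some L → L.Admissible m t.used Θ) →
    (∀ m ∈ ms, m.dom = ret₀.ty) → ∀ ρ : Valuation, ρ.Proper → t.form.Stable I t.used t.C ρ →
    (callEnd t (callAll call R ret₀ D₀ ms t.repo t.C t.form t.used)).Satisfiable I t.used t.C ρ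
  | [], t, henv, _, _, _, _, _, ρ, hρ, hst => Result.Satisfiable.refl hρ hst
  | m :: ms, t, henv, hk, hle, hret, hR, hms, ρ, hρ, hst => by
    rw [callAll]
    rcases hm : R.lookup m with _ | L
    · exact callAll_satisfiable hcall hcons ms t henv hk hle hret hR
        (fun m hm => hms m (List.mem_cons_of_mem _ hm)) ρ hρ hst
    · have hL := hR m L hm
      have hadm := hL.body.subst1_var hret
        ((hms m List.mem_cons_self).symm.trans hL.param_ty.symm)
      have henv₀ : TransEnv t.repo t.C D₀ t.used Θ := ⟨henv.repo, henv.keysC, hk, hle⟩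
      have hs := hcall _ t.repo t.C D₀ t.form t.used Θ _ hadm henv₀
      have hc := hcons _ t.repo t.C D₀ t.form t.used Θ _ hadm henv₀ ρ hρ hst
      dsimp only
      rw [callEnd_cons]
      generalize call (L.body.subst1 L.param (.var ret₀)) t.repo t.C D₀ t.form t.used = t₁
        at hs hc
      exact hc.trans hs.toTransExt (callAll_satisfiable hcall hcons ms t₁ hs.env hk
        (fun r => (hle r).trans (hs.idx r)) (hs.used hret)
        (fun m L h => (hR m L h).mono hs.used) fun m hm => hms m (List.mem_cons_of_mem _ hm))

/-- Every construct constrains its fresh return variable, and its fresh SSA variables, by equations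
with older variables that have a solution: the expressions are defined because the older variables
have values of the right types, or else the guard is on. -/
theorem conservative_transPos (G : FreshGen) {call : Translator Op} (hcall : call.WellBehaved)
    (hcons : call.Conservative I) : (transPos G call).Conservative I := by
  intro M
  induction M using Term.size_induction with
  | h M ih =>
  intro R C D φ U Θ θ hM henv ρ hρ hst
  have ht := hM.typed.ty_eq
  have hv := hM.vars
  have hr := hM.refs
  have hwb := wellBehaved_transPos G hcall
  cases hM.typed with
  | fail θ =>
    rw [transPos]
    exact .retExpr henv hρ hst fun ρ' _ =>
      ⟨.fail, Outcome.hasTy_fail _, fun _ _ => rfl⟩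
  | var x =>
    rw [transPos]
    refine .retExpr henv hρ hst fun ρ' h =>
      ⟨ρ' (.prog x), h.hasTy (.prog x), fun ρ'' h' => ?_⟩
    rw [← h'.prog x (hv (by simp [Term.vars]))]
    rfl
  | meth m =>
    rw [transPos]
    exact .retExpr henv hρ hst fun ρ' _ =>
      ⟨.val (.meth m), Outcome.hasTy_val rfl rfl, fun _ _ => rfl⟩
  | int i =>
    rw [transPos]
    exact .retExpr henv hρ hst fun ρ' _ =>
      ⟨.val (.int i), Outcome.hasTy_val rfl rfl, fun _ _ => rfl⟩
  | unit =>
    rw [transPos]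
    exact .retExpr henv hρ hst fun ρ' _ =>
      ⟨.val .unit, Outcome.hasTy_val rfl rfl, fun _ _ => rfl⟩
  | deref r =>
    rw [transPos]
    refine .retExpr henv hρ hst fun ρ' h =>
      ⟨ρ' (.ssa r (D.idx r)), h.hasTy (.ssa r _), fun ρ'' h' => ?_⟩
    rw [← h'.ssa r _ (henv.idx_le r)]
    rfl
  | @lam x M θ' hM' =>
    rw [transPos]
    have hty := G.meth_ty R.keys x.ty M.ty
    generalize G.meth R.keys x.ty M.ty = m at hty
    have henv' : TransEnv (R.insert m ⟨x, M⟩) C D U Θ :=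
      henv.insert_repo ⟨by rw [hty, hM'.ty_eq]; exact .lam hM', hv, hr⟩
    exact .retExpr henv' hρ hst fun ρ' _ =>
      ⟨.val (.meth m), Outcome.hasTy_val rfl rfl, fun _ _ => rfl⟩
  | @fst M θ₁ θ₂ hM' =>
    rw [transPos, ht]
    have h₁ := ih M (by simp only [Term.size]; omega) R C D φ U Θ _ ⟨hM', hv, hr⟩ henv ρ hρ hst
    have hw := hwb M R C D φ U Θ _ ⟨hM', hv, hr⟩ henv
    refine h₁.finish hw.toTransExt (fun _ => le_rfl) fun ρ' hρ' =>
      .guard hw.ret_mem fun v hv => ?_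
    obtain ⟨hc, hty⟩ := hρ' _ v hv
    obtain ⟨w, w', rfl, hc, -, hty, -⟩ := Val.exists_pair_of_closed hc (hty.trans hw.ret_ty)
    refine .eq (o := .val w) (Outcome.hasTy_val hc (hty.trans (G.var_ty _ _).symm))
      fun ρ'' h => ?_
    simp [Expr.eval, pv, h.prog _ hw.ret_mem, hv]
  | @snd M θ₁ θ₂ hM' =>
    rw [transPos, ht]
    have h₁ := ih M (by simp only [Term.size]; omega) R C D φ U Θ _ ⟨hM', hv, hr⟩ henv ρ hρ hst
    have hw := hwb M R C D φ U Θ _ ⟨hM', hv, hr⟩ henv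
    refine h₁.finish hw.toTransExt (fun _ => le_rfl) fun ρ' hρ' =>
      .guard hw.ret_mem fun v hv => ?_
    obtain ⟨hc, hty⟩ := hρ' _ v hv
    obtain ⟨w, w', rfl, -, hc, -, hty⟩ := Val.exists_pair_of_closed hc (hty.trans hw.ret_ty)
    refine .eq (o := .val w') (Outcome.hasTy_val hc (hty.trans (G.var_ty _ _).symm))
      fun ρ'' h => ?_
    simp [Expr.eval, pv, h.prog _ hw.ret_mem, hv]
  | @assign r M hM' =>
    rw [transPos]
    simp only [Term.refs, Finset.union_subset_iff, Finset.singleton_subset_iff] at hr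
    have h₁ := ih M (by simp only [Term.size]; omega) R C D φ U Θ _ ⟨hM', hv, hr.2⟩ henv ρ hρ hst
    have hw := hwb M R C D φ U Θ _ ⟨hM', hv, hr.2⟩ henv
    generalize transPos G call M R C D φ U = t₁ at h₁ hw
    refine h₁.finish hw.toTransExt (fun r' => ?_) fun ρ' hρ' => .guard hw.ret_mem fun v hv => ?_
    · rw [SSAMap.idx_bump]
      split_ifs with e
      · subst e; exact Nat.le_succ _
      · exact le_rfl
    · refine ⟨.val .unit, fun r' => if r' = r then ρ' (.prog t₁.ret) else .fail,
        Outcome.hasTy_val rfl (G.var_ty _ _).symm, fun r' => ?_, fun ρ'' h hret hg => ?_⟩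
      · dsimp only
        split_ifs with e
        · rw [e, ← hw.ret_ty]
          exact hρ'.hasTy (.prog t₁.ret)
        · exact Outcome.hasTy_fail _
      · refine ⟨Form.holds_eq_pv.mpr (by rw [hret]; rfl), Form.holds_eq_ssa.mpr ?_⟩
        have hb : (t₁.C.bump r).idx r = t₁.C.idx r + 1 := by rw [SSAMap.idx_bump, if_pos rfl]
        rw [SSAMap.idx_insert, if_pos rfl, hg r _ (by omega) le_rfl]
        dsimp only
        rw [if_pos rfl, ← h.prog _ hw.ret_mem]
        rfl
  | @arith o M N hM' hN =>
    rw [transPos]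
    simp only [Term.refs, Term.vars, Finset.union_subset_iff] at hr hv
    have hM₁ : M.Admissible .int U Θ := ⟨hM', hv.1, hr.1⟩
    have h₁ := ih M (by simp only [Term.size]; omega) R C D φ U Θ _ hM₁ henv ρ hρ hst
    have hw := hwb M R C D φ U Θ _ hM₁ henv
    generalize transPos G call M R C D φ U = t₁ at h₁ hw
    have hN₁ : N.Admissible .int t₁.used Θ := ⟨hN, hv.2.trans hw.used, hr.2⟩
    have hw₂ := hwb N t₁.repo t₁.C t₁.D t₁.form t₁.used Θ _ hN₁ hw.env
    have h₂ := h₁.trans hw.toTransExt (ih N (by simp only [Term.size]; omega) t₁.repo t₁.C t₁.D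
      t₁.form t₁.used Θ _ hN₁ hw.env)
    generalize transPos G call N t₁.repo t₁.C t₁.D t₁.form t₁.used = t₂ at h₂ hw₂
    have hr₁ := hw₂.used hw.ret_mem
    refine h₂.finish (hw₂.toTransExt.trans hw.toTransExt) (fun _ => le_rfl) fun ρ' hρ' =>
      .guard hr₁ fun v hv => .guard hw₂.ret_mem fun w hv' => ?_
    obtain ⟨hc, hty⟩ := hρ' _ v hv
    obtain ⟨i, rfl⟩ := Val.exists_int_of_closed hc (hty.trans hw.ret_ty)
    obtain ⟨hc, hty⟩ := hρ' _ w hv'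
    obtain ⟨j, rfl⟩ := Val.exists_int_of_closed hc (hty.trans hw₂.ret_ty)
    refine .eq (o := .val (.int (I o i j))) (Outcome.hasTy_val rfl (G.var_ty _ _).symm)
      fun ρ'' h => ?_
    simp [Expr.eval, pv, h.prog _ hr₁, h.prog _ hw₂.ret_mem, hv, hv']
  | @pair M N θ₁ θ₂ hM' hN =>
    rw [transPos, hM'.ty_eq, hN.ty_eq]
    simp only [Term.refs, Term.vars, Finset.union_subset_iff] at hr hv
    have hM₁ : M.Admissible _ U Θ := ⟨hM', hv.1, hr.1⟩
    have h₁ := ih M (by simp only [Term.size]; omega) R C D φ U Θ _ hM₁ henv ρ hρ hst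
    have hw := hwb M R C D φ U Θ _ hM₁ henv
    generalize transPos G call M R C D φ U = t₁ at h₁ hw
    have hN₁ : N.Admissible _ t₁.used Θ := ⟨hN, hv.2.trans hw.used, hr.2⟩
    have hw₂ := hwb N t₁.repo t₁.C t₁.D t₁.form t₁.used Θ _ hN₁ hw.env
    have h₂ := h₁.trans hw.toTransExt (ih N (by simp only [Term.size]; omega) t₁.repo t₁.C t₁.D
      t₁.form t₁.used Θ _ hN₁ hw.env)
    generalize transPos G call N t₁.repo t₁.C t₁.D t₁.form t₁.used = t₂ at h₂ hw₂
    have hr₁ := hw₂.used hw.ret_mem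
    refine h₂.finish (hw₂.toTransExt.trans hw.toTransExt) (fun _ => le_rfl) fun ρ' hρ' =>
      .guard hr₁ fun v hv => .guard hw₂.ret_mem fun w hv' => ?_
    obtain ⟨hc, hty⟩ := hρ' _ v hv
    obtain ⟨hc', hty'⟩ := hρ' _ w hv'
    refine .eq (o := .val (.pair v w)) (Outcome.hasTy_val ?_ ?_) fun ρ'' h => ?_
    · simp [Val.fv, hc, hc']
    · rw [G.var_ty, Val.ty, hty, hty']
      exact congrArg₂ _ hw.ret_ty hw₂.ret_ty
    · simp [Expr.eval, pv, h.prog _ hr₁, h.prog _ hw₂.ret_mem, hv, hv']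
  | @letin x M N θ hM' hN =>
    rw [transPos, hN.ty_eq]
    simp only [Term.refs, Term.vars, Finset.union_subset_iff] at hr hv
    have hM₁ : M.Admissible _ U Θ := ⟨hM', hv.1.2, hr.1⟩
    have h₁ := ih M (by simp only [Term.size]; omega) R C D φ U Θ _ hM₁ henv ρ hρ hst
    have hw := hwb M R C D φ U Θ _ hM₁ henv
    generalize transPos G call M R C D φ U = t₁ at h₁ hw
    have hN₁ : (N.subst1 x (.var t₁.ret)).Admissible θ t₁.used Θ :=
      Term.Admissible.subst1_var ⟨hN, hv.2.trans hw.used, hr.2⟩ hw.ret_mem hw.ret_ty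
    have hw₂ := hwb _ t₁.repo t₁.C t₁.D t₁.form t₁.used Θ _ hN₁ hw.env
    have h₂ := h₁.trans hw.toTransExt (ih (N.subst1 x (.var t₁.ret))
      (by rw [Term.size_subst1_var]; simp only [Term.size]; omega) t₁.repo t₁.C t₁.D
      t₁.form t₁.used Θ _ hN₁ hw.env)
    generalize transPos G call (N.subst1 x (.var t₁.ret)) t₁.repo t₁.C t₁.D t₁.form t₁.used = t₂
      at h₂ hw₂
    exact h₂.finish (hw₂.toTransExt.trans hw.toTransExt) (fun _ => le_rfl) fun ρ' hρ' =>
      .guard (hw₂.used hw.ret_mem) fun v hv =>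
        .copy hρ' hw₂.ret_mem (hw₂.ret_ty.trans (G.var_ty _ _).symm) (D := t₂.C)
          (fun _ => le_rfl) fun ρ'' _ h _ =>
            Form.holds_guard_of_copy h (Form.holds_eq_pv_pv.mpr h)
  | @letrec f x M N θ' θ hf hM' hN =>
    rw [transPos]
    simp only [Term.refs, Term.vars, Finset.union_subset_iff,
      Finset.insert_subset_iff, Finset.singleton_subset_iff] at hr hv
    have hty := G.meth_ty R.keys x.ty M.ty
    generalize G.meth R.keys x.ty M.ty = m at hty
    have hff := G.var_fresh U f.ty
    have hfty := G.var_ty U f.ty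
    generalize G.var U f.ty = f' at hff hfty
    have hsU : U ⊆ insert f' U := Finset.subset_insert _ _
    have hL : ((Lam.mk x M).subst1 f (.var f')).Admissible m (insert f' U) Θ := by
      refine Lam.Admissible.subst1_var ⟨?_, ?_, hr.1⟩ (Finset.mem_insert_self _ _) hfty
      · rw [hty, hM'.ty_eq]; exact .lam hM'
      · exact (Finset.union_subset (Finset.singleton_subset_iff.mpr hv.1.1.2) hv.1.2).trans hsU
    have hN₁ : (N.subst1 f (.var f')).Admissible _ (insert f' U) Θ :=
      Term.Admissible.subst1_var ⟨hN, hv.2.trans hsU, hr.2⟩ (Finset.mem_insert_self _ _) hfty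
    have henv₁ := (henv.mono hsU henv.keysC fun _ => le_rfl).insert_repo hL
    have hfill : (Form.eq (pv f') (.meth m)).Fillable I U C C f' ρ :=
      .eq (o := .val (.meth m))
        (Outcome.hasTy_val rfl (by rw [hfty, hf, ← hM'.ty_eq]; exact hty)) fun _ _ => rfl
    obtain ⟨ρ₁, hρ₁, hag, hst₁⟩ := hfill.exists_valuation hρ hff fun _ => le_rfl
    obtain ⟨ρ₂, hρ₂, hag₂, hst₂⟩ := ih (N.subst1 f (.var f'))
      (by rw [Term.size_subst1_var]; simp only [Term.size]; omega) _ _ _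
      (.and φ (.eq (pv f') (.meth m))) (insert f' U) Θ _ hN₁ henv₁ ρ₁ hρ₁
      fun ρ' h' => ⟨hst.mono hag hsU (fun _ => le_rfl) ρ' h', hst₁ ρ' h'⟩
    exact ⟨ρ₂, hρ₂, hag.trans hag₂ hsU fun _ => le_rfl, hst₂⟩
  | @appMeth m M hM' =>
    rw [transPos]
    simp only [Term.vars] at hv
    have hM₁ : M.Admissible _ U Θ := ⟨hM', hv, hr⟩
    have h₁ := ih M (by simp only [Term.size]; omega) R C D φ U Θ _ hM₁ henv ρ hρ hst
    have hw := hwb M R C D φ U Θ _ hM₁ henv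
    generalize transPos G call M R C D φ U = t₁ at h₁ hw
    rcases hL : R.lookup m with _ | L
    · exact h₁.trans hw.toTransExt fun ρ' hρ' hst' => .retExpr hw.env hρ' hst' fun _ _ =>
        ⟨.nil, Outcome.hasTy_nil _, fun _ _ => rfl⟩
    · have hLa := henv.repo m L hL
      have hN₁ := ((hLa.mono hw.used).body).subst1_var hw.ret_mem
        (hw.ret_ty.trans hLa.param_ty.symm)
      have hw₂ := hcall _ t₁.repo t₁.C t₁.D t₁.form t₁.used Θ _ hN₁ hw.env
      have h₂ := h₁.trans hw.toTransExt (hcons _ t₁.repo t₁.C t₁.D t₁.form t₁.used Θ _ hN₁ hw.env)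
      dsimp only
      generalize call (L.body.subst1 L.param (.var t₁.ret)) t₁.repo t₁.C t₁.D t₁.form t₁.used = t₂
        at h₂ hw₂
      exact h₂.finish (hw₂.toTransExt.trans hw.toTransExt) (fun _ => le_rfl) fun ρ' hρ' =>
        .guard (hw₂.used hw.ret_mem) fun v hv =>
          .copy hρ' hw₂.ret_mem (hw₂.ret_ty.trans (G.var_ty _ _).symm) (D := t₂.C)
            (fun _ => le_rfl) fun ρ'' _ h _ =>
              Form.holds_guard_of_copy h (Form.holds_eq_pv_pv.mpr h)
  | @ite M M₁ M₀ θ hM' hM₁ hM₀ =>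
    rw [transPos, hM₁.ty_eq]
    simp only [Term.refs, Term.vars, Finset.union_subset_iff] at hr hv
    have hMa : M.Admissible _ U Θ := ⟨hM', hv.1.1, hr.1.1⟩
    have hb := ih M (by simp only [Term.size]; omega) R C D φ U Θ _ hMa henv ρ hρ hst
    have hwb' := hwb M R C D φ U Θ _ hMa henv
    generalize transPos G call M R C D φ U = tb at hb hwb'
    have hM₀a : M₀.Admissible θ tb.used Θ := ⟨hM₀, hv.2.trans hwb'.used, hr.2⟩
    have hw₀ := hwb M₀ tb.repo tb.C tb.D tb.form tb.used Θ _ hM₀a hwb'.env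
    have h₀ := hb.trans hwb'.toTransExt (ih M₀ (by simp only [Term.size]; omega)
      tb.repo tb.C tb.D tb.form tb.used Θ _ hM₀a hwb'.env)
    generalize transPos G call M₀ tb.repo tb.C tb.D tb.form tb.used = t₀ at hw₀ h₀
    have hM₁a : M₁.Admissible θ t₀.used Θ := ⟨hM₁, (hv.1.2.trans hwb'.used).trans hw₀.used, hr.1.2⟩
    have henv₁ : TransEnv t₀.repo t₀.C tb.D t₀.used Θ :=
      ⟨hw₀.env.repo, hw₀.env.keysC, hwb'.env.keysD,
        fun r => (hwb'.env.idx_le r).trans (hw₀.idx r)⟩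
    have hw₁ := hwb M₁ t₀.repo t₀.C tb.D t₀.form t₀.used Θ _ hM₁a henv₁
    have hw₀' := hw₀.toTransExt.trans hwb'.toTransExt
    have h₁ := h₀.trans hw₀' (ih M₁ (by simp only [Term.size]; omega)
      t₀.repo t₀.C tb.D t₀.form t₀.used Θ _ hM₁a henv₁)
    generalize transPos G call M₁ t₀.repo t₀.C tb.D t₀.form t₀.used = t₁ at hw₁ h₁
    have hrb := hw₁.used (hw₀.used hwb'.ret_mem)
    refine h₁.finish (hw₁.toTransExt.trans hw₀') t₁.C.idx_le_bumpAll fun ρ' hρ' =>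
      .guard hrb fun v hv => ?_
    have hiff : ∀ ρ'' : Valuation, Valuation.Agree t₁.used t₁.C ρ' ρ'' →
        ((Form.eq (pv tb.ret) (.int 0) : Form Op).Holds I ρ'' ↔ v = .int 0) := by
      intro ρ'' h
      rw [Form.holds_eq_pv, h.prog _ hrb, hv]
      simp [Expr.eval, eq_comm]
    -- only the joining equations of the branch selected by `v` are required
    by_cases hi : v = .int 0
    · exact .copy hρ' (hw₁.used hw₀.ret_mem) (hw₀.ret_ty.trans (G.var_ty _ _).symm) (D := t₀.D)
        (fun r => (hw₀.env.idx_le r).trans (hw₁.idx r)) fun ρ'' hag h hj =>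
          ⟨fun _ => Form.holds_guard_of_copy h
            ⟨Form.holds_eq_pv_pv.mpr h, SSAMap.holds_join_bumpAll hj⟩,
          fun hn => (hn ((hiff ρ'' hag).mpr hi)).elim⟩
    · exact .copy hρ' hw₁.ret_mem (hw₁.ret_ty.trans (G.var_ty _ _).symm) (D := t₁.D)
        hw₁.env.idx_le fun ρ'' hag h hj =>
          ⟨fun hn => (hi ((hiff ρ'' hag).mp hn)).elim,
          fun _ => Form.holds_guard_of_copy h
            ⟨Form.holds_eq_pv_pv.mpr h, SSAMap.holds_join_bumpAll hj⟩⟩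
  | @appVar x M θ' θ hx hM' =>
    rw [transPos, ht]
    simp only [Term.vars, Finset.union_subset_iff, Finset.singleton_subset_iff] at hv
    have hMa : M.Admissible _ U Θ := ⟨hM', hv.2, hr⟩
    have h₁ := ih M (by simp only [Term.size]; omega) R C D φ U Θ _ hMa henv ρ hρ hst
    have hw₁ := hwb M R C D φ U Θ _ hMa henv
    generalize transPos G call M R C D φ U = t₀ at h₁ hw₁
    have hdom : ∀ m' ∈ Repo.restrict R x.ty, m'.dom = t₀.ret.ty ∧ m'.cod = θ := fun m' hm' => by
      have := (Repo.mem_restrict.mp hm').2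
      rw [hx] at this
      rw [hw₁.ret_ty]
      exact Ty.arr.inj this
    obtain ⟨hend, hspec⟩ := callAll_spec hcall (R := R) (ret₀ := t₀.ret) (D₀ := t₀.D)
      (Repo.restrict R x.ty)
      t₀ hw₁.env hw₁.env.keysD hw₁.env.idx_le hw₁.ret_mem
      (fun m L h => (henv.repo m L h).mono hw₁.used) fun m' hm' => (hdom m' hm').1
    have hsat := h₁.trans hw₁.toTransExt (callAll_satisfiable hcall hcons (R := R) (ret₀ := t₀.ret)
      (D₀ := t₀.D) (Repo.restrict R x.ty)
      t₀ hw₁.env hw₁.env.keysD hw₁.env.idx_le hw₁.ret_mem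
      (fun m L h => (henv.repo m L h).mono hw₁.used) fun m' hm' => (hdom m' hm').1)
    have hnd := (callAll_fst_sublist (call := call) (R := R) (ret₀ := t₀.ret) (D₀ := t₀.D)
      (Repo.restrict R x.ty) t₀.repo t₀.C t₀.form t₀.used).nodup (Repo.nodup_restrict R x.ty)
    generalize callAll call R t₀.ret t₀.D (Repo.restrict R x.ty) t₀.repo t₀.C t₀.form t₀.used = l
      at hend hspec hsat hnd
    unfold callEnd at hend hspec hsat
    rcases hg : l.getLast? with _ | ⟨m', tₙ⟩
    · exact h₁.trans hw₁.toTransExt fun ρ' hρ' hst' => .retExpr hw₁.env hρ' hst' fun _ _ =>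
        ⟨.nil, Outcome.hasTy_nil _, fun _ _ => rfl⟩
    rw [hg] at hend hspec hsat
    simp only [Option.map_some, Option.getD_some] at hend hspec hsat
    have hxU : x ∈ tₙ.used := hend.used (hw₁.used hv.1)
    refine hsat.finish (hend.trans hw₁.toTransExt) tₙ.C.idx_le_bumpAll fun ρ' hρ' =>
      .guard (hend.used hw₁.ret_mem) fun v hv => ?_
    have hiff : ∀ (ρ'' : Valuation) (m : Meth), Valuation.Agree tₙ.used tₙ.C ρ' ρ'' →
        ((Form.eq (pv x) (.meth m) : Form Op).Holds I ρ'' ↔ ρ' (.prog x) = .val (.meth m)) := by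
      intro ρ'' m h
      rw [Form.holds_eq_pv, h.prog _ hxU]
      simp [Expr.eval, eq_comm]
    -- at most one of the implications has a true premise, as the methods in the list are distinct
    by_cases hp : ∃ p ∈ l, ρ' (.prog x) = .val (.meth p.1)
    · obtain ⟨p, hpl, hpx⟩ := hp
      obtain ⟨hpm, L, t', hsp⟩ := hspec p hpl
      refine .copy hρ' (hsp.last.used hsp.spec.ret_mem)
        ((hsp.spec.ret_ty.trans (hdom _ hpm).2).trans (G.var_ty _ _).symm) (D := p.2.D)
        (fun r => (hsp.spec.env.idx_le r).trans (hsp.last.idx r)) fun ρ'' hag h hj =>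
        Form.holds_conj.mpr fun ψ hψ => ?_
      obtain ⟨q, hql, rfl⟩ := List.mem_map.mp hψ
      intro hq
      rw [hiff ρ'' _ hag, hpx] at hq
      have hqp : p = q := List.inj_on_of_nodup_map hnd hpl hql
        (Val.meth.inj (Outcome.val.inj hq))
      subst hqp
      exact ⟨Form.holds_guard_of_copy h (Form.holds_eq_pv_pv.mpr h),
        SSAMap.holds_join_bumpAll hj⟩
    · refine ⟨.fail, fun _ => .fail, Outcome.hasTy_fail _,
        fun _ => Outcome.hasTy_fail _, fun ρ'' hag _ _ =>
        Form.holds_conj.mpr fun ψ hψ => ?_⟩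
      obtain ⟨q, hql, rfl⟩ := List.mem_map.mp hψ
      intro hq
      rw [hiff ρ'' _ hag] at hq
      exact (hp ⟨q, hql, hq⟩).elim

end Satisfiability

/-! ### Initial configurations -/

section Initial

variable {Op : Type u} {I : Op → ℤ → ℤ → ℤ} {ρ : Valuation}

theorem Val.eval_toExpr {s : Subst} {v : Val}
    (h : ∀ x ∈ v.fv, ∃ w, s x = some w ∧ ρ (.prog x) = .val w) :
    (v.toExpr : Expr Op).eval I ρ = some (.val (v.subst s)) := by
  induction v with
  | var x =>
    obtain ⟨w, hw, hρ⟩ := h x (by simp [Val.fv])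
    simp [Val.toExpr, Expr.eval, Val.subst, hw, hρ]
  | pair v w hv hw =>
    simp only [Val.fv, Finset.mem_union] at h
    simp [Val.toExpr, Expr.eval, Val.subst, hv fun x hx => h x (.inl hx),
      hw fun x hx => h x (.inr hx)]
  | _ => rfl

theorem Val.eval_toExpr_of_closed {v : Val} (h : v.fv = ∅) :
    (v.toExpr : Expr Op).eval I ρ = some (.val v) := by
  rw [Val.eval_toExpr (s := fun _ => none) (by simp [h]), Val.subst_eq_self h]

theorem Outcome.eval_toExpr_of_closed {χ : Outcome} (h : χ.Closed) :
    (χ.toExpr : Expr Op).eval I ρ = some χ := by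
  cases χ with
  | val v => exact Val.eval_toExpr_of_closed h
  | _ => rfl

theorem Store.holds_initForm {S : Store} :
    (S.initForm : Form Op).Holds I ρ ↔
      ∀ r v, S.lookup r = some v → (v.toExpr : Expr Op).eval I ρ = some (ρ (.ssa r 0)) := by
  simp only [Store.initForm, Form.holds_conj, List.mem_map, Multiset.mem_toList,
    forall_exists_index, and_imp, forall_apply_eq_imp_iff₂]
  refine ⟨fun h r v hv => ?_, fun h e he => ?_⟩
  · have := h ⟨r, v⟩ (Finmap.mem_lookup_iff.mp hv)
    simpa [Form.Holds, Expr.eval] using this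
  · have := h e.1 e.2 (Finmap.mem_lookup_iff.mpr he)
    simpa [Form.Holds, Expr.eval] using this

theorem Assignment.holds_form {σ : Assignment} :
    (σ.form : Form Op).Holds I ρ ↔
      ∀ x v, σ.lookup x = some v → (v.toExpr : Expr Op).eval I ρ = some (ρ (.prog x)) := by
  simp only [Assignment.form, Form.holds_conj, List.mem_map, Multiset.mem_toList,
    forall_exists_index, and_imp, forall_apply_eq_imp_iff₂]
  refine ⟨fun h x v hv => ?_, fun h e he => ?_⟩
  · have := h ⟨x, v⟩ (Finmap.mem_lookup_iff.mp hv)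
    simpa [Form.Holds, Expr.eval] using this
  · have := h e.1 e.2 (Finmap.mem_lookup_iff.mpr he)
    simpa [Form.Holds, Expr.eval] using this

theorem Store.keys_initSSA (S : Store) : S.initSSA.keys = S.keys := keys_mapVals _ _

theorem Store.idx_initSSA (S : Store) (r : Ref) : S.initSSA.idx r = 0 := by
  unfold SSAMap.idx Store.initSSA
  rw [lookup_mapVals]
  cases S.lookup r <;> rfl

theorem Config.Valid.admissible {K : Config Op} (h : K.Valid) :
    ∃ θ, K.term.Admissible θ K.vars K.store.keys := by
  obtain ⟨θ, hθ⟩ := h.term_typed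
  refine ⟨θ, hθ, ?_, h.term_refs⟩
  intro x hx
  simp only [Config.vars, Finset.mem_union]
  exact .inl (.inl hx)

theorem Config.Valid.transEnv {K : Config Op} (h : K.Valid) :
    TransEnv K.repo K.store.initSSA K.store.initSSA K.vars K.store.keys where
  repo m L hL := by
    refine ⟨h.repo_typed m L hL, ?_, h.repo_refs m L hL⟩
    intro x hx
    simp only [Config.vars, Finset.mem_union]
    exact .inl (.inr ((mem_gather _ _ _).mpr ⟨m, L, hL, hx⟩))
  keysC := K.store.keys_initSSA
  keysD := K.store.keys_initSSA
  idx_le _ := le_rfl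

theorem Lam.fv_subset_vars (L : Lam Op) : L.fv ⊆ L.vars := by
  intro x hx
  exact Finset.mem_union_right _ (L.body.fv_subset_vars (Finset.mem_of_mem_erase hx))

theorem Config.fv_subset_vars (K : Config Op) : K.fv ⊆ K.vars := by
  intro x hx
  simp only [Config.fv, Config.vars, Finset.mem_union] at hx ⊢
  rcases hx with (hx | hx) | hx
  · exact .inl (.inl (K.term.fv_subset_vars hx))
  · obtain ⟨m, L, hL, hx⟩ := (mem_gather _ _ _).mp hx
    exact .inl (.inr ((mem_gather _ _ _).mpr ⟨m, L, hL, L.fv_subset_vars hx⟩))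
  · exact .inr hx

theorem Lam.mem_fv_subst {s : Subst} {L : Lam Op} {x : Var} (hx : x ∈ L.fv) (hs : s x = none) :
    x ∈ (L.subst s).fv := by
  obtain ⟨hne, hx⟩ := Finset.mem_erase.mp hx
  refine Finset.mem_erase.mpr ⟨hne, Term.mem_fv_subst hx ?_⟩
  unfold Subst.drop
  rw [if_neg hne, hs]

/-- An assignment that closes the configuration is defined on its free variables. -/
theorem Config.exists_lookup_of_mem_fv {K : Config Op} {σ : Assignment}
    (h : (K.apply σ).Closed) {x : Var} (hx : x ∈ K.fv) : ∃ v, σ.lookup x = some v := by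
  by_contra! hno
  have hs : σ.toSubst x = none := Option.eq_none_iff_forall_ne_some.mpr hno
  suffices hmem : x ∈ (K.apply σ).fv by
    rw [h] at hmem
    exact absurd hmem (Finset.notMem_empty x)
  simp only [Config.fv, Finset.mem_union] at hx ⊢
  rcases hx with (hx | hx) | hx
  · exact .inl (.inl (Term.mem_fv_subst hx hs))
  · obtain ⟨m, L, hL, hx⟩ := (mem_gather _ _ _).mp hx
    refine .inl (.inr ((mem_gather _ _ _).mpr ⟨m, L.subst σ.toSubst, ?_, Lam.mem_fv_subst hx hs⟩))
    simp [Config.apply, lookup_mapVals, hL]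
  · obtain ⟨r, v, hv, hx⟩ := (mem_gather _ _ _).mp hx
    refine .inr ((mem_gather _ _ _).mpr ⟨r, v.subst σ.toSubst, ?_, Val.mem_fv_subst hx hs⟩)
    simp [Config.apply, lookup_mapVals, hv]

/-- The restriction of the assignment `σ` to the free variables of `K`. -/
def Config.env (K : Config Op) (σ : Assignment) : Subst :=
  fun x => if x ∈ K.fv then σ.lookup x else none

theorem Config.env_eq_some {K : Config Op} {σ : Assignment} {x : Var} {v : Val} :
    K.env σ x = some v ↔ x ∈ K.fv ∧ σ.lookup x = some v := by
  unfold Config.env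
  split_ifs with h <;> simp [h]

theorem Config.mem_fv_of_store {K : Config Op} {r : Ref} {v : Val} {x : Var}
    (h : K.store.lookup r = some v) (hx : x ∈ v.fv) : x ∈ K.fv := by
  simp only [Config.fv, Finset.mem_union]
  exact .inr ((mem_gather _ _ _).mpr ⟨r, v, h, hx⟩)

theorem Config.mem_fv_of_repo {K : Config Op} {m : Meth} {L : Lam Op} {x : Var}
    (h : K.repo.lookup m = some L) (hx : x ∈ L.fv) : x ∈ K.fv := by
  simp only [Config.fv, Finset.mem_union]
  exact .inl (.inr ((mem_gather _ _ _).mpr ⟨m, L, h, hx⟩))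

theorem Config.mem_fv_of_term {K : Config Op} {x : Var} (hx : x ∈ K.term.fv) : x ∈ K.fv := by
  simp only [Config.fv, Finset.mem_union]
  exact .inl (.inl hx)

theorem Config.env_eq_toSubst (K : Config Op) (σ : Assignment) {x : Var} (hx : x ∈ K.fv) :
    σ.toSubst x = K.env σ x := (if_pos hx).symm

theorem Config.env_covers {K : Config Op} {σ : Assignment} (h : (K.apply σ).Closed) :
    (K.env σ).Covers K.fv := by
  intro x hx
  obtain ⟨v, hv⟩ := K.exists_lookup_of_mem_fv h hx
  exact ⟨v, Config.env_eq_some.mpr ⟨hx, hv⟩⟩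

theorem Config.term_apply (K : Config Op) (σ : Assignment) :
    (K.apply σ).term = K.term.subst (K.env σ) :=
  Term.subst_congr fun _ hx => K.env_eq_toSubst σ (Config.mem_fv_of_term hx)

theorem Config.lookup_store_apply (K : Config Op) (σ : Assignment) {r : Ref} {w : Val} :
    (K.apply σ).store.lookup r = some w ↔
      ∃ v, K.store.lookup r = some v ∧ w = v.subst (K.env σ) := by
  simp only [Config.apply, lookup_mapVals, Option.map_eq_some_iff]
  refine exists_congr fun v => and_congr_right fun hv => ?_
  rw [Val.subst_congr fun x hx => K.env_eq_toSubst σ (Config.mem_fv_of_store hv hx), eq_comm]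

theorem Config.lookup_repo_apply (K : Config Op) (σ : Assignment) {m : Meth} {L₀ : Lam Op} :
    (K.apply σ).repo.lookup m = some L₀ ↔
      ∃ L, K.repo.lookup m = some L ∧ L₀ = L.subst (K.env σ) := by
  simp only [Config.apply, lookup_mapVals, Option.map_eq_some_iff]
  refine exists_congr fun L => and_congr_right fun hL => ?_
  rw [Lam.subst_congr fun x hx => K.env_eq_toSubst σ (Config.mem_fv_of_repo hL hx), eq_comm]

theorem Config.keys_repo_apply (K : Config Op) (σ : Assignment) :
    (K.apply σ).repo.keys = K.repo.keys := keys_mapVals _ _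

section

variable {K : Config Op} {σ : Assignment}

theorem Config.meths_env (hground : ∀ x ∈ K.fv, x.ty.Ground) (hσ : σ.Proper) {x : Var} {v : Val}
    (h : K.env σ x = some v) : v.meths = ∅ := by
  obtain ⟨hx, hv⟩ := Config.env_eq_some.mp h
  obtain ⟨hc, ht⟩ := hσ x v hv
  exact Val.meths_eq_empty_of_ground hc (ht ▸ hground x hx)

theorem Config.env_typed (hσ : σ.Proper) : (K.env σ).Typed :=
  fun x v h => (hσ x v (Config.env_eq_some.mp h).2).2

theorem Config.Valid.meths_term_apply (hvalid : K.Valid) (hground : ∀ x ∈ K.fv, x.ty.Ground)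
    (hσ : σ.Proper) : (K.apply σ).term.meths ⊆ K.repo.keys := by
  intro m hm
  rw [Config.term_apply] at hm
  rcases Term.mem_meths_subst hm with h | ⟨x, -, w, hw, h⟩
  · exact hvalid.term_meths h
  · simp [Config.meths_env hground hσ hw] at h

theorem Config.Valid.scopedMeths_apply (hvalid : K.Valid) (hground : ∀ x ∈ K.fv, x.ty.Ground)
    (hσ : σ.Proper) : ScopedMeths (K.apply σ).repo (K.apply σ).store where
  repo m L₀ hL₀ := by
    obtain ⟨L, hL, rfl⟩ := (K.lookup_repo_apply σ).mp hL₀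
    rw [Config.keys_repo_apply]
    intro m' hm'
    rcases Term.mem_meths_subst hm' with h | ⟨x, -, w, hw, h⟩
    · exact hvalid.repo_meths m L hL h
    · simp [Config.meths_env hground hσ (Subst.drop_eq_some.mp hw).2] at h
  store r w hw := by
    obtain ⟨v, hv, rfl⟩ := (K.lookup_store_apply σ).mp hw
    rw [Config.keys_repo_apply]
    intro m' hm'
    rcases Val.mem_meths_subst hm' with h | ⟨x, -, w, hw, h⟩
    · exact hvalid.store_meths r v hv h
    · simp [Config.meths_env hground hσ hw] at h

/-- The configuration closed by the assignment is a starting point of the simulation. This is where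
the free variables have to be of ground type: the value of a higher-order variable would contain
methods, and these need not belong to the repository. -/
theorem Config.Valid.liveState (hvalid : K.Valid) (hground : ∀ x ∈ K.fv, x.ty.Ground)
    (hσ : σ.Proper) (hclosing : (K.apply σ).Closed) :
    LiveState (K.env σ) (K.apply σ).repo (K.apply σ).store K.repo K.vars K.store.keys where
  dom x v h := K.fv_subset_vars (Config.env_eq_some.mp h).1
  closed x v h := (hσ x v (Config.env_eq_some.mp h).2).1
  typed := Config.env_typed hσ
  meths x v h := by simp [Config.meths_env hground hσ h]
  store_keys := keys_mapVals _ _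
  store r w hw := by
    refine ⟨?_, ?_, (hvalid.scopedMeths_apply hground hσ).store r w hw⟩
    · rw [Finset.eq_empty_iff_forall_notMem]
      intro x hx
      have h := Config.mem_fv_of_store hw hx
      rw [hclosing] at h
      exact absurd h (Finset.notMem_empty x)
    · obtain ⟨v, hv, rfl⟩ := (K.lookup_store_apply σ).mp hw
      rw [Val.ty_subst (Config.env_typed hσ), hvalid.store_typed r v hv]
  repo m L₀ hL₀ := by
    obtain ⟨L, hL, rfl⟩ := (K.lookup_repo_apply σ).mp hL₀
    refine ⟨L, hL, rfl, (Config.env_covers hclosing).mono (.refl _)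
      fun x hx => Config.mem_fv_of_repo hL hx, ?_⟩
    rw [Config.keys_repo_apply]
    exact hvalid.repo_meths m L hL

end

end Initial

/-! ### The translation of a configuration -/

section Configurations

variable {Op : Type u} {I : Op → ℤ → ℤ → ℤ}

theorem sound_transNat (G : FreshGen) :
    ∀ k, (transNat G k : Translator Op).Sound I (some k)
  | 0 => sound_transPos G (wellBehaved_transNil G) (sound_transNil G)
  | k + 1 => sound_transPos G (wellBehaved_transNat G k) (sound_transNat G k)

theorem conservative_transNat (G : FreshGen) :
    ∀ k, (transNat G k : Translator Op).Conservative I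
  | 0 => conservative_transPos G (wellBehaved_transNil G) (conservative_transNil G)
  | k + 1 => conservative_transPos G (wellBehaved_transNat G k) (conservative_transNat G k)

theorem wellBehaved_transBound (G : FreshGen) :
    ∀ b, (transBound G b : Translator Op).WellBehaved
  | none => wellBehaved_transNil G
  | some k => wellBehaved_transNat G k

theorem sound_transBound (G : FreshGen) : ∀ b, (transBound G b : Translator Op).Sound I b
  | none => sound_transNil G
  | some k => sound_transNat G k

theorem conservative_transBound (G : FreshGen) :
    ∀ b, (transBound G b : Translator Op).Conservative I
  | none => conservative_transNil G
  | some k => conservative_transNat G k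

variable {K : Config Op} {σ : Assignment} (G : FreshGen)

/-- The configuration has some evaluation, and the formula forces the return variable to be its
outcome. -/
theorem Config.exists_eval_forall_ret_eq (hvalid : K.Valid) (hground : ∀ x ∈ K.fv, x.ty.Ground)
    (hσ : σ.Proper) (hclosing : (K.apply σ).Closed) :
    ∃ (χ : Outcome) (R' : Repo Op) (S' : Store),
      Eval I (K.apply σ).term (K.apply σ).repo (K.apply σ).store (K.apply σ).bound χ R' S' ∧
        ∀ ρ : Valuation, (K.translate G).form.Holds I ρ → (σ.form : Form Op).Holds I ρ →
          ρ (.prog (K.translate G).ret) = χ := by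
  obtain ⟨θ, hM⟩ := hvalid.admissible
  have henv := hvalid.transEnv
  have hspec := wellBehaved_transBound G K.bound K.term K.repo _ _ K.store.initForm _ _ θ hM henv
  have hmodels : ∀ ρ : Valuation, (K.translate G).form.Holds I ρ → (σ.form : Form Op).Holds I ρ →
      ρ.Models (K.env σ) K.store.initSSA (K.apply σ).store := by
    intro ρ hφ hσρ
    have hprog : ∀ x v, K.env σ x = some v → ρ (.prog x) = .val v := by
      intro x v h
      have hx := (Config.env_eq_some.mp h).2
      have := Assignment.holds_form.mp hσρ x v hx
      rw [Val.eval_toExpr_of_closed (hσ x v hx).1] at this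
      exact (Option.some.inj this).symm
    refine ⟨hprog, fun r w hw => ?_⟩
    obtain ⟨v, hv, rfl⟩ := (K.lookup_store_apply σ).mp hw
    have := Store.holds_initForm.mp (hspec.form I ρ hφ) r v hv
    rw [Val.eval_toExpr (s := K.env σ)] at this
    · rw [Store.idx_initSSA]
      exact (Option.some.inj this).symm
    · intro x hx
      obtain ⟨w, hw⟩ := Config.env_covers hclosing x (Config.mem_fv_of_store hv hx)
      exact ⟨w, hw, hprog x w hw⟩
  have hmeths : K.term.meths ⊆ (K.apply σ).repo.keys := by
    rw [Config.keys_repo_apply]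
    exact hvalid.term_meths
  have hsim := sound_transBound (I := I) G K.bound K.term K.repo _ _ K.store.initForm _ _ θ hM henv
    (K.env σ) _ _ (hvalid.liveState hground hσ hclosing)
    ((Config.env_covers hclosing).mono (.refl _) fun x hx => Config.mem_fv_of_term hx) hmeths
  rw [← Config.term_apply] at hsim
  rcases hsim with ⟨χ, R', S', -, he, hρ⟩ | ⟨v, R', S', η', he, hv, -, -, -, hρ⟩
  · exact ⟨χ, R', S', he, fun ρ hφ hσρ => hρ ρ hφ (hmodels ρ hφ hσρ)⟩
  · exact ⟨.val v, R', S', he, fun ρ hφ hσρ => (hρ ρ hφ (hmodels ρ hφ hσρ)).env _ v hv⟩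

/-- The formula is satisfiable together with the equations of the assignment, so that it cannot
entail an equation for a hollow reason. -/
theorem Config.exists_holds_translate (hvalid : K.Valid) (hσ : σ.Proper)
    (hclosing : (K.apply σ).Closed)
    (hfresh : ∀ x ∈ σ.keys, x ∈ (K.translate G).used → x ∈ K.vars) :
    ∃ ρ : Valuation, ρ.Proper ∧ (K.translate G).form.Holds I ρ ∧ (σ.form : Form Op).Holds I ρ := by
  obtain ⟨θ, hM⟩ := hvalid.admissible
  have henv := hvalid.transEnv
  -- The only valuation that is possible on the initial variables; elsewhere it is immaterial.
  let ρ₀ : Valuation := fun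
    | .prog x => ((σ.lookup x).map Outcome.val).getD .fail
    | .ssa r _ => (((K.apply σ).store.lookup r).map Outcome.val).getD .fail
  have hprog : ∀ x v, σ.lookup x = some v → ρ₀ (.prog x) = .val v := by
    intro x v h
    simp [ρ₀, h]
  have hρ₀ : ρ₀.Proper := by
    rintro (x | ⟨r, i⟩) v hv
    · rcases h : σ.lookup x with _ | w
      · simp [ρ₀, h] at hv
      · simp only [ρ₀, h, Option.map_some, Option.getD_some, Outcome.val.injEq] at hv
        exact hv ▸ hσ x w h
    · rcases h : (K.apply σ).store.lookup r with _ | w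
      · simp [ρ₀, h] at hv
      · simp only [ρ₀, h, Option.map_some, Option.getD_some, Outcome.val.injEq] at hv
        subst hv
        refine ⟨?_, ?_⟩
        · rw [Finset.eq_empty_iff_forall_notMem]
          intro x hx
          have h' := Config.mem_fv_of_store h hx
          rw [hclosing] at h'
          exact absurd h' (Finset.notMem_empty x)
        · obtain ⟨v, hv, rfl⟩ := (K.lookup_store_apply σ).mp h
          exact (Val.ty_subst (Config.env_typed hσ) v).trans (hvalid.store_typed r v hv)
  have hst : (K.store.initForm : Form Op).Stable I K.vars K.store.initSSA ρ₀ := by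
    intro ρ hρ
    rw [Store.holds_initForm]
    intro r v hv
    have hr : ρ (.ssa r 0) = .val (v.subst (K.env σ)) := by
      rw [hρ.ssa r 0 (Nat.zero_le _)]
      simp [ρ₀, (K.lookup_store_apply σ).mpr ⟨v, hv, rfl⟩]
    rw [hr]
    refine Val.eval_toExpr fun x hx => ?_
    have hx' := Config.mem_fv_of_store hv hx
    obtain ⟨w, hw⟩ := Config.env_covers hclosing x hx'
    exact ⟨w, hw, (hρ.prog x (K.fv_subset_vars hx')).trans
      (hprog x w (Config.env_eq_some.mp hw).2)⟩
  obtain ⟨ρ₁, hρ₁, hag, hφ⟩ := conservative_transBound (I := I) G K.bound K.term K.repo _ _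
    K.store.initForm _ _ θ hM henv ρ₀ hρ₀ hst
  -- The formula does not constrain the unused variables, at which `σ` may be defined.
  let ρ : Valuation := fun
    | .prog x => if x ∈ (K.translate G).used then ρ₁ (.prog x) else ρ₀ (.prog x)
    | .ssa r i => ρ₁ (.ssa r i)
  refine ⟨ρ, ?_, hφ ρ ⟨fun x hx => if_pos hx, fun _ _ _ => rfl⟩, ?_⟩
  · rintro (x | ⟨r, i⟩) v hv
    · by_cases hx : x ∈ (K.translate G).used
      · simp only [ρ, if_pos hx] at hv
        exact hρ₁ _ v hv
      · simp only [ρ, if_neg hx] at hv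
        exact hρ₀ _ v hv
    · exact hρ₁ _ v hv
  · rw [Assignment.holds_form]
    intro x v hv
    rw [Val.eval_toExpr_of_closed (hσ x v hv).1, ← hprog x v hv]
    by_cases hx : x ∈ (K.translate G).used
    · have : ρ (.prog x) = ρ₁ (.prog x) := if_pos hx
      rw [this, hag.prog x (hfresh x (mem_keys_of_lookup hv) hx)]
    · have : ρ (.prog x) = ρ₀ (.prog x) := if_neg hx
      rw [this]

theorem RepoPerm.refl (R : Repo Op) : RepoPerm 1 R R := by
  intro m
  have h : (Lam.perm 1 : Lam Op → Lam Op) = id := by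
    funext L
    simp [Lam.perm, Term.perm_one]
  simp [h]

theorem StorePerm.refl (S : Store) : StorePerm 1 S S := by
  intro r
  have h : Val.perm 1 = id := funext Val.perm_one
  simp [h]

theorem IsNamePerm.one : IsNamePerm 1 := ⟨fun _ => rfl, by simp⟩

theorem Outcome.closed_perm {π : Equiv.Perm Meth} {χ : Outcome} :
    (χ.perm π).Closed ↔ χ.Closed := by
  cases χ <;> simp [Outcome.perm, Outcome.Closed, Val.fv_perm]

/-- The outcomes of a configuration are closed under nominal equivalence. -/
theorem Eval.of_nomEquiv {M : Term Op} {R R' : Repo Op} {S S' : Store} {k : Option ℕ}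
    {χ χ' : Outcome} (h : Eval I M R S k χ R' S') (hM : M.meths ⊆ R.keys) (hsc : ScopedMeths R S)
    (hχ : NomEquiv R.keys χ χ') : ∃ R₂ S₂, Eval I M R S k χ' R₂ S₂ := by
  obtain ⟨π, hπ, rfl, hfix⟩ := hχ
  obtain ⟨R₂, S₂, -, -, he⟩ := h.perm hπ ((RepoPerm.refl R).congr hsc hfix)
    ((StorePerm.refl S).congr hsc hfix)
  rw [Term.perm_congr (π := 1) fun m hm => hfix m (hM hm), Term.perm_one] at he
  exact ⟨R₂, S₂, he⟩

/-- Any two outcomes of a configuration are nominally equivalent. -/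
theorem Eval.nomEquiv {M : Term Op} {R R₁ R₂ : Repo Op} {S S₁ S₂ : Store} {k : Option ℕ}
    {χ₁ χ₂ : Outcome} (h₁ : Eval I M R S k χ₁ R₁ S₁) (h₂ : Eval I M R S k χ₂ R₂ S₂)
    (hM : M.meths ⊆ R.keys) (hsc : ScopedMeths R S) : NomEquiv R.keys χ₁ χ₂ := by
  rw [← M.perm_one] at h₂
  obtain ⟨π, hπ, hfix, hχ, -⟩ :=
    h₁.unique_up_to_perm .one hM hsc (RepoPerm.refl R) (StorePerm.refl S) h₂
  exact ⟨π, hπ, hχ, hfix⟩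

theorem Config.eval_iff_exists_entails (hvalid : K.Valid) (hground : ∀ x ∈ K.fv, x.ty.Ground)
    (hσ : σ.Proper) (hfresh : ∀ x ∈ σ.keys, x ∈ (K.translate G).used → x ∈ K.vars)
    (hclosing : (K.apply σ).Closed) {χ' : Outcome} (hχ' : χ'.Closed) :
    (∃ (R' : Repo Op) (S' : Store),
        Eval I (K.apply σ).term (K.apply σ).repo (K.apply σ).store (K.apply σ).bound χ' R' S') ↔
      ∃ χ : Outcome, NomEquiv K.repo.keys χ χ' ∧
        (Form.and (K.translate G).form σ.form).Entails I
          (.eq (pv (K.translate G).ret) χ.toExpr) := by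
  obtain ⟨χ₀, R₀, S₀, he₀, hret⟩ :=
    K.exists_eval_forall_ret_eq (I := I) G hvalid hground hσ hclosing
  have hsc := hvalid.scopedMeths_apply hground hσ
  have hM := hvalid.meths_term_apply hground hσ
  rw [← K.keys_repo_apply σ] at hM ⊢
  constructor
  · rintro ⟨R', S', he⟩
    have hequiv := he₀.nomEquiv he hM hsc
    refine ⟨χ₀, hequiv, fun ρ _ hρ => ?_⟩
    obtain ⟨π, -, rfl, -⟩ := hequiv
    rw [Form.holds_eq_pv, Outcome.eval_toExpr_of_closed (Outcome.closed_perm.mp hχ'),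
      hret ρ hρ.1 hρ.2]
  · rintro ⟨χ, hequiv, hent⟩
    obtain ⟨ρ, hρ, hφ, hσρ⟩ := K.exists_holds_translate (I := I) G hvalid hσ hclosing hfresh
    have hχ : χ.Closed := by
      obtain ⟨π, -, rfl, -⟩ := hequiv
      exact Outcome.closed_perm.mp hχ'
    have h := Form.holds_eq_pv.mp (hent ρ hρ ⟨hφ, hσρ⟩)
    rw [Outcome.eval_toExpr_of_closed hχ, hret ρ hφ hσρ] at h
    exact he₀.of_nomEquiv hM hsc (Option.some.inj h ▸ hequiv)

end Configurations

end HORef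

theorem mainTheorem1 {Op : Type*} (I : Op → ℤ → ℤ → ℤ) (G : HORef.FreshGen)
    (K : HORef.Config Op) (hvalid : K.Valid) (hground : ∀ x ∈ K.fv, x.ty.Ground)
    (ret : HORef.Var) (φ : HORef.Form Op) (R'' : HORef.Repo Op) (C D : HORef.SSAMap)
    (used : Finset HORef.Var) (htrans : K.translate G = ⟨ret, φ, R'', C, D, used⟩)
    (σ₀ : HORef.Assignment) (hσ₀ : HORef.Assignment.Proper σ₀)
    (hfresh : ∀ x ∈ σ₀.keys, x ∈ used → x ∈ K.vars)
    (hclosing : (K.apply σ₀).Closed)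
    (χ' : HORef.Outcome) (hχ' : χ'.Closed) :
    (∃ (R' : HORef.Repo Op) (S' : HORef.Store),
        HORef.Eval I (K.apply σ₀).term (K.apply σ₀).repo (K.apply σ₀).store (K.apply σ₀).bound
          χ' R' S') ↔
      ∃ χ : HORef.Outcome, HORef.NomEquiv K.repo.keys χ χ' ∧
        (HORef.Form.and φ (HORef.Assignment.form σ₀)).Entails I
          (HORef.Form.eq (HORef.pv ret) χ.toExpr) := by
  have h := HORef.Config.eval_iff_exists_entails (I := I) G hvalid hground hσ₀
    (by rw [htrans]; exact hfresh) hclosing hχ'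
  rw [htrans] at h
  exact h
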